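/- Let $(M,\varphi,\xi,\eta,g)$ be a paracontact metric manifold of dimension $2n+1$. That is, $M$ is a connected smooth $(2n+1)$-dimensional manifold (Hausdorff, second countable), $\eta$ is a contact form on $M$ (a smooth 1-form with $\eta\wedge(d\eta)^n\neq 0$ everywhere), $\xi$ is its Reeb vector field (the vector field with $\eta(\xi)=1$ and $d\eta(\xi,\cdot)=0$), $\varphi$ is a smooth $(1,1)$-tensor field, and $g$ is a smooth semi-Riemannian metric such that $$\eta=g(\xi,\cdot),\qquad d\eta(\cdot,\cdot)=g(\cdot,\varphi\,\cdot),\qquad \varphi^2=I-\eta\otimes\xi,$$ where $d\eta(X,Y)=\tfrac12\big(X(\eta(Y))-Y(\eta(X))-\eta([X,Y])\big)$. For a smooth vector field $V$ and a relatively compact open set $D\subseteq M$, let $$E_D(V)=\frac12\int_D \mathrm{tr}_g(V^*g^s)\,dv$$ be the energy over $D$ of the map $V:(M,g)\to(TM,g^s)$, where $g^s$ is the Sasaki metric and $dv$ the volume measure of $g$. For a real number $r\neq 0$, a smooth vector field $V$ with $g(V,V)=r$ is called harmonic if it is a critical point of the energy among the vector fields of the same constant length: for every relatively compact open $D\subseteq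 M$ and every smooth variation $(V_t)_{|t|<\varepsilon}$ with $V_0=V$, $g(V_t,V_t)=r$ for all $t$, and $V_t=V$ outside a compact subset of $D$ independent of $t$, one has $\frac{d}{dt}\big|_{t=0}E_D(V_t)=0$. The manifold $M$ is called $H$-paracontact if $\xi$ is a harmonic vector field. Let $Q$ be the Ricci operator of $g$, defined by $g(QX,Y)=\varrho(X,Y)$, where $\varrho(X,Y)=\mathrm{tr}\,(Z\mapsto R(X,Z)Y)$ is the Ricci tensor, $R(X,Y)=\nabla_{[X,Y]}-[\nabla_X,\nabla_Y]$ and $\nabla$ is the Levi-Civita connection. Then $M$ is $H$-paracontact if and only if $\xi$ is an eigenvector of $Q$, i.e. there is a function $\mu:M\to\mathbb R$ with $Q\xi=\mu\,\xi$ at every point of $M$. -/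

import Mathlib

open scoped Manifold ContDiff

noncomputable section

namespace SemiRiemannian

open Bundle MeasureTheory VectorField

/-- The model space of `m`-dimensional manifolds. -/
abbrev Model (m : ℕ) : Type := EuclideanSpace ℝ (Fin m)

/-- A smooth semi-Riemannian metric on an `m`-dimensional smooth manifold: a smooth field of
symmetric nondegenerate bilinear forms on the tangent spaces, of arbitrary signature. -/
structure Metric (m : ℕ) (M : Type*) [TopologicalSpace M] [ChartedSpace (Model m) M]
    [IsManifold (𝓡 m) ∞ M] where
  /-- The bilinear form on each tangent space. -/
  val : ∀ x : M, TangentSpace (𝓡 m) x →L[ℝ] TangentSpace (𝓡 m) x →L[ℝ] ℝ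
  symm : ∀ (x : M) (u v : TangentSpace (𝓡 m) x), val x u v = val x v u
  nondegenerate : ∀ (x : M) (u : TangentSpace (𝓡 m) x), (∀ v, val x u v = 0) → u = 0
  contMDiff : ContMDiff (𝓡 m) ((𝓡 m).prod 𝓘(ℝ, Model m →L[ℝ] Model m →L[ℝ] ℝ)) ∞
    (fun x ↦ TotalSpace.mk' (Model m →L[ℝ] Model m →L[ℝ] ℝ)
      (E := fun x : M ↦ TangentSpace (𝓡 m) x →L[ℝ] TangentSpace (𝓡 m) x →L[ℝ] ℝ) x (val x))

variable {m : ℕ} {M : Type*} [TopologicalSpace M] [ChartedSpace (Model m) M]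
  [IsManifold (𝓡 m) ∞ M]

instance (x : M) : FiniteDimensional ℝ (TangentSpace (𝓡 m) x) :=
  inferInstanceAs (FiniteDimensional ℝ (Model m))

instance (x : M) : T2Space (TangentSpace (𝓡 m) x) :=
  inferInstanceAs (T2Space (Model m))

namespace Metric

variable (g : Metric m M)

/-- The metric at a point as an algebraic bilinear form. -/
def bilin (x : M) : LinearMap.BilinForm ℝ (TangentSpace (𝓡 m) x) :=
  LinearMap.mk₂ ℝ (fun u v ↦ g.val x u v) (by simp) (by simp) (by simp) (by simp)

@[simp] lemma bilin_apply (x : M) (u v : TangentSpace (𝓡 m) x) :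
    g.bilin x u v = g.val x u v := rfl

lemma bilin_nondegenerate (x : M) : (g.bilin x).Nondegenerate := by
  refine ⟨fun u hu ↦ g.nondegenerate x u hu, fun u hu ↦ g.nondegenerate x u fun v ↦ ?_⟩
  rw [g.symm]
  exact hu v

/-- The musical isomorphism `T_xM ≃ (T_xM)*`, `u ↦ g(u, ·)`. -/
def flat (x : M) : TangentSpace (𝓡 m) x ≃ₗ[ℝ] Module.Dual ℝ (TangentSpace (𝓡 m) x) :=
  (g.bilin x).toDual (g.bilin_nondegenerate x)

/-- The metric trace `tr_g B` of a bilinear form `B` on `T_xM`, i.e. the trace of the endomorphism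
`A` with `g(A u, v) = B(u, v)`; equivalently `∑ ε_i B(E_i, E_i)` in a pseudo-orthonormal basis. -/
def tr (x : M) (B : LinearMap.BilinForm ℝ (TangentSpace (𝓡 m) x)) : ℝ :=
  LinearMap.trace ℝ _ ((g.flat x).symm.toLinearMap ∘ₗ B)

lemma mdifferentiableAt_apply {X Y : ∀ x : M, TangentSpace (𝓡 m) x} {x : M}
    (hX : MDifferentiableAt (𝓡 m) (𝓡 m).tangent (T% X) x)
    (hY : MDifferentiableAt (𝓡 m) (𝓡 m).tangent (T% Y) x) :
    MDifferentiableAt (𝓡 m) 𝓘(ℝ, ℝ) (fun p ↦ g.val p (X p) (Y p)) x := by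
  have h : MDifferentiableAt (𝓡 m) ((𝓡 m).prod 𝓘(ℝ, ℝ))
      (fun p ↦ TotalSpace.mk' ℝ (E := Bundle.Trivial M ℝ) p (g.val p (X p) (Y p))) x := by
    apply MDifferentiableAt.clm_bundle_apply₂ (F₁ := Model m) (F₂ := Model m)
    · exact (g.contMDiff x).mdifferentiableAt (by simp)
    · exact hX
    · exact hY
  simp only [mdifferentiableAt_totalSpace] at h
  exact h.2

/-- The Koszul expression, equal to `2 g(∇_X Y, Z)`. -/
def koszul (X Y Z : ∀ x : M, TangentSpace (𝓡 m) x) (x : M) : ℝ :=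
  mvfderiv (𝓡 m) (fun p ↦ g.val p (Y p) (Z p)) x (X x)
    + mvfderiv (𝓡 m) (fun p ↦ g.val p (X p) (Z p)) x (Y x)
    - mvfderiv (𝓡 m) (fun p ↦ g.val p (X p) (Y p)) x (Z x)
    + g.val x (mlieBracket (𝓡 m) X Y x) (Z x)
    - g.val x (mlieBracket (𝓡 m) X Z x) (Y x)
    - g.val x (mlieBracket (𝓡 m) Y Z x) (X x)

lemma koszul_tensorial_left {Y Z : ∀ x : M, TangentSpace (𝓡 m) x} {x : M}
    (hY : MDifferentiableAt (𝓡 m) (𝓡 m).tangent (T% Y) x)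
    (hZ : MDifferentiableAt (𝓡 m) (𝓡 m).tangent (T% Z) x) :
    TensorialAt (𝓡 m) (Model m) (fun X ↦ g.koszul X Y Z x) x where
  smul {f X} hf hX := by
    have h₁ := mvfderiv_fun_mul hf (g.mdifferentiableAt_apply hX hZ)
    have h₂ := mvfderiv_fun_mul hf (g.mdifferentiableAt_apply hX hY)
    simp [koszul, h₁, h₂, mlieBracket_smul_left hf hX]
    rw [g.symm x (X x) (Y x), g.symm x (X x) (Z x)] 
    ring
  add {X X'} hX hX' := by
    have h₁ := mvfderiv_fun_add (g.mdifferentiableAt_apply hX hZ) (g.mdifferentiableAt_apply hX' hZ)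
    have h₂ := mvfderiv_fun_add (g.mdifferentiableAt_apply hX hY) (g.mdifferentiableAt_apply hX' hY)
    simp [koszul, h₁, h₂, mlieBracket_add_left hX hX']
    ring

lemma koszul_tensorial_right {X Y : ∀ x : M, TangentSpace (𝓡 m) x} {x : M}
    (hX : MDifferentiableAt (𝓡 m) (𝓡 m).tangent (T% X) x)
    (hY : MDifferentiableAt (𝓡 m) (𝓡 m).tangent (T% Y) x) :
    TensorialAt (𝓡 m) (Model m) (fun Z ↦ g.koszul X Y Z x) x where
  smul {f Z} hf hZ := by
    have h₁ := mvfderiv_fun_mul hf (g.mdifferentiableAt_apply hX hZ)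
    have h₂ := mvfderiv_fun_mul hf (g.mdifferentiableAt_apply hY hZ)
    simp [koszul, h₁, h₂, mlieBracket_smul_right hf hZ]
    rw [g.symm x (Z x) (X x), g.symm x (Z x) (Y x)] 
    ring
  add {Z Z'} hZ hZ' := by
    have h₁ := mvfderiv_fun_add (g.mdifferentiableAt_apply hX hZ) (g.mdifferentiableAt_apply hX hZ')
    have h₂ := mvfderiv_fun_add (g.mdifferentiableAt_apply hY hZ) (g.mdifferentiableAt_apply hY hZ')
    simp [koszul, h₁, h₂, mlieBracket_add_right hZ hZ']
    ring

lemma koszul_add {X Y Y' Z : ∀ x : M, TangentSpace (𝓡 m) x} {x : M}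
    (hX : MDifferentiableAt (𝓡 m) (𝓡 m).tangent (T% X) x)
    (hY : MDifferentiableAt (𝓡 m) (𝓡 m).tangent (T% Y) x)
    (hY' : MDifferentiableAt (𝓡 m) (𝓡 m).tangent (T% Y') x)
    (hZ : MDifferentiableAt (𝓡 m) (𝓡 m).tangent (T% Z) x) :
    g.koszul X (Y + Y') Z x = g.koszul X Y Z x + g.koszul X Y' Z x := by
  have h₁ := mvfderiv_fun_add (g.mdifferentiableAt_apply hY hZ) (g.mdifferentiableAt_apply hY' hZ)
  have h₂ := mvfderiv_fun_add (g.mdifferentiableAt_apply hX hY) (g.mdifferentiableAt_apply hX hY')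
  simp [koszul, h₁, h₂, mlieBracket_add_right hY hY', mlieBracket_add_left hY hY']
  ring

lemma koszul_smul {f : M → ℝ} {X Y Z : ∀ x : M, TangentSpace (𝓡 m) x} {x : M}
    (hX : MDifferentiableAt (𝓡 m) (𝓡 m).tangent (T% X) x)
    (hY : MDifferentiableAt (𝓡 m) (𝓡 m).tangent (T% Y) x)
    (hf : MDifferentiableAt (𝓡 m) 𝓘(ℝ, ℝ) f x)
    (hZ : MDifferentiableAt (𝓡 m) (𝓡 m).tangent (T% Z) x) :
    g.koszul X (f • Y) Z x
      = f x * g.koszul X Y Z x + 2 * (mvfderiv (𝓡 m) f x (X x) * g.val x (Y x) (Z x)) := by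
  have h₁ := mvfderiv_fun_mul hf (g.mdifferentiableAt_apply hY hZ)
  have h₂ := mvfderiv_fun_mul hf (g.mdifferentiableAt_apply hX hY)
  simp [koszul, h₁, h₂, mlieBracket_smul_right hf hY, mlieBracket_smul_left hf hY]
  rw [g.symm x (Y x) (X x)]
  ring

/-- For a vector field `Y` differentiable at `x`, the bilinear form `(u, w) ↦ 2 g(∇_u Y, w)` on
`T_xM` given by the Koszul formula. -/
def koszulForm (Y : ∀ x : M, TangentSpace (𝓡 m) x) (x : M)
    (hY : MDifferentiableAt (𝓡 m) (𝓡 m).tangent (T% Y) x) :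
    TangentSpace (𝓡 m) x →L[ℝ] TangentSpace (𝓡 m) x →L[ℝ] ℝ :=
  TensorialAt.mkHom₂ (I := 𝓡 m) (F := Model m) (F' := Model m) (fun X Z ↦ g.koszul X Y Z x) x
    (fun _ hZ ↦ g.koszul_tensorial_left hY hZ) (fun _ hX ↦ g.koszul_tensorial_right hX hY)

lemma koszulForm_apply {X Y Z : ∀ x : M, TangentSpace (𝓡 m) x} {x : M}
    (hX : MDifferentiableAt (𝓡 m) (𝓡 m).tangent (T% X) x)
    (hY : MDifferentiableAt (𝓡 m) (𝓡 m).tangent (T% Y) x)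
    (hZ : MDifferentiableAt (𝓡 m) (𝓡 m).tangent (T% Z) x) :
    g.koszulForm Y x hY (X x) (Z x) = g.koszul X Y Z x :=
  TensorialAt.mkHom₂_apply _ _ hX hZ

open Classical in
/-- The value at `x` of `u ↦ ∇_u Y`, where `∇` is the Levi-Civita connection, determined by the
Koszul formula. It is set to `0` if `Y` is not differentiable at `x`. -/
def nabla (Y : ∀ x : M, TangentSpace (𝓡 m) x) (x : M) :
    TangentSpace (𝓡 m) x →L[ℝ] TangentSpace (𝓡 m) x :=
  if hY : MDifferentiableAt (𝓡 m) (𝓡 m).tangent (T% Y) x then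
    LinearMap.toContinuousLinearMap ((g.flat x).symm.toLinearMap ∘ₗ
      LinearMap.mk₂ ℝ (fun u w ↦ (1 / 2 : ℝ) * g.koszulForm Y x hY u w)
        (by intros; simp; ring) (by intros; simp; ring)
        (by intros; simp; ring) (by intros; simp; ring))
  else 0

lemma val_nabla {X Y Z : ∀ x : M, TangentSpace (𝓡 m) x} {x : M}
    (hX : MDifferentiableAt (𝓡 m) (𝓡 m).tangent (T% X) x)
    (hY : MDifferentiableAt (𝓡 m) (𝓡 m).tangent (T% Y) x)
    (hZ : MDifferentiableAt (𝓡 m) (𝓡 m).tangent (T% Z) x) :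
    g.val x (g.nabla Y x (X x)) (Z x) = (1 / 2 : ℝ) * g.koszul X Y Z x := by
  have h : g.flat x (g.nabla Y x (X x)) (Z x) = (1 / 2 : ℝ) * g.koszulForm Y x hY (X x) (Z x) := by
    simp [nabla, hY]
  rw [← g.koszulForm_apply hX hY hZ, ← h]
  rfl

/-- The Levi-Civita connection of `g`. -/
def leviCivita : CovariantDerivative (𝓡 m) (Model m) (fun x : M ↦ TangentSpace (𝓡 m) x) where
  toFun := g.nabla
  isCovariantDerivativeOnUniv :=
    { add := by
        intro Y Y' x hY hY' _
        ext1 u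
        refine (g.flat x).injective (LinearMap.ext fun w ↦ ?_)
        have hX := FiberBundle.mdifferentiableAt_extend (𝓡 m) (Model m) u
        have hZ := FiberBundle.mdifferentiableAt_extend (𝓡 m) (Model m) w
        have h₁ := g.val_nabla hX hY hZ
        have h₂ := g.val_nabla hX hY' hZ
        have h₃ := g.val_nabla hX (mdifferentiableAt_add_section hY hY') hZ
        have h₄ := g.koszul_add hX hY hY' hZ
        simp only [FiberBundle.extend_apply_self] at h₁ h₂ h₃
        change g.val x _ w = g.val x _ w
        erw [h₃]
        simp [h₁, h₂, h₄]
        ring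
      leibniz := by
        intro Y f x hY hf _
        ext1 u
        refine (g.flat x).injective (LinearMap.ext fun w ↦ ?_)
        have hX := FiberBundle.mdifferentiableAt_extend (𝓡 m) (Model m) u
        have hZ := FiberBundle.mdifferentiableAt_extend (𝓡 m) (Model m) w
        have h₁ := g.val_nabla hX hY hZ
        have h₃ := g.val_nabla hX (hf.smul_section hY) hZ
        have h₄ := g.koszul_smul hX hY hf hZ
        simp only [FiberBundle.extend_apply_self] at h₁ h₃ h₄
        change g.val x _ w = g.val x _ w
        erw [h₃, h₄]
        simp [h₁]
        ring }

/-! ### Curvature -/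

/-- The curvature `R(X, Y) Z = ∇_{[X, Y]} Z - [∇_X, ∇_Y] Z` on vector fields. -/
def curvature (X Y Z : ∀ x : M, TangentSpace (𝓡 m) x) (x : M) : TangentSpace (𝓡 m) x :=
  g.leviCivita Z x (mlieBracket (𝓡 m) X Y x)
    - (g.leviCivita (fun p ↦ g.leviCivita Z p (Y p)) x (X x)
      - g.leviCivita (fun p ↦ g.leviCivita Z p (X p)) x (Y x))

end Metric

/-- The coordinate vector field `∂_i` of the preferred chart at `x`, a smooth field on the domain of
this chart (and zero elsewhere). -/
def coordField (x : M) (i : Fin m) : ∀ p : M, TangentSpace (𝓡 m) p :=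
  (trivializationAt (Model m) (fun p : M ↦ TangentSpace (𝓡 m) p) x).localFrame
    (EuclideanSpace.basisFun (Fin m) ℝ).toBasis i

/-- The basis `(∂_i)` of `T_xM` given by the preferred chart at `x`. -/
def coordBasis (x : M) : Module.Basis (Fin m) ℝ (TangentSpace (𝓡 m) x) :=
  (trivializationAt (Model m) (fun p : M ↦ TangentSpace (𝓡 m) p) x).basisAt
    (EuclideanSpace.basisFun (Fin m) ℝ).toBasis (FiberBundle.mem_baseSet_trivializationAt' x)

namespace Metric

variable (g : Metric m M)

/-- The Ricci tensor at `x`: the bilinear form `ρ(u, v) = tr (w ↦ R(u, w) v)`, given by its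
components `ρ_ij = ∑ k, (R(∂_i, ∂_k) ∂_j)^k` in the coordinate frame. -/
def ricci (x : M) : LinearMap.BilinForm ℝ (TangentSpace (𝓡 m) x) :=
  Matrix.toBilin (coordBasis x) (Matrix.of fun i j ↦
    ∑ k, (coordBasis x).repr
      (g.curvature (coordField x i) (coordField x k) (coordField x j) x) k)

/-- The Ricci operator `Q`, with `g(Q u, v) = ρ(u, v)`. -/
def ricciOperator (x : M) : Module.End ℝ (TangentSpace (𝓡 m) x) :=
  (g.flat x).symm.toLinearMap ∘ₗ g.ricci x

/-! ### The Sasaki metric -/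

/-- The connection map `K : T_p(TM) → T_xM` of the Levi-Civita connection, at `p = (x, v)`. In the
bundle coordinates of `TM` induced by the preferred chart at `x` it is
`(ẋ, v̇) ↦ v̇ + Γ(ẋ, v)`, where `Γ(a, v)` is the covariant derivative at `x`, in direction `a`, of
the field with constant coordinates equal to those of `v`. -/
def connectionMap (p : TangentBundle (𝓡 m) M) :
    TangentSpace (𝓡 m).tangent p →L[ℝ] TangentSpace (𝓡 m) p.1 :=
  (trivializationAt (Model m) (fun x : M ↦ TangentSpace (𝓡 m) x) p.1).symmL ℝ p.1 ∘L
      (mfderiv (𝓡 m).tangent 𝓘(ℝ, Model m)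
        (fun q : TangentBundle (𝓡 m) M ↦
          (trivializationAt (Model m) (fun x : M ↦ TangentSpace (𝓡 m) x) p.1 q).2) p)
    + g.leviCivita (FiberBundle.extend (Model m) p.2) p.1 ∘L
      mfderiv (𝓡 m).tangent (𝓡 m)
        (TotalSpace.proj : TangentBundle (𝓡 m) M → M) p

/-- The Sasaki metric `g^s(A, B) = g(dπ A, dπ B) + g(K A, K B)` on `TM`. -/
def sasaki (p : TangentBundle (𝓡 m) M) :
    LinearMap.BilinForm ℝ (TangentSpace (𝓡 m).tangent p) :=
  (g.bilin p.1).compl₁₂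
      (mfderiv (𝓡 m).tangent (𝓡 m)
        (TotalSpace.proj : TangentBundle (𝓡 m) M → M) p).toLinearMap
      (mfderiv (𝓡 m).tangent (𝓡 m)
        (TotalSpace.proj : TangentBundle (𝓡 m) M → M) p).toLinearMap
    + (g.bilin p.1).compl₁₂ (g.connectionMap p).toLinearMap (g.connectionMap p).toLinearMap

/-- The pullback `V^* g^s` of the Sasaki metric by a vector field `V : M → TM`. -/
def pullbackSasaki (V : ∀ x : M, TangentSpace (𝓡 m) x) (x : M) :
    LinearMap.BilinForm ℝ (TangentSpace (𝓡 m) x) :=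
  (g.sasaki (TotalSpace.mk' (Model m) x (V x))).compl₁₂
    (mfderiv (𝓡 m) (𝓡 m).tangent (T% V) x).toLinearMap
    (mfderiv (𝓡 m) (𝓡 m).tangent (T% V) x).toLinearMap

/-! ### Volume and energy -/

/-- The function `|det (g(∂_i, ∂_j))|^{1/2}` of the preferred chart at `x`, at the point `p`. -/
def volumeDensity (x p : M) : ℝ :=
  √|(Matrix.of fun i j : Fin m ↦ g.val p (coordField x i p) (coordField x j p)).det|

variable [MeasurableSpace M]

/-- The measure `|det g|^{1/2} dx^1 ⋯ dx^m` on the domain of the preferred chart at `x`, as a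
measure on `M` vanishing outside this domain. -/
def chartVolume (x : M) : Measure M :=
  (((volume : Measure (Model m)).restrict (chartAt (Model m) x).target).withDensity
    (fun y ↦ ENNReal.ofReal (g.volumeDensity x ((chartAt (Model m) x).symm y)))).map
    (chartAt (Model m) x).symm

/-- The semi-Riemannian volume measure `dv`: the measure which on the domain of each chart is
`|det g|^{1/2} dx^1 ⋯ dx^m`. As these chart measures agree on overlaps, it is their supremum. -/
def volumeMeasure : Measure M := ⨆ x : M, g.chartVolume x

/-- The energy of `V : (M, g) → (TM, g^s)` over the domain `D`. -/
def energy (D : Set M) (V : ∀ x : M, TangentSpace (𝓡 m) x) : ℝ :=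
  (1 / 2 : ℝ) * ∫ x in D, g.tr x (g.pullbackSasaki V x) ∂g.volumeMeasure

/-- `V` belongs to `𝔛^r(M)`: it has constant length `‖V‖² = r`. -/
def HasLength (V : ∀ x : M, TangentSpace (𝓡 m) x) (r : ℝ) : Prop :=
  ∀ x, g.val x (V x) (V x) = r

/-- `V` is a harmonic vector field: it is smooth, has constant length `r ≠ 0`, and is a critical
point of the energy among the vector fields of length `r`. That is, for each relatively compact
domain `D` and each smooth variation `(V_t)`, `|t| < ε`, of `V` through vector fields of length `r`,
which is supported in a compact subset of `D`, the derivative of the energy over `D` vanishes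
at `t = 0`. -/
def IsHarmonic (V : ∀ x : M, TangentSpace (𝓡 m) x) : Prop :=
  ContMDiff (𝓡 m) (𝓡 m).tangent ∞ (T% V) ∧
  ∃ r : ℝ, r ≠ 0 ∧ g.HasLength V r ∧
    ∀ D : Set M, IsOpen D → IsCompact (closure D) →
    ∀ ε : ℝ, 0 < ε → ∀ W : ℝ → ∀ x : M, TangentSpace (𝓡 m) x,
      ContMDiffOn (𝓘(ℝ, ℝ).prod (𝓡 m)) (𝓡 m).tangent ∞
        (fun q : ℝ × M ↦ TotalSpace.mk' (Model m) (E := fun x : M ↦ TangentSpace (𝓡 m) x)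
          q.2 (W q.1 q.2)) (Set.Ioo (-ε) ε ×ˢ Set.univ) →
      W 0 = V →
      (∀ t ∈ Set.Ioo (-ε) ε, g.HasLength (W t) r) →
      (∃ K ⊆ D, IsCompact K ∧ ∀ t ∈ Set.Ioo (-ε) ε, ∀ x ∉ K, W t x = V x) →
      HasDerivAt (fun t ↦ g.energy D (W t)) 0 0

end Metric

/-! ### Paracontact metric structures -/

/-- The exterior derivative `dη` of a 1-form, with the normalization usual in contact geometry:
`dη(X, Y) = ½ (X (η Y) - Y (η X) - η [X, Y])`. This expression depends on `X` and `Y` only through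
their values at the point, so it is evaluated on arbitrary extensions of tangent vectors. -/
def extDeriv (η : ∀ x : M, TangentSpace (𝓡 m) x →L[ℝ] ℝ) (x : M)
    (u v : TangentSpace (𝓡 m) x) : ℝ :=
  (1 / 2 : ℝ) *
    (mvfderiv (𝓡 m) (fun p ↦ η p (FiberBundle.extend (Model m) v p)) x u
      - mvfderiv (𝓡 m) (fun p ↦ η p (FiberBundle.extend (Model m) u p)) x v
      - η x (mlieBracket (𝓡 m) (FiberBundle.extend (Model m) u)
          (FiberBundle.extend (Model m) v) x))

/-- `η ∧ (dη)^n ≠ 0` at every point, for a 1-form `η` on a manifold of dimension `2n+1`. The sum is,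
up to a nonzero constant factor, the value of `η ∧ (dη)^n` on the vectors `v_0, …, v_{2n}`. -/
def IsContactForm {n : ℕ} {M : Type*} [TopologicalSpace M] [ChartedSpace (Model (2 * n + 1)) M]
    [IsManifold (𝓡 (2 * n + 1)) ∞ M]
    (η : ∀ x : M, TangentSpace (𝓡 (2 * n + 1)) x →L[ℝ] ℝ) : Prop :=
  ∀ x : M, ∃ v : Fin (2 * n + 1) → TangentSpace (𝓡 (2 * n + 1)) x,
    ∑ σ : Equiv.Perm (Fin (2 * n + 1)), ((Equiv.Perm.sign σ : ℤ) : ℝ) *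
      (η x (v (σ 0)) * ∏ i : Fin n, extDeriv η x
        (v (σ ⟨2 * i.val + 1, by omega⟩)) (v (σ ⟨2 * i.val + 2, by omega⟩))) ≠ 0

/-- A paracontact metric structure `(φ, ξ, η, g)` on a manifold of dimension `2n+1`: a contact form
`η` with Reeb vector field `ξ`, and an associated semi-Riemannian metric `g` with tensor `φ`. -/
structure ParacontactMetricStructure (n : ℕ) (M : Type*) [TopologicalSpace M]
    [ChartedSpace (Model (2 * n + 1)) M] [IsManifold (𝓡 (2 * n + 1)) ∞ M] where
  /-- The tensor of type `(1,1)`. -/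
  φ : ∀ x : M, TangentSpace (𝓡 (2 * n + 1)) x →L[ℝ] TangentSpace (𝓡 (2 * n + 1)) x
  /-- The Reeb vector field. -/
  ξ : ∀ x : M, TangentSpace (𝓡 (2 * n + 1)) x
  /-- The contact form. -/
  η : ∀ x : M, TangentSpace (𝓡 (2 * n + 1)) x →L[ℝ] ℝ
  /-- The associated metric. -/
  g : Metric (2 * n + 1) M
  contMDiff_φ : ContMDiff (𝓡 (2 * n + 1))
    ((𝓡 (2 * n + 1)).prod 𝓘(ℝ, Model (2 * n + 1) →L[ℝ] Model (2 * n + 1))) ∞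
    (fun x ↦ TotalSpace.mk' (Model (2 * n + 1) →L[ℝ] Model (2 * n + 1))
      (E := fun x : M ↦ TangentSpace (𝓡 (2 * n + 1)) x →L[ℝ] TangentSpace (𝓡 (2 * n + 1)) x)
      x (φ x))
  contMDiff_ξ : ContMDiff (𝓡 (2 * n + 1)) (𝓡 (2 * n + 1)).tangent ∞ (T% ξ)
  contMDiff_η : ContMDiff (𝓡 (2 * n + 1))
    ((𝓡 (2 * n + 1)).prod 𝓘(ℝ, Model (2 * n + 1) →L[ℝ] ℝ)) ∞
    (fun x ↦ TotalSpace.mk' (Model (2 * n + 1) →L[ℝ] ℝ)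
      (E := fun x : M ↦ TangentSpace (𝓡 (2 * n + 1)) x →L[ℝ] ℝ) x (η x))
  isContactForm : IsContactForm η
  η_ξ : ∀ x, η x (ξ x) = 1
  extDeriv_ξ : ∀ x v, extDeriv η x (ξ x) v = 0
  η_eq : ∀ x v, η x v = g.val x (ξ x) v
  extDeriv_eq : ∀ x u v, extDeriv η x u v = g.val x u (φ x v)
  φ_φ : ∀ x v, φ x (φ x v) = v - η x v • ξ x

namespace ParacontactMetricStructure

variable {n : ℕ} {M : Type*} [TopologicalSpace M] [ChartedSpace (Model (2 * n + 1)) M]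
  [IsManifold (𝓡 (2 * n + 1)) ∞ M]

/-- A paracontact metric manifold is H-paracontact if its Reeb vector field is harmonic. -/
def IsHParacontact [MeasurableSpace M] (S : ParacontactMetricStructure n M) : Prop :=
  S.g.IsHarmonic S.ξ

/-- The Reeb vector field is an eigenvector of the Ricci operator (at every point, with an
eigenvalue which may depend on the point). -/
def IsRicciEigenvector (S : ParacontactMetricStructure n M) : Prop :=
  ∃ μ : M → ℝ, ∀ x, (S.g.ricciOperator x).HasEigenvector (μ x) (S.ξ x)

end ParacontactMetricStructure

end SemiRiemannian

end

/-!
# Harmonicity of the Reeb vector field of a paracontact metric manifold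

By the definition of the Sasaki metric, the energy density of a vector field `V` is
`m + tr_g g(∇V, ∇V)` (`SemiRiemannian.Metric.tr_pullbackSasaki`), so the derivative of the energy
along a variation `(W_t)` of `ξ` through unit fields, with variation field `Z`, is
`∫ tr_g g(∇Z, ∇ξ) dv`; the constraint on the length says that `Z` is orthogonal to `ξ`.

On a paracontact metric manifold the `g`-adjoint of `∇ξ` is `∇ξ + 2φ`, because `η = g(ξ, ·)` and
`dη = g(·, φ ·)`. The form `dη` is closed and `φ² = I - η ⊗ ξ`; together these imply that `ξ` is
divergence free and that the divergence of `φ` vanishes on vectors orthogonal to `ξ`. With the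
Ricci identity for `∇∇ξ` this gives the pointwise formula
`tr_g g(∇Z, ∇ξ) = div ((∇ξ + 2φ) Z) - ρ(ξ, Z)` for `Z` orthogonal to `ξ`
(`SemiRiemannian.LocalParacontact.div_adj_nabla`). By the
divergence theorem (`SemiRiemannian.Metric.integral_divergence`), the first variation at `ξ` is
therefore `-∫ ρ(ξ, Z) dv` (`SemiRiemannian.ParacontactMetricStructure.hasDerivAt_energy`).

If `Q ξ = μ ξ`, then `ρ(ξ, Z) = μ g(ξ, Z) = 0` and `ξ` is harmonic. Conversely, every compactly
supported `Z` orthogonal to `ξ` is the variation field of `(ξ + t Z) / |ξ + t Z|`, so that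
harmonicity forces `ρ(ξ, ·)` to vanish on the orthogonal complement of `ξ`, i.e.
`Q ξ = ρ(ξ, ξ) ξ`.

All local computations are made in charts: `SemiRiemannian.LocalMetric` and
`SemiRiemannian.LocalParacontact` are the coordinate expressions of the structures, and the lemmas
named `…inChart…`, `toChart…`, `hat…` compare them with the invariant objects.
-/

noncomputable section

namespace SemiRiemannian

set_option maxSynthPendingDepth 3

open Bundle Module Set Filter Topology MeasureTheory VectorField

/-! ### Traces and adjoints of endomorphisms -/

section Trace

variable {E : Type*} [NormedAddCommGroup E] [NormedSpace ℝ E] [FiniteDimensional ℝ E]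

variable (E) in
/-- The trace of a continuous endomorphism, as a continuous linear form. -/
def traceCLM : (E →L[ℝ] E) →L[ℝ] ℝ :=
  LinearMap.toContinuousLinearMap (LinearMap.trace ℝ E ∘ₗ ContinuousLinearMap.coeLM ℝ)

lemma traceCLM_apply (T : E →L[ℝ] E) : traceCLM E T = LinearMap.trace ℝ E T.toLinearMap := rfl

lemma traceCLM_comp_comm (S T : E →L[ℝ] E) : traceCLM E (S ∘L T) = traceCLM E (T ∘L S) := by
  simp only [traceCLM_apply, ContinuousLinearMap.toLinearMap_comp]
  exact LinearMap.trace_comp_comm' _ _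

lemma traceCLM_smulRight (f : E →L[ℝ] ℝ) (x : E) : traceCLM E (f.smulRight x) = f x := by
  rw [traceCLM_apply]
  exact LinearMap.trace_smulRight _ _

lemma traceCLM_eq_sum {ι : Type*} [Fintype ι] [DecidableEq ι] (b : Basis ι ℝ E) (T : E →L[ℝ] E) :
    traceCLM E T = ∑ i, b.repr (T (b i)) i := by
  rw [traceCLM_apply, LinearMap.trace_eq_matrix_trace ℝ b, Matrix.trace]
  simp [LinearMap.toMatrix_apply]

/-- Endomorphisms which are adjoint for a nondegenerate bilinear form have the same trace. -/
lemma traceCLM_eq_of_adjoint {B : E →L[ℝ] E →L[ℝ] ℝ} (hB : ∀ u, (∀ v, B u v = 0) → u = 0)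
    {S T : E →L[ℝ] E} (h : ∀ u v, B (S u) v = B u (T v)) : traceCLM E S = traceCLM E T := by
  have hinj : Function.Injective (ContinuousLinearMap.coeLM ℝ ∘ₗ B.toLinearMap :
      E →ₗ[ℝ] Dual ℝ E) := by
    rw [← LinearMap.ker_eq_bot, LinearMap.ker_eq_bot']
    intro u hu
    exact hB u fun v ↦ by simpa using LinearMap.congr_fun hu v
  let e : E ≃ₗ[ℝ] Dual ℝ E := LinearEquiv.ofInjectiveOfFinrankEq _ hinj
    (Subspace.dual_finrank_eq).symm
  have he : ∀ u v, e u v = B u v := fun u v ↦ rfl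
  rw [traceCLM_apply, traceCLM_apply, ← LinearMap.trace_transpose' T.toLinearMap,
    ← LinearMap.trace_conj' S.toLinearMap e]
  congr 1
  ext f v
  obtain ⟨u, rfl⟩ := e.surjective f
  have h₁ : (Dual.transpose T.toLinearMap) (e u) v = e u (T v) := rfl
  rw [h₁]
  simp [LinearEquiv.conj_apply, he, h]

/-- An injective map to the dual of a finite-dimensional space is invertible. -/
lemma isInvertible_of_nondegenerate {B : E →L[ℝ] E →L[ℝ] ℝ}
    (hB : ∀ u, (∀ v, B u v = 0) → u = 0) : B.IsInvertible := by
  have hinj : Function.Injective B.toLinearMap := by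
    rw [← LinearMap.ker_eq_bot, LinearMap.ker_eq_bot']
    intro u hu
    exact hB u fun v ↦ by simpa using DFunLike.congr_fun hu v
  have hdim : finrank ℝ E = finrank ℝ (E →L[ℝ] ℝ) := by
    rw [← LinearEquiv.finrank_eq (LinearMap.toContinuousLinearMap (E := E) (F' := ℝ) (𝕜 := ℝ))]
    exact (Subspace.dual_finrank_eq).symm
  exact ⟨(LinearEquiv.ofInjectiveOfFinrankEq _ hinj hdim).toContinuousLinearEquiv, by ext; rfl⟩

/-- The adjoint `S^*` of an endomorphism with respect to a bilinear form `B`, characterized by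
`B(S^* u, v) = B(u, S v)` when `B` is nondegenerate (and `0` otherwise). -/
def adj (B : E →L[ℝ] E →L[ℝ] ℝ) (S : E →L[ℝ] E) : E →L[ℝ] E :=
  B.inverse ∘L ((ContinuousLinearMap.compL ℝ E E ℝ).flip S ∘L B)

lemma adj_apply {B : E →L[ℝ] E →L[ℝ] ℝ} (hB : ∀ u, (∀ v, B u v = 0) → u = 0) (S : E →L[ℝ] E)
    (u v : E) : B (adj B S u) v = B u (S v) := by
  obtain ⟨e, he⟩ := isInvertible_of_nondegenerate hB
  have : B (adj B S u) = (B u).comp S := by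
    simp [adj, ← he]
  rw [this]; rfl

omit [FiniteDimensional ℝ E] in
lemma eq_of_forall_apply_eq {B : E →L[ℝ] E →L[ℝ] ℝ} (hB : ∀ u, (∀ v, B u v = 0) → u = 0)
    {u u' : E} (h : ∀ v, B u v = B u' v) : u = u' := by
  rw [← sub_eq_zero]
  exact hB _ fun v ↦ by simp [h]

/-- The metric trace `tr_B` of the bilinear form `(u, v) ↦ B(Su, Tv)`, i.e. the trace of `T^* S`. -/
def pairing (B : E →L[ℝ] E →L[ℝ] ℝ) (S T : E →L[ℝ] E) : ℝ := traceCLM E (adj B T ∘L S)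

lemma pairing_comm {B : E →L[ℝ] E →L[ℝ] ℝ} (hB : ∀ u, (∀ v, B u v = 0) → u = 0)
    (hs : ∀ u v, B u v = B v u) (S T : E →L[ℝ] E) : pairing B S T = pairing B T S := by
  refine traceCLM_eq_of_adjoint hB fun u v ↦ ?_
  simp only [ContinuousLinearMap.comp_apply]
  rw [adj_apply hB, hs, ← adj_apply hB, hs]

end Trace

/-! ### Semi-Riemannian metrics on open subsets of a vector space -/

/-- A smooth semi-Riemannian metric on a subset `Ω` of a vector space `E`, meant to be open: the
expression of a metric in a chart. Values outside `Ω` are irrelevant. -/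
structure LocalMetric {E : Type*} [NormedAddCommGroup E] [NormedSpace ℝ E] (Ω : Set E) where
  /-- The bilinear form at each point. -/
  G : E → E →L[ℝ] E →L[ℝ] ℝ
  contDiffOn : ContDiffOn ℝ ∞ G Ω
  symm : ∀ y ∈ Ω, ∀ u v, G y u v = G y v u
  nondegenerate : ∀ y ∈ Ω, ∀ u, (∀ v, G y u v = 0) → u = 0

namespace LocalMetric

variable {E : Type*} [NormedAddCommGroup E] [NormedSpace ℝ E]

section
variable {Ω : Set E} (γ : LocalMetric Ω)

/-- The Christoffel symbols of the first kind:
`½ (D_a G(b, c) + D_b G(a, c) - D_c G(a, b))`. -/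
def christoffelLower (y : E) : E →L[ℝ] E →L[ℝ] E →L[ℝ] ℝ :=
  (1 / 2 : ℝ) • (fderiv ℝ γ.G y + (fderiv ℝ γ.G y).flip
    - (ContinuousLinearMap.flipₗᵢ ℝ E E ℝ).toLinearIsometry.toContinuousLinearMap ∘L
      (fderiv ℝ γ.G y).flip)

lemma christoffelLower_apply (y a b c : E) :
    γ.christoffelLower y a b c = (1 / 2 : ℝ) * (fderiv ℝ γ.G y a b c + fderiv ℝ γ.G y b a c
      - fderiv ℝ γ.G y c a b) := by
  simp [christoffelLower]

/-- The Christoffel symbols: `Γ y a b` is the covariant derivative at `y`, in direction `a`, of the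
constant field `b`. -/
def Γ (y : E) : E →L[ℝ] E →L[ℝ] E :=
  ContinuousLinearMap.compL ℝ E (E →L[ℝ] ℝ) E (γ.G y).inverse ∘L γ.christoffelLower y

/-- The covariant derivative `u ↦ ∇_u V`. -/
def nabla (V : E → E) (y : E) : E →L[ℝ] E := fderiv ℝ V y + (γ.Γ y).flip (V y)

lemma nabla_apply (V : E → E) (y a : E) : γ.nabla V y a = fderiv ℝ V y a + γ.Γ y a (V y) := by
  simp [nabla]

/-- The covariant derivative `∇_w F` of a field of endomorphisms. -/
def nablaEnd (F : E → E →L[ℝ] E) (y w : E) : E →L[ℝ] E :=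
  fderiv ℝ F y w + γ.Γ y w ∘L F y - F y ∘L γ.Γ y w

/-- The curvature `R(a, b) c = ∇_{[a, b]} c - [∇_a, ∇_b] c`, computed on constant fields, whose
brackets vanish. -/
def curv (y a b : E) : E →L[ℝ] E :=
  fderiv ℝ γ.Γ y b a - fderiv ℝ γ.Γ y a b + γ.Γ y b ∘L γ.Γ y a - γ.Γ y a ∘L γ.Γ y b

end

variable [FiniteDimensional ℝ E] {Ω : Set E} (γ : LocalMetric Ω)

/-- The divergence of a vector field. -/
def div (V : E → E) (y : E) : ℝ := traceCLM E (γ.nabla V y)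

/-- The Ricci tensor `ρ(u, v) = tr (w ↦ R(u, w) v)`. -/
def ric (y u v : E) : ℝ :=
  traceCLM E (LinearMap.toContinuousLinearMap
    { toFun := fun w ↦ γ.curv y u w v
      map_add' := by intros; simp [curv]; abel
      map_smul' := by intros; simp [curv, smul_sub, smul_add] })

variable (hΩ : IsOpen Ω) {y : E} (hy : y ∈ Ω)
include hy

lemma G_Γ (a b c : E) : γ.G y (γ.Γ y a b) c = γ.christoffelLower y a b c := by
  obtain ⟨e, he⟩ := isInvertible_of_nondegenerate (γ.nondegenerate y hy)
  simp [Γ, ← he]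

include hΩ

omit [FiniteDimensional ℝ E] in
lemma contDiffAt_G : ContDiffAt ℝ ∞ γ.G y := γ.contDiffOn.contDiffAt (hΩ.mem_nhds hy)

omit [FiniteDimensional ℝ E] in
lemma contDiffAt_fderiv_G : ContDiffAt ℝ ∞ (fderiv ℝ γ.G) y :=
  (γ.contDiffAt_G hΩ hy).fderiv_right (m := ∞) (by simp)

lemma contDiffAt_inverse_G : ContDiffAt ℝ ∞ (fun z ↦ (γ.G z).inverse) y :=
  ((isInvertible_of_nondegenerate (γ.nondegenerate y hy)).contDiffAt_map_inverse).comp y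
    (γ.contDiffAt_G hΩ hy)

lemma contDiffAt_Γ : ContDiffAt ℝ ∞ γ.Γ y := by
  have h := γ.contDiffAt_fderiv_G hΩ hy
  have h' : ContDiffAt ℝ ∞ (fun z ↦ (fderiv ℝ γ.G z).flip) y :=
    (ContinuousLinearMap.flipₗᵢ ℝ E E (E →L[ℝ] ℝ)).contDiff.contDiffAt.comp y h
  have h₁ : ContDiffAt ℝ ∞ γ.christoffelLower y :=
    (contDiffAt_const (c := (1 / 2 : ℝ))).smul ((h.add h').sub (contDiffAt_const.clm_comp h'))
  exact (((ContinuousLinearMap.compL ℝ E (E →L[ℝ] ℝ) E).contDiff.contDiffAt.comp y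
    (γ.contDiffAt_inverse_G hΩ hy))).clm_comp h₁

omit [FiniteDimensional ℝ E] in
lemma fderiv_G_symm (a b c : E) : fderiv ℝ γ.G y a b c = fderiv ℝ γ.G y a c b := by
  have hd := (γ.contDiffAt_G hΩ hy).differentiableAt (by simp)
  have h₁ : ∀ b c, fderiv ℝ (fun z ↦ γ.G z b c) y a = fderiv ℝ γ.G y a b c := fun b c ↦ by
    rw [fderiv_clm_apply (by fun_prop) (by fun_prop), fderiv_clm_apply (by fun_prop) (by fun_prop)]
    simp
  rw [← h₁, ← h₁]
  have : (fun z ↦ γ.G z b c) =ᶠ[𝓝 y] fun z ↦ γ.G z c b := by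
    filter_upwards [hΩ.mem_nhds hy] with z hz using γ.symm z hz b c
  rw [this.fderiv_eq]

/-- The Levi-Civita connection is torsion free. -/
lemma Γ_symm (a b : E) : γ.Γ y a b = γ.Γ y b a := by
  refine eq_of_forall_apply_eq (γ.nondegenerate y hy) fun c ↦ ?_
  rw [γ.G_Γ hy, γ.G_Γ hy, christoffelLower_apply, christoffelLower_apply,
    γ.fderiv_G_symm hΩ hy c a b]
  ring

/-- The Levi-Civita connection is metric. -/
lemma fderiv_G (a b c : E) :
    fderiv ℝ γ.G y a b c = γ.G y (γ.Γ y a b) c + γ.G y b (γ.Γ y a c) := by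
  rw [γ.symm y hy b, γ.G_Γ hy, γ.G_Γ hy, christoffelLower_apply, christoffelLower_apply,
    γ.fderiv_G_symm hΩ hy a c b, γ.fderiv_G_symm hΩ hy b a c, γ.fderiv_G_symm hΩ hy c a b]
  ring

/-- The Leibniz rule for the metric along vector fields. -/
lemma fderiv_G_apply {V W : E → E} (hV : DifferentiableAt ℝ V y) (hW : DifferentiableAt ℝ W y)
    (a : E) : fderiv ℝ (fun z ↦ γ.G z (V z) (W z)) y a
      = γ.G y (γ.nabla V y a) (W y) + γ.G y (V y) (γ.nabla W y a) := by
  have hd := (γ.contDiffAt_G hΩ hy).differentiableAt (by simp)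
  rw [fderiv_clm_apply (by fun_prop) (by fun_prop), fderiv_clm_apply (by fun_prop) (by fun_prop)]
  simp [nabla_apply, γ.fderiv_G hΩ hy]
  ring

/-- The first Bianchi identity. -/
lemma curv_bianchi (a b c : E) :
    γ.curv y a b c + γ.curv y b c a + γ.curv y c a b = 0 := by
  have hd := (γ.contDiffAt_Γ hΩ hy).differentiableAt (by simp)
  have h₁ : ∀ a b c, fderiv ℝ (fun z ↦ γ.Γ z b c) y a = fderiv ℝ γ.Γ y a b c := fun a b c ↦ by
    rw [fderiv_clm_apply (by fun_prop) (by fun_prop), fderiv_clm_apply (by fun_prop) (by fun_prop)]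
    simp
  have h₂ : ∀ a b c, fderiv ℝ γ.Γ y a b c = fderiv ℝ γ.Γ y a c b := by
    intro a b c
    rw [← h₁, ← h₁]
    have : (fun z ↦ γ.Γ z b c) =ᶠ[𝓝 y] fun z ↦ γ.Γ z c b := by
      filter_upwards [hΩ.mem_nhds hy] with z hz using γ.Γ_symm hΩ hz b c
    rw [this.fderiv_eq]
  simp only [curv, add_apply, sub_apply,
    ContinuousLinearMap.comp_apply]
  rw [h₂ b a c, h₂ c b a, h₂ a c b, γ.Γ_symm hΩ hy a c, γ.Γ_symm hΩ hy b c, γ.Γ_symm hΩ hy a b]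
  abel

end LocalMetric

/-! ### The volume density and the divergence theorem in a chart -/

/-- Jacobi's formula. -/
lemma hasFDerivAt_det {E : Type*} [NormedAddCommGroup E] [NormedSpace ℝ E] {ι : Type*} [Fintype ι]
    [DecidableEq ι] {A : E → Matrix ι ι ℝ} {A' : ι → ι → E →L[ℝ] ℝ} {y : E}
    (hA : ∀ i j, HasFDerivAt (fun z ↦ A z i j) (A' i j) y) :
    HasFDerivAt (fun z ↦ (A z).det) (∑ i, ∑ j, (A y).adjugate j i • A' i j) y := by
  let D : ContinuousMultilinearMap ℝ (fun _ : ι ↦ ι → ℝ) ℝ :=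
    { toMultilinearMap := (Matrix.detRowAlternating (n := ι) (R := ℝ)).toMultilinearMap
      cont := by
        change Continuous fun B : Matrix ι ι ℝ ↦ B.det
        exact Continuous.matrix_det continuous_id }
  have h₁ : HasFDerivAt (fun z i ↦ A z i)
      (ContinuousLinearMap.pi fun i ↦ ContinuousLinearMap.pi fun j ↦ A' i j) y :=
    hasFDerivAt_pi.2 fun i ↦ hasFDerivAt_pi.2 fun j ↦ hA i j
  have h₂ := (D.hasFDerivAt (x := fun i ↦ A y i)).comp y h₁
  refine HasFDerivAt.congr_fderiv (f' := _) h₂ ?_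
  ext a
  rw [ContinuousLinearMap.comp_apply, ContinuousMultilinearMap.linearDeriv_apply]
  simp only [FunLike.coe_sum, Finset.sum_apply, smul_apply, smul_eq_mul]
  refine Finset.sum_congr rfl fun i _ ↦ ?_
  have h₃ : D (Function.update (fun i ↦ A y i) i (fun j ↦ A' i j a))
      = Matrix.cramer (A y).transpose (fun j ↦ A' i j a) i := by
    rw [Matrix.cramer_transpose_apply]; rfl
  refine Eq.trans h₃ ?_
  rw [Matrix.cramer_eq_adjugate_mulVec, Matrix.mulVec, dotProduct]
  simp [← Matrix.adjugate_transpose]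

namespace LocalMetric

variable {E : Type*} [NormedAddCommGroup E] [NormedSpace ℝ E] [FiniteDimensional ℝ E]
variable {Ω : Set E} (γ : LocalMetric Ω) {ι : Type*} [Fintype ι] [DecidableEq ι] (b : Basis ι ℝ E)

/-- The Gram matrix of the metric in a basis. -/
def gram (y : E) : Matrix ι ι ℝ := Matrix.of fun i j ↦ γ.G y (b i) (b j)

/-- The density `|det G|^{1/2}` of the volume measure. -/
def vol (y : E) : ℝ := √|(γ.gram b y).det|

/-- The logarithm of the density of the volume measure. The determinant may be negative, but
`Real.log` only sees its absolute value. -/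
def logVol (y : E) : ℝ := 1 / 2 * Real.log (γ.gram b y).det

variable {y : E} (hy : y ∈ Ω)

omit [FiniteDimensional ℝ E] in
include hy in
lemma det_gram_ne_zero : (γ.gram b y).det ≠ 0 := by
  intro h
  obtain ⟨v, hv, hv'⟩ := Matrix.exists_mulVec_eq_zero_iff.2 h
  have h₁ : ∑ i, v i • b i = 0 := by
    refine γ.nondegenerate y hy _ fun w ↦ ?_
    rw [γ.symm y hy]
    have : ((γ.G y).flip (∑ i, v i • b i)).toLinearMap = 0 := by
      refine b.ext fun i ↦ ?_
      have := congr_fun hv' i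
      simp only [Matrix.mulVec, dotProduct, gram, Matrix.of_apply, Pi.zero_apply] at this
      change γ.G y (b i) (∑ j, v j • b j) = 0
      simp only [map_sum, map_smul, smul_eq_mul]
      rw [← this]
      exact Finset.sum_congr rfl fun _ _ ↦ mul_comm _ _
    exact LinearMap.congr_fun this w
  exact hv (funext fun i ↦ Fintype.linearIndependent_iff.1 b.linearIndependent v h₁ i)

omit [FiniteDimensional ℝ E] in
include hy in
lemma vol_eq_exp : γ.vol b y = Real.exp (γ.logVol b y) := by
  have h := γ.det_gram_ne_zero b hy
  have h' : 1 / 2 * Real.log (γ.gram b y).det = Real.log (√|(γ.gram b y).det|) := by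
    rw [Real.log_sqrt (abs_nonneg _), Real.log_abs]; ring
  rw [vol, logVol, h', Real.exp_log]
  positivity

omit [FiniteDimensional ℝ E] in
include hy in
lemma vol_pos : 0 < γ.vol b y := by
  rw [γ.vol_eq_exp b hy]; positivity

variable (hΩ : IsOpen Ω)
include hy hΩ

/-- The logarithmic derivative of the volume density in direction `a` is the trace of `Γ_a`. -/
lemma hasFDerivAt_logVol :
    HasFDerivAt (γ.logVol b) (traceCLM E ∘L γ.Γ y) y := by
  have hd := (γ.contDiffAt_G hΩ hy).differentiableAt (by simp)
  have h₁ : ∀ i j, HasFDerivAt (fun z ↦ γ.gram b z i j)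
      ((ContinuousLinearMap.apply ℝ ℝ (b j) ∘L ContinuousLinearMap.apply ℝ (E →L[ℝ] ℝ) (b i)) ∘L
        fderiv ℝ γ.G y) y := fun i j ↦
    (ContinuousLinearMap.apply ℝ ℝ (b j) ∘L
      ContinuousLinearMap.apply ℝ (E →L[ℝ] ℝ) (b i)).hasFDerivAt.comp y hd.hasFDerivAt
  have h₂ := ((hasFDerivAt_det h₁).log (γ.det_gram_ne_zero b hy)).const_mul (1 / 2)
  refine h₂.congr_fderiv ?_
  ext a
  have hs : ∀ i j, γ.gram b y i j = γ.gram b y j i := fun i j ↦ γ.symm y hy _ _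
  have h₃ : ∀ i j, fderiv ℝ γ.G y a (b i) (b j)
      = ∑ k, b.repr (γ.Γ y a (b i)) k * γ.gram b y k j
        + ∑ k, b.repr (γ.Γ y a (b j)) k * γ.gram b y k i := by
    intro i j
    have h₄ : ∀ i j, γ.G y (γ.Γ y a (b i)) (b j)
        = ∑ k, b.repr (γ.Γ y a (b i)) k * γ.gram b y k j := fun i j ↦ by
      conv_lhs => rw [← b.sum_repr (γ.Γ y a (b i))]
      simp only [map_sum, map_smul, FunLike.coe_sum, Finset.sum_apply, smul_apply, smul_eq_mul]
      rfl
    rw [γ.fderiv_G hΩ hy, γ.symm y hy (b i), h₄, h₄]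
  -- `A adj(A) = adj(A) A = det A` for the Gram matrix `A`, in coordinates.
  have h₅ : ∀ i k, ∑ j, γ.gram b y k j * (γ.gram b y).adjugate j i
      = if k = i then (γ.gram b y).det else 0 := fun i k ↦ by
    rw [← Matrix.mul_apply, Matrix.mul_adjugate, Matrix.smul_apply, Matrix.one_apply]
    simp
  have h₆ : ∀ j k, ∑ i, (γ.gram b y).adjugate j i * γ.gram b y i k
      = if j = k then (γ.gram b y).det else 0 := fun i k ↦ by
    rw [← Matrix.mul_apply, Matrix.adjugate_mul, Matrix.smul_apply, Matrix.one_apply]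
    simp
  have h₇ : ∑ i, ∑ j, (γ.gram b y).adjugate j i * fderiv ℝ γ.G y a (b i) (b j)
      = 2 * ((γ.gram b y).det * traceCLM E (γ.Γ y a)) := by
    simp only [h₃, mul_add, Finset.sum_add_distrib, two_mul]
    congr 1
    · rw [traceCLM_eq_sum b, Finset.mul_sum]
      refine Finset.sum_congr rfl fun i _ ↦ ?_
      simp only [Finset.mul_sum]
      rw [Finset.sum_comm]
      have : ∀ k, ∑ j, (γ.gram b y).adjugate j i * (b.repr (γ.Γ y a (b i)) k * γ.gram b y k j)
          = b.repr (γ.Γ y a (b i)) k * if k = i then (γ.gram b y).det else 0 := fun k ↦ by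
        rw [← h₅, Finset.mul_sum]
        exact Finset.sum_congr rfl fun _ _ ↦ by ring
      simp only [this, mul_ite, mul_zero, Finset.sum_ite_eq', Finset.mem_univ, if_true]
      exact mul_comm _ _
    · rw [traceCLM_eq_sum b, Finset.mul_sum, Finset.sum_comm]
      refine Finset.sum_congr rfl fun j _ ↦ ?_
      simp only [Finset.mul_sum]
      rw [Finset.sum_comm]
      have : ∀ k, ∑ i, (γ.gram b y).adjugate j i * (b.repr (γ.Γ y a (b j)) k * γ.gram b y k i)
          = b.repr (γ.Γ y a (b j)) k * if j = k then (γ.gram b y).det else 0 := fun k ↦ by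
        rw [← h₆, Finset.mul_sum]
        exact Finset.sum_congr rfl fun i _ ↦ by rw [hs k i]; ring
      simp only [this, mul_ite, mul_zero, Finset.sum_ite_eq, Finset.mem_univ, if_true]
      exact mul_comm _ _
  have h₈ := γ.det_gram_ne_zero b hy
  simp only [smul_apply, FunLike.coe_sum, Finset.sum_apply, smul_eq_mul,
    ContinuousLinearMap.comp_apply, ContinuousLinearMap.apply_apply]
  rw [h₇]
  field_simp

omit [FiniteDimensional ℝ E] in
lemma contDiffAt_logVol : ContDiffAt ℝ ∞ (γ.logVol b) y := by
  have hd := γ.contDiffAt_G hΩ hy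
  have : ContDiffAt ℝ ∞ (fun z ↦ (γ.gram b z).det) y := by
    simp only [Matrix.det_apply, gram, Matrix.of_apply]
    fun_prop
  exact contDiffAt_const.mul (this.log (γ.det_gram_ne_zero b hy))

omit [FiniteDimensional ℝ E] in
lemma contDiffAt_vol : ContDiffAt ℝ ∞ (γ.vol b) y := by
  refine ((γ.contDiffAt_logVol b hy hΩ).exp).congr_of_eventuallyEq ?_
  filter_upwards [hΩ.mem_nhds hy] with z hz using γ.vol_eq_exp b hz

lemma hasFDerivAt_vol :
    HasFDerivAt (γ.vol b) (γ.vol b y • (traceCLM E ∘L γ.Γ y)) y := by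
  rw [γ.vol_eq_exp b hy]
  refine ((γ.hasFDerivAt_logVol b hy hΩ).exp).congr_of_eventuallyEq ?_
  filter_upwards [hΩ.mem_nhds hy] with z hz using γ.vol_eq_exp b hz

/-- The curvature endomorphisms are traceless: their trace is the exterior derivative of the form
`a ↦ tr Γ_a`, which is exact. -/
lemma trace_curv (u v : E) : traceCLM E (γ.curv y u v) = 0 := by
  have hb := Module.finBasis ℝ E
  have hd := (γ.contDiffAt_Γ hΩ hy).differentiableAt (by simp)
  have h₁ : fderiv ℝ (γ.logVol hb) =ᶠ[𝓝 y] fun z ↦ traceCLM E ∘L γ.Γ z := by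
    filter_upwards [hΩ.mem_nhds hy] with z hz using (γ.hasFDerivAt_logVol hb hz hΩ).fderiv
  have h₂ : ∀ u v, fderiv ℝ (fderiv ℝ (γ.logVol hb)) y u v = traceCLM E (fderiv ℝ γ.Γ y u v) := by
    intro u v
    rw [h₁.fderiv_eq, fderiv_clm_comp (by fun_prop) hd]
    simp
  have h₃ := (γ.contDiffAt_logVol hb hy hΩ).isSymmSndFDerivAt (by simp; exact ENat.LEInfty.out) u v
  rw [h₂, h₂] at h₃
  simp only [curv, map_add, map_sub]
  rw [h₃, traceCLM_comp_comm]
  ring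

/-- The Ricci tensor is symmetric: by the Bianchi identity its antisymmetric part is a trace of
curvature endomorphisms. -/
lemma ric_symm (u v : E) : γ.ric y u v = γ.ric y v u := by
  rw [← sub_eq_zero, ric, ric, ← map_sub, ← neg_eq_zero, ← map_neg]
  rw [← γ.trace_curv hy hΩ v u]
  congr 1
  ext w
  have h₁ := γ.curv_bianchi hΩ hy v u w
  have h₂ : γ.curv y w v u = - γ.curv y v w u := by
    simp [curv]; abel
  rw [h₂] at h₁
  simp only [neg_apply, sub_apply, LinearMap.coe_toContinuousLinearMap', LinearMap.coe_mk,
    AddHom.coe_mk]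
  rw [← sub_eq_zero, ← neg_eq_zero, ← h₁]
  abel

omit hΩ hy in
/-- The divergence theorem in a chart: `vol · div X` is the flat divergence of `vol · X`. -/
theorem integral_vol_mul_div [MeasurableSpace E] [BorelSpace E] (μ : Measure E)
    [μ.IsAddHaarMeasure] (hΩ : IsOpen Ω) {X : E → E} (hX : ContDiff ℝ 1 X)
    (hc : HasCompactSupport X) (hs : tsupport X ⊆ Ω) :
    ∫ y, γ.vol b y * γ.div X y ∂μ = 0 := by
  set Y : E → E := fun z ↦ γ.vol b z • X z with hYdef
  have hYs : tsupport Y ⊆ tsupport X := closure_mono (Function.support_smul_subset_right _ _)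
  have hY : ContDiff ℝ 1 Y := by
    refine contDiff_iff_contDiffAt.2 fun z ↦ ?_
    by_cases hz : z ∈ tsupport X
    · exact ((γ.contDiffAt_vol b (hs hz) hΩ).of_le (by simp)).smul hX.contDiffAt
    · refine contDiffAt_const (c := (0 : E)) |>.congr_of_eventuallyEq ?_
      exact notMem_tsupport_iff_eventuallyEq.1 fun h ↦ hz (hYs h)
  have hYc : HasCompactSupport Y := hc.mono' ((subset_tsupport _).trans hYs)
  have h₁ : ∀ z, γ.vol b z * γ.div X z = traceCLM E (fderiv ℝ Y z) := by
    intro z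
    by_cases hz : z ∈ tsupport X
    · have hz' := hs hz
      have hv := γ.hasFDerivAt_vol b hz' hΩ
      have hX' := (hX.differentiable (by simp) z).hasFDerivAt
      have hY' : HasFDerivAt Y _ z := hv.smul hX'
      rw [hY'.fderiv, map_add, map_smul, traceCLM_smulRight, div, nabla, map_add]
      have : (γ.Γ z).flip (X z) = γ.Γ z (X z) := by
        ext a; simp [γ.Γ_symm hΩ hz' a]
      rw [this]
      simp [mul_add]
    · have h0 := notMem_tsupport_iff_eventuallyEq.1 hz
      have h0' := notMem_tsupport_iff_eventuallyEq.1 fun h ↦ hz (hYs h)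
      have e₁ : fderiv ℝ X z = 0 := by rw [h0.fderiv_eq]; simp
      have e₂ : fderiv ℝ Y z = 0 := by rw [h0'.fderiv_eq]; simp
      have e₃ : X z = 0 := h0.eq_of_nhds
      simp [div, nabla, e₁, e₂, e₃]
  have h₂ : ∀ v, ∫ z, fderiv ℝ Y z v ∂μ = 0 := by
    intro v
    have hi : Integrable (fun z ↦ fderiv ℝ Y z v) μ :=
      ((hY.continuous_fderiv (by simp)).clm_apply continuous_const).integrable_of_hasCompactSupport
        (hYc.fderiv_apply ℝ v)
    have := integral_smul_fderiv_eq_neg_fderiv_smul_of_integrable (μ := μ) (𝕜 := ℝ)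
      (f := fun _ : E ↦ (1 : ℝ)) (g := Y) (v := v) (by simp) (by simpa using hi)
      (by simpa using hY.continuous.integrable_of_hasCompactSupport hYc) (by simp)
      (fun z _ ↦ hY.differentiable (by simp) z)
    simpa using this
  simp_rw [h₁]
  have hi : Integrable (fderiv ℝ Y) μ :=
    (hY.continuous_fderiv (by simp)).integrable_of_hasCompactSupport (hYc.fderiv ℝ)
  rw [ContinuousLinearMap.integral_comp_comm _ hi]
  have : ∫ z, fderiv ℝ Y z ∂μ = 0 := by
    ext v
    rw [ContinuousLinearMap.integral_apply hi, h₂]; rfl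
  rw [this, map_zero]

end LocalMetric

/-! ### Paracontact metric structures in a chart -/

namespace LocalMetric

variable {E : Type*} [NormedAddCommGroup E] [NormedSpace ℝ E]
variable {Ω : Set E} (γ : LocalMetric Ω)

lemma nabla_clm_apply {F : E → E →L[ℝ] E} {W : E → E} {y : E} (hF : DifferentiableAt ℝ F y)
    (hW : DifferentiableAt ℝ W y) (a : E) :
    γ.nabla (fun z ↦ F z (W z)) y a = γ.nablaEnd F y a (W y) + F y (γ.nabla W y a) := by
  rw [nabla_apply, nabla_apply, fderiv_clm_apply hF hW]
  simp [nablaEnd]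
  abel

variable [FiniteDimensional ℝ E]

/-- The endomorphism `v ↦ (∇_v F) X`. -/
def nablaEndFlip (F : E → E →L[ℝ] E) (y X : E) : E →L[ℝ] E :=
  LinearMap.toContinuousLinearMap
    { toFun := fun v ↦ γ.nablaEnd F y v X
      map_add' := by intros; simp [nablaEnd]; abel
      map_smul' := by intros; simp [nablaEnd, smul_sub, smul_add] }

@[simp] lemma nablaEndFlip_apply (F : E → E →L[ℝ] E) (y X v : E) :
    γ.nablaEndFlip F y X v = γ.nablaEnd F y v X := rfl

lemma trace_nablaEnd {F : E → E →L[ℝ] E} {y : E} (hF : DifferentiableAt ℝ F y) (w : E) :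
    traceCLM E (γ.nablaEnd F y w) = fderiv ℝ (fun z ↦ traceCLM E (F z)) y w := by
  have h : HasFDerivAt (fun z ↦ traceCLM E (F z)) _ y :=
    (traceCLM E).hasFDerivAt.comp y hF.hasFDerivAt
  rw [h.fderiv, nablaEnd, map_sub, map_add, traceCLM_comp_comm]
  simp

variable {y : E} (hy : y ∈ Ω) (hΩ : IsOpen Ω)

include hy hΩ in
/-- The Ricci identity. -/
lemma nablaEnd_nabla_sub {V : E → E} (hV : ContDiffAt ℝ ∞ V y) (a b : E) :
    γ.nablaEnd (γ.nabla V) y a b - γ.nablaEnd (γ.nabla V) y b a = - γ.curv y a b (V y) := by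
  have hΓ := (γ.contDiffAt_Γ hΩ hy).differentiableAt (by simp)
  have hV' := hV.differentiableAt (by simp)
  have hDV : DifferentiableAt ℝ (fderiv ℝ V) y :=
    (hV.fderiv_right (m := ∞) (by simp)).differentiableAt (by simp)
  have hs := hV.isSymmSndFDerivAt (by simp; exact ENat.LEInfty.out) a b
  have h : ∀ a b, fderiv ℝ (γ.nabla V) y a b
      = fderiv ℝ (fderiv ℝ V) y a b + fderiv ℝ γ.Γ y a b (V y) + γ.Γ y b (fderiv ℝ V y a) := by
    intro a b
    have hΓ' : DifferentiableAt ℝ (fun z ↦ (γ.Γ z).flip) y :=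
      (ContinuousLinearMap.flipₗᵢ ℝ E E E).differentiableAt.comp y hΓ
    have hΓ'' : fderiv ℝ (fun z ↦ (γ.Γ z).flip) y a = (fderiv ℝ γ.Γ y a).flip := by
      have := (ContinuousLinearMap.flipₗᵢ ℝ E E E).toContinuousLinearEquiv.hasFDerivAt.comp y
        hΓ.hasFDerivAt
      exact congrArg (fun L ↦ L a) this.fderiv
    have e : γ.nabla V = fun z ↦ fderiv ℝ V z + (γ.Γ z).flip (V z) := rfl
    rw [e, fderiv_fun_add hDV (hΓ'.clm_apply hV'), fderiv_clm_apply hΓ' hV']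
    simp [hΓ'']
    abel
  simp only [nablaEnd, sub_apply, add_apply, ContinuousLinearMap.comp_apply, h, curv, nabla_apply,
    hs, γ.Γ_symm hΩ hy b a, map_add]
  abel

end LocalMetric

/-- The expression in a chart of a paracontact metric structure: a unit vector field `ξ` and a field
of endomorphisms `φ` with `dη = G(·, φ ·)` for `η = G(ξ, ·)`. Values outside `Ω` are irrelevant. -/
structure LocalParacontact {E : Type*} [NormedAddCommGroup E] [NormedSpace ℝ E] {Ω : Set E}
    (γ : LocalMetric Ω) where
  /-- The Reeb vector field. -/
  ξ : E → E
  /-- The tensor of type `(1,1)`. -/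
  φ : E → E →L[ℝ] E
  contDiffOn_ξ : ContDiffOn ℝ ∞ ξ Ω
  contDiffOn_φ : ContDiffOn ℝ ∞ φ Ω
  unit : ∀ y ∈ Ω, γ.G y (ξ y) (ξ y) = 1
  G_ξ_φ : ∀ y ∈ Ω, ∀ v, γ.G y (ξ y) (φ y v) = 0
  φ_φ : ∀ y ∈ Ω, ∀ v, φ y (φ y v) = v - γ.G y (ξ y) v • ξ y
  dη : ∀ y ∈ Ω, ∀ u v, (1 / 2 : ℝ) * (fderiv ℝ (fun z ↦ γ.G z (ξ z)) y u v
    - fderiv ℝ (fun z ↦ γ.G z (ξ z)) y v u) = γ.G y u (φ y v)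

namespace LocalParacontact

variable {E : Type*} [NormedAddCommGroup E] [NormedSpace ℝ E] [FiniteDimensional ℝ E]
variable {Ω : Set E} {γ : LocalMetric Ω} (S : LocalParacontact γ)
variable {y : E} (hy : y ∈ Ω) (hΩ : IsOpen Ω)

include hy hΩ

omit [FiniteDimensional ℝ E] in
lemma contDiffAt_ξ : ContDiffAt ℝ ∞ S.ξ y := S.contDiffOn_ξ.contDiffAt (hΩ.mem_nhds hy)

omit [FiniteDimensional ℝ E] in
lemma differentiableAt_ξ : DifferentiableAt ℝ S.ξ y :=
  (S.contDiffAt_ξ hy hΩ).differentiableAt (by simp)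

omit [FiniteDimensional ℝ E] in
lemma differentiableAt_φ : DifferentiableAt ℝ S.φ y :=
  (S.contDiffOn_φ.contDiffAt (hΩ.mem_nhds hy)).differentiableAt (by simp)

omit [FiniteDimensional ℝ E] in
lemma contDiffAt_η : ContDiffAt ℝ ∞ (fun z ↦ γ.G z (S.ξ z)) y :=
  (γ.contDiffAt_G hΩ hy).clm_apply (S.contDiffAt_ξ hy hΩ)

lemma fderiv_η (u v : E) : fderiv ℝ (fun z ↦ γ.G z (S.ξ z)) y u v
    = γ.G y (γ.nabla S.ξ y u) v + γ.G y (S.ξ y) (γ.Γ y u v) := by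
  have hd := (γ.contDiffAt_G hΩ hy).differentiableAt (by simp)
  rw [fderiv_clm_apply hd (S.differentiableAt_ξ hy hΩ)]
  simp [γ.fderiv_G hΩ hy, LocalMetric.nabla_apply]
  ring

/-- `φ` is the skew-symmetric part of `-∇ξ`, since the connection is torsion free. -/
lemma G_φ (u v : E) : γ.G y u (S.φ y v)
    = (1 / 2 : ℝ) * (γ.G y (γ.nabla S.ξ y u) v - γ.G y (γ.nabla S.ξ y v) u) := by
  rw [← S.dη y hy, S.fderiv_η hy hΩ, S.fderiv_η hy hΩ, γ.Γ_symm hΩ hy u v]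
  ring

lemma G_φ_skew (u v : E) : γ.G y u (S.φ y v) = - γ.G y (S.φ y u) v := by
  rw [γ.symm y hy (S.φ y u), S.G_φ hy hΩ, S.G_φ hy hΩ]; ring

lemma G_nabla_ξ (a : E) : γ.G y (γ.nabla S.ξ y a) (S.ξ y) = 0 := by
  have hd := S.differentiableAt_ξ hy hΩ
  have h := γ.fderiv_G_apply hΩ hy hd hd a
  have h₁ : (fun z ↦ γ.G z (S.ξ z) (S.ξ z)) =ᶠ[𝓝 y] fun _ ↦ 1 := by
    filter_upwards [hΩ.mem_nhds hy] with z hz using S.unit z hz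
  rw [h₁.fderiv_eq, γ.symm y hy (S.ξ y)] at h
  simp at h
  linarith

/-- The Reeb vector field is geodesic. -/
lemma nabla_ξ_ξ : γ.nabla S.ξ y (S.ξ y) = 0 := by
  refine γ.nondegenerate y hy _ fun v ↦ ?_
  have h := S.G_φ hy hΩ (S.ξ y) v
  rw [S.G_ξ_φ y hy, S.G_nabla_ξ hy hΩ] at h
  linarith

lemma φ_ξ : S.φ y (S.ξ y) = 0 := by
  refine γ.nondegenerate y hy _ fun v ↦ ?_
  rw [← neg_eq_zero, ← S.G_φ_skew hy hΩ, S.G_ξ_φ y hy]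

/-- The adjoint of `∇ξ` is `∇ξ + 2φ`. -/
lemma adj_nabla_ξ : adj (γ.G y) (γ.nabla S.ξ y) = γ.nabla S.ξ y + (2 : ℝ) • S.φ y := by
  ext u
  refine eq_of_forall_apply_eq (γ.nondegenerate y hy) fun v ↦ ?_
  rw [adj_apply (γ.nondegenerate y hy)]
  simp only [add_apply, smul_apply, map_add, map_smul, smul_eq_mul]
  rw [γ.symm y hy (S.φ y u), S.G_φ hy hΩ, γ.symm y hy u]
  ring

/-- The derivative of `Φ(u, v) = G(u, φ v)` in terms of `∇φ`. -/
lemma fderiv_Φ (w u v : E) : fderiv ℝ (fun z ↦ γ.G z u (S.φ z v)) y w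
    = γ.G y u (γ.nablaEnd S.φ y w v) + γ.G y (γ.Γ y w u) (S.φ y v)
      + γ.G y u (S.φ y (γ.Γ y w v)) := by
  have hφ := S.differentiableAt_φ hy hΩ
  have h := γ.fderiv_G_apply hΩ hy (V := fun _ ↦ u) (W := fun z ↦ S.φ z v) (by fun_prop)
    (by fun_prop) w
  rw [h, γ.nabla_clm_apply hφ (by fun_prop)]
  simp [LocalMetric.nabla_apply]
  ring

lemma G_nablaEnd_φ_skew (w u v : E) :
    γ.G y u (γ.nablaEnd S.φ y w v) = - γ.G y v (γ.nablaEnd S.φ y w u) := by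
  have h : (fun z ↦ γ.G z u (S.φ z v)) =ᶠ[𝓝 y] fun z ↦ - γ.G z v (S.φ z u) := by
    filter_upwards [hΩ.mem_nhds hy] with z hz
    rw [S.G_φ_skew hz hΩ, γ.symm z hz]
  have h₁ := congrArg (fun L : E →L[ℝ] ℝ ↦ L w) h.fderiv_eq
  simp only [fderiv_fun_neg, neg_apply] at h₁
  rw [S.fderiv_Φ hy hΩ, S.fderiv_Φ hy hΩ, S.G_φ_skew hy hΩ (γ.Γ y w u),
    S.G_φ_skew hy hΩ (γ.Γ y w v), γ.symm y hy (S.φ y _), γ.symm y hy (S.φ y _)] at h₁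
  linarith

/-- The form `Φ = dη` is closed. -/
lemma G_nablaEnd_φ_cyclic (w u v : E) :
    γ.G y u (γ.nablaEnd S.φ y w v) + γ.G y v (γ.nablaEnd S.φ y u w)
      + γ.G y w (γ.nablaEnd S.φ y v u) = 0 := by
  have hη := S.contDiffAt_η hy hΩ
  have hs := hη.isSymmSndFDerivAt (by simp; exact ENat.LEInfty.out)
  have hDη : DifferentiableAt ℝ (fderiv ℝ (fun z ↦ γ.G z (S.ξ z))) y :=
    (hη.fderiv_right (m := ∞) (by simp)).differentiableAt (by simp)
  have h : ∀ w u v, fderiv ℝ (fun z ↦ γ.G z u (S.φ z v)) y w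
      = (1 / 2 : ℝ) * (fderiv ℝ (fderiv ℝ (fun z ↦ γ.G z (S.ξ z))) y w u v
        - fderiv ℝ (fderiv ℝ (fun z ↦ γ.G z (S.ξ z))) y w v u) := by
    intro w u v
    have h₁ : (fun z ↦ γ.G z u (S.φ z v)) =ᶠ[𝓝 y] fun z ↦ (1 / 2 : ℝ) *
        (fderiv ℝ (fun z ↦ γ.G z (S.ξ z)) z u v - fderiv ℝ (fun z ↦ γ.G z (S.ξ z)) z v u) := by
      filter_upwards [hΩ.mem_nhds hy] with z hz using (S.dη z hz u v).symm
    have h₂ : ∀ u v, HasFDerivAt (fun z ↦ fderiv ℝ (fun z ↦ γ.G z (S.ξ z)) z u v)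
        ((ContinuousLinearMap.apply ℝ ℝ v ∘L ContinuousLinearMap.apply ℝ (E →L[ℝ] ℝ) u) ∘L
          fderiv ℝ (fderiv ℝ (fun z ↦ γ.G z (S.ξ z))) y) y := fun u v ↦
      (ContinuousLinearMap.apply ℝ ℝ v ∘L
        ContinuousLinearMap.apply ℝ (E →L[ℝ] ℝ) u).hasFDerivAt.comp y hDη.hasFDerivAt
    rw [h₁.fderiv_eq, (((h₂ u v).fun_sub (h₂ v u)).const_mul (1 / 2)).fderiv]
    simp
  have h₁ := h w u v
  have h₂ := h u v w
  have h₃ := h v w u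
  rw [S.fderiv_Φ hy hΩ] at h₁ h₂ h₃
  rw [S.G_φ_skew hy hΩ (γ.Γ y _ _), γ.symm y hy (S.φ y _)] at h₁ h₂ h₃
  rw [hs.eq u w] at h₂
  rw [hs.eq v u, hs.eq v w] at h₃
  rw [γ.Γ_symm hΩ hy u w] at h₂
  rw [γ.Γ_symm hΩ hy v w, γ.Γ_symm hΩ hy v u] at h₃
  linarith

/-- The covariant derivative of the identity `φ² = I - η ⊗ ξ`. -/
lemma nablaEnd_φ_comp (w v : E) :
    γ.nablaEnd S.φ y w (S.φ y v) + S.φ y (γ.nablaEnd S.φ y w v)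
      = - (γ.G y (γ.nabla S.ξ y w) v) • S.ξ y - γ.G y (S.ξ y) v • γ.nabla S.ξ y w := by
  have hφ := S.differentiableAt_φ hy hΩ
  have hξ := S.differentiableAt_ξ hy hΩ
  have hη := (S.contDiffAt_η hy hΩ).differentiableAt (by simp)
  have h : (fun z ↦ S.φ z (S.φ z v)) =ᶠ[𝓝 y] fun z ↦ v - γ.G z (S.ξ z) v • S.ξ z := by
    filter_upwards [hΩ.mem_nhds hy] with z hz using S.φ_φ z hz v
  have h₁ := congrArg (fun L : E →L[ℝ] E ↦ L w) h.fderiv_eq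
  have hη' : DifferentiableAt ℝ (fun z ↦ γ.G z (S.ξ z) v) y := hη.clm_apply (by fun_prop)
  have hη'' : fderiv ℝ (fun z ↦ γ.G z (S.ξ z) v) y w
      = γ.G y (γ.nabla S.ξ y w) v + γ.G y (S.ξ y) (γ.Γ y w v) := by
    rw [fderiv_clm_apply hη (by fun_prop), ← S.fderiv_η hy hΩ]
    simp
  rw [fderiv_clm_apply hφ (by fun_prop), fderiv_clm_apply hφ (by fun_prop), fderiv_fun_sub
    (by fun_prop) (by fun_prop), fderiv_fun_smul hη' hξ] at h₁
  simp [hη''] at h₁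
  simp only [LocalMetric.nablaEnd, sub_apply, add_apply, ContinuousLinearMap.comp_apply, map_add,
    map_sub, S.φ_φ y hy, LocalMetric.nabla_apply, map_smul, smul_add, add_smul,
    neg_smul] at h₁ ⊢
  rw [← sub_eq_zero] at h₁ ⊢
  rw [← h₁]
  module

/-- `tr (v ↦ φ (∇_v φ) X) = 0`, a consequence of the closedness of `Φ` and of `φ² = I - η ⊗ ξ`. -/
lemma trace_φ_comp_nablaEndFlip (X : E) :
    traceCLM E (S.φ y ∘L γ.nablaEndFlip S.φ y X) = 0 := by
  set P := γ.nablaEndFlip S.φ y X with hP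
  set F := γ.nablaEnd S.φ y X with hF
  have hadj : ∀ u v, γ.G y u ((P - F) v) = γ.G y v (P u) := by
    intro u v
    have h₁ := S.G_nablaEnd_φ_cyclic hy hΩ X u v
    have h₂ := S.G_nablaEnd_φ_skew hy hΩ v X u
    simp only [sub_apply, map_sub, hP, hF, LocalMetric.nablaEndFlip_apply]
    linarith
  have h₁ : traceCLM E ((P - F) ∘L S.φ y) = traceCLM E (-(S.φ y ∘L P)) := by
    refine traceCLM_eq_of_adjoint (γ.nondegenerate y hy) fun u v ↦ ?_
    rw [ContinuousLinearMap.comp_apply, γ.symm y hy, hadj, neg_apply, map_neg,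
      ContinuousLinearMap.comp_apply, S.G_φ_skew hy hΩ u]
    ring
  have h₂ : traceCLM E (F ∘L S.φ y + S.φ y ∘L F) = 0 := by
    have : F ∘L S.φ y + S.φ y ∘L F
        = - (((γ.G y (γ.nabla S.ξ y X)).smulRight (S.ξ y))
          + (γ.G y (S.ξ y)).smulRight (γ.nabla S.ξ y X)) := by
      ext v
      have := S.nablaEnd_φ_comp hy hΩ X v
      simp only [add_apply, ContinuousLinearMap.comp_apply, neg_apply,
        ContinuousLinearMap.smulRight_apply, hF, this]
      module
    rw [this, map_neg, map_add, traceCLM_smulRight, traceCLM_smulRight, γ.symm y hy (S.ξ y),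
      S.G_nabla_ξ hy hΩ]
    simp
  rw [map_add, traceCLM_comp_comm F] at h₂
  rw [ContinuousLinearMap.sub_comp, map_sub, map_neg, traceCLM_comp_comm P,
    traceCLM_comp_comm F] at h₁
  linarith

/-- The divergence of `φ`, evaluated on `φ X`. -/
lemma trace_nablaEndFlip_φ (X : E) : traceCLM E (γ.nablaEndFlip S.φ y (S.φ y X))
    = - (γ.G y (S.ξ y) X * γ.div S.ξ y) := by
  have h : γ.nablaEndFlip S.φ y (S.φ y X) = - (S.φ y ∘L γ.nablaEndFlip S.φ y X)
      - (((γ.G y).flip X ∘L γ.nabla S.ξ y).smulRight (S.ξ y))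
      - γ.G y (S.ξ y) X • γ.nabla S.ξ y := by
    ext v
    have := S.nablaEnd_φ_comp hy hΩ v X
    simp only [sub_apply, neg_apply, ContinuousLinearMap.comp_apply, smul_apply,
      ContinuousLinearMap.smulRight_apply, ContinuousLinearMap.flip_apply,
      LocalMetric.nablaEndFlip_apply]
    rw [← sub_eq_zero] at this ⊢
    rw [← this]
    module
  rw [h, map_sub, map_sub, map_neg, map_smul, S.trace_φ_comp_nablaEndFlip hy hΩ,
    traceCLM_smulRight]
  simp [S.nabla_ξ_ξ hy hΩ, LocalMetric.div]

/-- The Reeb vector field is divergence free. -/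
lemma div_ξ : γ.div S.ξ y = 0 := by
  have h := S.trace_nablaEndFlip_φ hy hΩ (S.ξ y)
  have h₁ : γ.nablaEndFlip S.φ y 0 = 0 := by ext; simp
  rw [S.φ_ξ hy hΩ, h₁, S.unit y hy] at h
  simpa using h.symm

/-- The divergence of `φ` vanishes on vectors orthogonal to `ξ`. -/
lemma trace_nablaEndFlip_of_orthogonal {W : E} (hW : γ.G y (S.ξ y) W = 0) :
    traceCLM E (γ.nablaEndFlip S.φ y W) = 0 := by
  have h := S.trace_nablaEndFlip_φ hy hΩ (S.φ y W)
  rw [S.φ_φ y hy, hW, S.G_ξ_φ y hy] at h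
  simpa using h

/-- The Bochner-type identity behind the theorem: for a field `W` orthogonal to `ξ`, the first
variation density `tr_G G(∇W, ∇ξ)` is `-ρ(ξ, W)` up to the divergence of `(∇ξ)^* W`, where
`(∇ξ)^* = ∇ξ + 2φ`. Expanding this divergence also gives `tr (v ↦ (∇_v φ) W)`, which
vanishes as `W` is orthogonal to `ξ`. -/
theorem div_adj_nabla {W : E → E} (hW : DifferentiableAt ℝ W y) (h0 : γ.G y (S.ξ y) (W y) = 0) :
    γ.div (fun z ↦ (γ.nabla S.ξ z + (2 : ℝ) • S.φ z) (W z)) y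
      = pairing (γ.G y) (γ.nabla W y) (γ.nabla S.ξ y) + γ.ric y (S.ξ y) (W y) := by
  have hφ := S.differentiableAt_φ hy hΩ
  have hA : DifferentiableAt ℝ (γ.nabla S.ξ) y := by
    have hΓ := (γ.contDiffAt_Γ hΩ hy).differentiableAt (by simp)
    have hΓ' : DifferentiableAt ℝ (fun z ↦ (γ.Γ z).flip) y :=
      (ContinuousLinearMap.flipₗᵢ ℝ E E E).differentiableAt.comp y hΓ
    exact (((S.contDiffAt_ξ hy hΩ).fderiv_right (m := ∞) (by simp)).differentiableAt
      (by simp)).add (hΓ'.clm_apply (S.differentiableAt_ξ hy hΩ))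
  have h₁ : γ.nabla (fun z ↦ (γ.nabla S.ξ z + (2 : ℝ) • S.φ z) (W z)) y
      = γ.nablaEndFlip (γ.nabla S.ξ) y (W y) + (2 : ℝ) • γ.nablaEndFlip S.φ y (W y)
        + (γ.nabla S.ξ y + (2 : ℝ) • S.φ y) ∘L γ.nabla W y := by
    ext a
    rw [γ.nabla_clm_apply (F := fun z ↦ γ.nabla S.ξ z + (2 : ℝ) • S.φ z) (by fun_prop) hW]
    have h' : HasFDerivAt (fun z ↦ γ.nabla S.ξ z + (2 : ℝ) • S.φ z) _ y :=
      hA.hasFDerivAt.add (hφ.hasFDerivAt.const_smul (2 : ℝ))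
    simp [LocalMetric.nablaEnd, h'.fderiv]
    module
  -- By the Ricci identity, `tr (v ↦ (∇_v ∇ξ) W)` is `tr ∇_W (∇ξ) = W(div ξ) = 0` up to Ricci.
  have h₂ : traceCLM E (γ.nablaEndFlip (γ.nabla S.ξ) y (W y)) = γ.ric y (W y) (S.ξ y) := by
    have h₃ : traceCLM E (γ.nablaEnd (γ.nabla S.ξ) y (W y)) = 0 := by
      rw [γ.trace_nablaEnd hA]
      have : (fun z ↦ traceCLM E (γ.nabla S.ξ z)) =ᶠ[𝓝 y] fun _ ↦ 0 := by
        filter_upwards [hΩ.mem_nhds hy] with z hz using S.div_ξ hz hΩ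
      rw [this.fderiv_eq]; simp
    rw [← sub_zero (traceCLM E _), ← h₃, ← map_sub, LocalMetric.ric]
    congr 1
    ext a
    have h₄ := γ.nablaEnd_nabla_sub hy hΩ (S.contDiffAt_ξ hy hΩ) a (W y)
    rw [sub_apply, LocalMetric.nablaEndFlip_apply, h₄]
    simp [LocalMetric.curv]
    abel
  rw [LocalMetric.div, h₁, map_add, map_add, map_smul, h₂,
    S.trace_nablaEndFlip_of_orthogonal hy hΩ h0, pairing, S.adj_nabla_ξ hy hΩ,
    γ.ric_symm hy hΩ]
  simp
  ring

end LocalParacontact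

/-! ### Tangent vectors and vector fields in charts -/

section Chart

variable {m : ℕ} {M : Type*} [TopologicalSpace M] [ChartedSpace (Model m) M]
  [IsManifold (𝓡 m) ∞ M]

/-- The coordinates, in the preferred chart at `x₀`, of tangent vectors at `p`. Only meaningful for
`p` in the domain of this chart. -/
def toChart (x₀ p : M) : TangentSpace (𝓡 m) p →L[ℝ] Model m :=
  (trivializationAt (Model m) (fun p : M ↦ TangentSpace (𝓡 m) p) x₀).continuousLinearMapAt ℝ p

/-- The tangent vectors at `p` with given coordinates in the preferred chart at `x₀`. -/
def ofChart (x₀ p : M) : Model m →L[ℝ] TangentSpace (𝓡 m) p :=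
  (trivializationAt (Model m) (fun p : M ↦ TangentSpace (𝓡 m) p) x₀).symmL ℝ p

/-- The expression of a vector field in the preferred chart at `x₀`. -/
def hat (x₀ : M) (V : ∀ p : M, TangentSpace (𝓡 m) p) (y : Model m) : Model m :=
  toChart x₀ ((chartAt (Model m) x₀).symm y) (V ((chartAt (Model m) x₀).symm y))

variable {x₀ p : M}

lemma mem_baseSet (hp : p ∈ (chartAt (Model m) x₀).source) :
    p ∈ (trivializationAt (Model m) (fun p : M ↦ TangentSpace (𝓡 m) p) x₀).baseSet := by
  rwa [TangentBundle.trivializationAt_baseSet]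

lemma toChart_ofChart (hp : p ∈ (chartAt (Model m) x₀).source) (a : Model m) :
    toChart x₀ p (ofChart x₀ p a) = a :=
  Trivialization.continuousLinearMapAt_symmL _ (mem_baseSet hp) a

lemma ofChart_toChart (hp : p ∈ (chartAt (Model m) x₀).source) (u : TangentSpace (𝓡 m) p) :
    ofChart x₀ p (toChart x₀ p u) = u :=
  Trivialization.symmL_continuousLinearMapAt _ (mem_baseSet hp) u

lemma toChart_apply (hp : p ∈ (chartAt (Model m) x₀).source) (u : TangentSpace (𝓡 m) p) :
    toChart x₀ p u
      = (trivializationAt (Model m) (fun p : M ↦ TangentSpace (𝓡 m) p) x₀ ⟨p, u⟩).2 := by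
  rw [toChart, Trivialization.continuousLinearMapAt_apply,
    Trivialization.coe_linearMapAt_of_mem _ (mem_baseSet hp)]

lemma toChart_injective (hp : p ∈ (chartAt (Model m) x₀).source) :
    Function.Injective (toChart (m := m) x₀ p) :=
  fun u v h ↦ (ofChart_toChart hp u).symm.trans
    ((congrArg (ofChart x₀ p) h).trans (ofChart_toChart hp v))

/-- The tangent space at a point of the chart domain, in coordinates. -/
def chartEquiv (hp : p ∈ (chartAt (Model m) x₀).source) : TangentSpace (𝓡 m) p ≃ₗ[ℝ] Model m where
  __ := (toChart x₀ p).toLinearMap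
  invFun := ofChart x₀ p
  left_inv := ofChart_toChart hp
  right_inv := toChart_ofChart hp

omit [IsManifold (𝓡 m) ∞ M] in
lemma symm_mem {y : Model m} (hy : y ∈ (chartAt (Model m) x₀).target) :
    (chartAt (Model m) x₀).symm y ∈ (chartAt (Model m) x₀).source :=
  (chartAt (Model m) x₀).map_target hy

omit [IsManifold (𝓡 m) ∞ M] in
lemma isOpen_target : IsOpen (chartAt (Model m) x₀).target := (chartAt (Model m) x₀).open_target

lemma mfderiv_chart (hp : p ∈ (chartAt (Model m) x₀).source) :
    mfderiv (𝓡 m) 𝓘(ℝ, Model m) (chartAt (Model m) x₀) p = toChart x₀ p := by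
  rw [toChart, TangentBundle.continuousLinearMapAt_trivializationAt hp]
  rfl

lemma mfderiv_chart_symm {y : Model m} (hy : y ∈ (chartAt (Model m) x₀).target) :
    mfderiv 𝓘(ℝ, Model m) (𝓡 m) (chartAt (Model m) x₀).symm y
      = ofChart x₀ ((chartAt (Model m) x₀).symm y) := by
  have h := TangentBundle.symmL_trivializationAt (I := 𝓡 m) (x₀ := x₀) (symm_mem hy)
  rw [ofChart, h]
  have h₁ : extChartAt (𝓡 m) x₀ ((chartAt (Model m) x₀).symm y) = y := by
    simp [extChartAt, hy]
  rw [h₁]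
  simp only [modelWithCornersSelf_coe, range_id, mfderivWithin_univ]
  rfl

lemma mdifferentiableAt_chart_symm {y : Model m} (hy : y ∈ (chartAt (Model m) x₀).target) :
    MDifferentiableAt 𝓘(ℝ, Model m) (𝓡 m) (chartAt (Model m) x₀).symm y :=
  mdifferentiableAt_atlas_symm (chart_mem_atlas _ x₀) hy

lemma contMDiffAt_chart_symm {y : Model m} (hy : y ∈ (chartAt (Model m) x₀).target) :
    ContMDiffAt 𝓘(ℝ, Model m) (𝓡 m) ∞ (chartAt (Model m) x₀).symm y :=
  (contMDiffOn_chart_symm (I := 𝓡 m) (x := x₀)).contMDiffAt (isOpen_target.mem_nhds hy)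

lemma contMDiffAt_chart (hp : p ∈ (chartAt (Model m) x₀).source) :
    ContMDiffAt (𝓡 m) 𝓘(ℝ, Model m) ∞ (chartAt (Model m) x₀) p :=
  (contMDiffOn_chart (I := 𝓡 m) (x := x₀)).contMDiffAt
    ((chartAt (Model m) x₀).open_source.mem_nhds hp)

/-- The derivative of a function, in a chart. -/
lemma mvfderiv_ofChart {f : M → ℝ} {y : Model m} (hy : y ∈ (chartAt (Model m) x₀).target)
    (hf : MDifferentiableAt (𝓡 m) 𝓘(ℝ, ℝ) f ((chartAt (Model m) x₀).symm y)) (a : Model m) :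
    mvfderiv (𝓡 m) f ((chartAt (Model m) x₀).symm y) (ofChart x₀ _ a)
      = fderiv ℝ (f ∘ (chartAt (Model m) x₀).symm) y a := by
  have h := mfderiv_comp y hf (mdifferentiableAt_chart_symm hy)
  rw [mfderiv_chart_symm hy, mfderiv_eq_fderiv] at h
  rw [h]
  rfl

lemma differentiableAt_hat {V : ∀ p : M, TangentSpace (𝓡 m) p} {y : Model m}
    (hy : y ∈ (chartAt (Model m) x₀).target)
    (hV : MDifferentiableAt (𝓡 m) (𝓡 m).tangent (T% V) ((chartAt (Model m) x₀).symm y)) :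
    DifferentiableAt ℝ (hat x₀ V) y := by
  rw [Trivialization.mdifferentiableAt_section_iff _ (trivializationAt (Model m)
    (fun p : M ↦ TangentSpace (𝓡 m) p) x₀) _ (mem_baseSet (symm_mem hy))] at hV
  have h := hV.comp y (mdifferentiableAt_chart_symm hy)
  refine (mdifferentiableAt_iff_differentiableAt.1 h).congr_of_eventuallyEq ?_
  filter_upwards [isOpen_target.mem_nhds hy] with z hz
  exact toChart_apply (symm_mem hz) _

lemma contDiffAt_hat {V : ∀ p : M, TangentSpace (𝓡 m) p} {y : Model m}
    (hy : y ∈ (chartAt (Model m) x₀).target)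
    (hV : ContMDiffAt (𝓡 m) (𝓡 m).tangent ∞ (T% V) ((chartAt (Model m) x₀).symm y)) :
    ContDiffAt ℝ ∞ (hat x₀ V) y := by
  have hV' := (Trivialization.contMDiffAt_section_iff (trivializationAt (Model m)
    (fun p : M ↦ TangentSpace (𝓡 m) p) x₀) (mem_baseSet (symm_mem hy))).1 hV
  have h := hV'.comp y (contMDiffAt_chart_symm hy)
  refine (contMDiffAt_iff_contDiffAt.1 h).congr_of_eventuallyEq ?_
  filter_upwards [isOpen_target.mem_nhds hy] with z hz
  exact toChart_apply (symm_mem hz) _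

lemma contMDiffAt_of_contDiffAt_hat {V : ∀ p : M, TangentSpace (𝓡 m) p}
    (hp : p ∈ (chartAt (Model m) x₀).source)
    (hV : ContDiffAt ℝ ∞ (hat x₀ V) (chartAt (Model m) x₀ p)) :
    ContMDiffAt (𝓡 m) (𝓡 m).tangent ∞ (T% V) p := by
  refine (Trivialization.contMDiffAt_section_iff (trivializationAt (Model m)
    (fun p : M ↦ TangentSpace (𝓡 m) p) x₀) (mem_baseSet hp)).2 ?_
  refine (hV.contMDiffAt.comp p (contMDiffAt_chart hp)).congr_of_eventuallyEq ?_
  filter_upwards [(chartAt (Model m) x₀).open_source.mem_nhds hp] with q hq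
  simp only [Function.comp_apply, hat]
  rw [(chartAt (Model m) x₀).left_inv hq, toChart_apply hq]

/-- The vector field with constant coordinates in the preferred chart at `x₀`. -/
def constField (x₀ : M) (a : Model m) (p : M) : TangentSpace (𝓡 m) p := ofChart x₀ p a

lemma hat_constField (a : Model m) {y : Model m} (hy : y ∈ (chartAt (Model m) x₀).target) :
    hat x₀ (constField x₀ a) y = a :=
  toChart_ofChart (symm_mem hy) a

lemma contMDiffAt_constField (a : Model m) (hp : p ∈ (chartAt (Model m) x₀).source) :
    ContMDiffAt (𝓡 m) (𝓡 m).tangent ∞ (T% (constField x₀ a)) p := by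
  refine contMDiffAt_of_contDiffAt_hat hp (contDiffAt_const (c := a) |>.congr_of_eventuallyEq ?_)
  filter_upwards [isOpen_target.mem_nhds ((chartAt (Model m) x₀).map_source hp)] with z hz
    using hat_constField a hz

lemma mdifferentiableAt_constField (a : Model m) (hp : p ∈ (chartAt (Model m) x₀).source) :
    MDifferentiableAt (𝓡 m) (𝓡 m).tangent (T% (constField x₀ a)) p :=
  (contMDiffAt_constField a hp).mdifferentiableAt (by simp)

lemma coordField_eq (hp : p ∈ (chartAt (Model m) x₀).source) (i : Fin m) :
    coordField x₀ i p = ofChart x₀ p (EuclideanSpace.basisFun (Fin m) ℝ i) := by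
  rw [coordField, Trivialization.localFrame_apply_of_mem_baseSet _ _ (mem_baseSet hp)]
  simp only [Trivialization.basisAt, ofChart, Trivialization.symmL_apply _ (mem_baseSet hp)]
  simp

/-- The Lie bracket, in a chart. -/
lemma toChart_mlieBracket {V W : ∀ p : M, TangentSpace (𝓡 m) p} {y : Model m}
    (hy : y ∈ (chartAt (Model m) x₀).target)
    (hV : MDifferentiableAt (𝓡 m) (𝓡 m).tangent (T% V) ((chartAt (Model m) x₀).symm y))
    (hW : MDifferentiableAt (𝓡 m) (𝓡 m).tangent (T% W) ((chartAt (Model m) x₀).symm y)) :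
    toChart x₀ _ (mlieBracket (𝓡 m) V W ((chartAt (Model m) x₀).symm y))
      = fderiv ℝ (hat x₀ W) y (hat x₀ V y) - fderiv ℝ (hat x₀ V) y (hat x₀ W y) := by
  have hm : ∀ (V : ∀ p : M, TangentSpace (𝓡 m) p), ∀ z ∈ (chartAt (Model m) x₀).target,
      mpullback 𝓘(ℝ, Model m) (𝓡 m) (chartAt (Model m) x₀).symm V z = hat x₀ V z := by
    intro V z hz
    rw [mpullback_apply, mfderiv_chart_symm hz, hat]
    have h : ContinuousLinearMap.inverse (ofChart x₀ ((chartAt (Model m) x₀).symm z))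
        = toChart x₀ _ :=
      ContinuousLinearMap.inverse_eq
        (ContinuousLinearMap.ext fun u ↦ ofChart_toChart (symm_mem hz) u)
        (ContinuousLinearMap.ext fun u ↦ toChart_ofChart (symm_mem hz) u)
    exact congrArg (fun L : TangentSpace (𝓡 m) ((chartAt (Model m) x₀).symm z) →L[ℝ] Model m ↦
      L (V ((chartAt (Model m) x₀).symm z))) h
  have : IsManifold (𝓡 m) (minSmoothness ℝ 2) M := by
    rw [minSmoothness_of_isRCLikeNormedField]
    exact IsManifold.of_le (n := ∞) ENat.LEInfty.out
  have h := mpullback_mlieBracket (I := 𝓘(ℝ, Model m)) (x₀ := y) (n := ∞) hV hW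
    (contMDiffAt_chart_symm hy) (by simp; exact ENat.LEInfty.out)
  have hm' : ∀ V : ∀ p : M, TangentSpace (𝓡 m) p,
      mpullback 𝓘(ℝ, Model m) (𝓡 m) (chartAt (Model m) x₀).symm V =ᶠ[𝓝 y] hat x₀ V := fun V ↦ by
    filter_upwards [isOpen_target.mem_nhds hy] with z hz using hm V z hz
  rw [hm _ y hy] at h
  refine Eq.trans h ?_
  have h₁ : ∀ V W : ∀ z : Model m, TangentSpace 𝓘(ℝ, Model m) z,
      mlieBracket 𝓘(ℝ, Model m) V W y = lieBracket ℝ V W y := fun V W ↦ by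
    rw [← mlieBracketWithin_univ, mlieBracketWithin_eq_lieBracketWithin]
    exact congrFun (lieBracketWithin_univ (V := V) (W := W)) y
  exact ((hm' V).mlieBracket_vectorField_eq (hm' W)).trans (h₁ _ _)

end Chart

/-! ### The Levi-Civita connection in charts -/

namespace Metric

variable {m : ℕ} {M : Type*} [TopologicalSpace M] [ChartedSpace (Model m) M]
  [IsManifold (𝓡 m) ∞ M] (g : Metric m M) (x₀ : M)

/-- The expression of the metric in the preferred chart at `x₀`. -/
def chartForm (y : Model m) : Model m →L[ℝ] Model m →L[ℝ] ℝ :=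
  LinearMap.toContinuousBilinearMap (LinearMap.mk₂ ℝ
    (fun a b ↦ g.val _ (ofChart x₀ ((chartAt (Model m) x₀).symm y) a)
      (ofChart x₀ ((chartAt (Model m) x₀).symm y) b)) (by simp) (by simp) (by simp) (by simp))

lemma chartForm_apply (y a b : Model m) : g.chartForm x₀ y a b
    = g.val _ (ofChart x₀ ((chartAt (Model m) x₀).symm y) a)
      (ofChart x₀ ((chartAt (Model m) x₀).symm y) b) := rfl

lemma contMDiffAt_val {V W : ∀ p : M, TangentSpace (𝓡 m) p} {p : M}
    (hV : ContMDiffAt (𝓡 m) (𝓡 m).tangent ∞ (T% V) p)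
    (hW : ContMDiffAt (𝓡 m) (𝓡 m).tangent ∞ (T% W) p) :
    ContMDiffAt (𝓡 m) 𝓘(ℝ, ℝ) ∞ (fun p ↦ g.val p (V p) (W p)) p := by
  have h : ContMDiffAt (𝓡 m) ((𝓡 m).prod 𝓘(ℝ, ℝ)) ∞
      (fun p ↦ TotalSpace.mk' ℝ (E := Bundle.Trivial M ℝ) p (g.val p (V p) (W p))) p := by
    apply ContMDiffAt.clm_bundle_apply₂ (F₁ := Model m) (F₂ := Model m)
    · exact g.contMDiff p
    · exact hV
    · exact hW
  simp only [contMDiffAt_totalSpace] at h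
  exact h.2

lemma contDiffOn_chartForm : ContDiffOn ℝ ∞ (g.chartForm x₀) (chartAt (Model m) x₀).target := by
  refine contDiffOn_clm_apply.2 fun a ↦ contDiffOn_clm_apply.2 fun b y hy ↦ ?_
  exact (contMDiffAt_iff_contDiffAt.1 ((g.contMDiffAt_val (contMDiffAt_constField a (symm_mem hy))
    (contMDiffAt_constField b (symm_mem hy))).comp y (contMDiffAt_chart_symm hy))).contDiffWithinAt

/-- The local expression of a semi-Riemannian metric in the preferred chart at `x₀`. -/
def inChart : LocalMetric (chartAt (Model m) x₀).target where
  G := g.chartForm x₀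
  contDiffOn := g.contDiffOn_chartForm x₀
  symm := fun _ _ _ _ ↦ g.symm _ _ _
  nondegenerate := fun y hy u hu ↦ by
    have h : ofChart x₀ ((chartAt (Model m) x₀).symm y) u = 0 := by
      refine g.nondegenerate _ _ fun v ↦ ?_
      have := hu (toChart x₀ _ v)
      rwa [chartForm_apply, ofChart_toChart (symm_mem hy)] at this
    rw [← toChart_ofChart (symm_mem hy) u, h, map_zero]

variable {x₀}

lemma inChart_G_apply (y a b : Model m) : (g.inChart x₀).G y a b
    = g.val _ (ofChart x₀ ((chartAt (Model m) x₀).symm y) a)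
      (ofChart x₀ ((chartAt (Model m) x₀).symm y) b) := rfl

variable {y : Model m} (hy : y ∈ (chartAt (Model m) x₀).target)
include hy

lemma inChart_G_toChart (u v : TangentSpace (𝓡 m) ((chartAt (Model m) x₀).symm y)) :
    (g.inChart x₀).G y (toChart x₀ _ u) (toChart x₀ _ v) = g.val _ u v := by
  rw [inChart_G_apply, ofChart_toChart (symm_mem hy), ofChart_toChart (symm_mem hy)]

omit [IsManifold (𝓡 m) ∞ M] g in
lemma eventually_mem_target : ∀ᶠ z in 𝓝 y, z ∈ (chartAt (Model m) x₀).target :=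
  isOpen_target.mem_nhds hy

lemma fderiv_val {V W : ∀ p : M, TangentSpace (𝓡 m) p}
    (hV : MDifferentiableAt (𝓡 m) (𝓡 m).tangent (T% V) ((chartAt (Model m) x₀).symm y))
    (hW : MDifferentiableAt (𝓡 m) (𝓡 m).tangent (T% W) ((chartAt (Model m) x₀).symm y))
    (a : Model m) :
    mvfderiv (𝓡 m) (fun p ↦ g.val p (V p) (W p)) ((chartAt (Model m) x₀).symm y) (ofChart x₀ _ a)
      = fderiv ℝ (g.inChart x₀).G y a (hat x₀ V y) (hat x₀ W y)
        + (g.inChart x₀).G y (fderiv ℝ (hat x₀ V) y a) (hat x₀ W y)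
        + (g.inChart x₀).G y (hat x₀ V y) (fderiv ℝ (hat x₀ W) y a) := by
  have hV' := differentiableAt_hat hy hV
  have hW' := differentiableAt_hat hy hW
  have hG := ((g.inChart x₀).contDiffAt_G isOpen_target hy).differentiableAt (by simp)
  rw [mvfderiv_ofChart hy (g.mdifferentiableAt_apply hV hW)]
  have h : (fun p ↦ g.val p (V p) (W p)) ∘ (chartAt (Model m) x₀).symm
      =ᶠ[𝓝 y] fun z ↦ (g.inChart x₀).G z (hat x₀ V z) (hat x₀ W z) := by
    filter_upwards [eventually_mem_target hy] with z hz
    exact (g.inChart_G_toChart hz _ _).symm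
  rw [h.fderiv_eq, fderiv_clm_apply (by fun_prop) hW', fderiv_clm_apply hG hV']
  simp
  ring

/-- The Levi-Civita connection, in a chart. -/
theorem toChart_nabla {V : ∀ p : M, TangentSpace (𝓡 m) p}
    (hV : MDifferentiableAt (𝓡 m) (𝓡 m).tangent (T% V) ((chartAt (Model m) x₀).symm y))
    (a : Model m) :
    toChart x₀ _ (g.leviCivita V ((chartAt (Model m) x₀).symm y) (ofChart x₀ _ a))
      = (g.inChart x₀).nabla (hat x₀ V) y a := by
  have hs := symm_mem hy
  refine eq_of_forall_apply_eq ((g.inChart x₀).nondegenerate y hy) fun c ↦ ?_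
  have hA := mdifferentiableAt_constField (x₀ := x₀) a hs
  have hC := mdifferentiableAt_constField (x₀ := x₀) c hs
  have h := g.val_nabla hA hV hC
  have hc : ∀ a, hat x₀ (constField x₀ a) =ᶠ[𝓝 y] fun _ ↦ a := fun a ↦ by
    filter_upwards [eventually_mem_target hy] with z hz using hat_constField a hz
  have hc' : ∀ a, fderiv ℝ (hat x₀ (constField x₀ a)) y = 0 := fun a ↦ by
    rw [(hc a).fderiv_eq]; simp
  have hVy : V ((chartAt (Model m) x₀).symm y) = ofChart x₀ _ (hat x₀ V y) :=
    (ofChart_toChart hs _).symm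
  have hval : ∀ (u v : TangentSpace (𝓡 m) ((chartAt (Model m) x₀).symm y)),
      g.val _ u v = (g.inChart x₀).G y (toChart x₀ _ u) (toChart x₀ _ v) :=
    fun u v ↦ (g.inChart_G_toChart hy u v).symm
  have hk : g.koszul (constField x₀ a) V (constField x₀ c) ((chartAt (Model m) x₀).symm y)
      = 2 * ((g.inChart x₀).christoffelLower y a (hat x₀ V y) c
        + (g.inChart x₀).G y (fderiv ℝ (hat x₀ V) y a) c) := by
    have e₁ := g.fderiv_val hy hV hC a
    have e₂ := g.fderiv_val hy hA hC (hat x₀ V y)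
    have e₃ := g.fderiv_val hy hA hV c
    have b₁ := toChart_mlieBracket hy hA hV
    have b₂ := toChart_mlieBracket hy hA hC
    have b₃ := toChart_mlieBracket hy hV hC
    rw [← hVy] at e₂
    simp only [hc', hat_constField _ hy] at e₁ e₂ e₃ b₁ b₂ b₃
    rw [koszul, hval _ (constField x₀ c _), hval _ (V _), hval _ (constField x₀ a _), b₁, b₂, b₃]
    simp only [constField] at e₁ e₂ e₃ ⊢
    rw [e₁, e₂, e₃, toChart_ofChart hs, toChart_ofChart hs, LocalMetric.christoffelLower_apply]
    have hs' := (g.inChart x₀).symm y hy a (fderiv ℝ (hat x₀ V) y c)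
    simp
    linarith
  rw [hk, hval] at h
  simp only [constField, toChart_ofChart hs] at h
  rw [LocalMetric.nabla_apply, map_add, add_apply, LocalMetric.G_Γ _ hy]
  refine Eq.trans h ?_
  ring

end Metric

/-! ### Curvature in charts -/

namespace LocalMetric

variable {E : Type*} [NormedAddCommGroup E] [NormedSpace ℝ E] [FiniteDimensional ℝ E]
  {Ω : Set E} (γ : LocalMetric Ω)

lemma contDiffAt_nabla {y : E} (hy : y ∈ Ω) (hΩ : IsOpen Ω) {V : E → E}
    (hV : ContDiffAt ℝ ∞ V y) : ContDiffAt ℝ ∞ (γ.nabla V) y := by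
  have hΓ' : ContDiffAt ℝ ∞ (fun z ↦ (γ.Γ z).flip) y :=
    (ContinuousLinearMap.flipₗᵢ ℝ E E E).contDiff.contDiffAt.comp y (γ.contDiffAt_Γ hΩ hy)
  exact (hV.fderiv_right (m := ∞) (by simp)).add (hΓ'.clm_apply hV)

/-- The Ricci tensor as a bilinear form. -/
def ricBilin (y : E) : LinearMap.BilinForm ℝ E :=
  LinearMap.mk₂ ℝ (γ.ric y)
    (fun u u' v ↦ by
      rw [ric, ric, ric, ← map_add]; congr 1; ext w; simp [curv]; abel)
    (fun c u v ↦ by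
      rw [ric, ric, smul_eq_mul, ← smul_eq_mul, ← map_smul]; congr 1; ext w
      simp [curv, smul_sub, smul_add])
    (fun u v v' ↦ by
      rw [ric, ric, ric, ← map_add]; congr 1; ext w; simp [curv]; abel)
    (fun c u v ↦ by
      rw [ric, ric, smul_eq_mul, ← smul_eq_mul, ← map_smul]; congr 1; ext w
      simp)

lemma ricBilin_apply (y u v : E) : γ.ricBilin y u v = γ.ric y u v := rfl

end LocalMetric

namespace Metric

variable {m : ℕ} {M : Type*} [TopologicalSpace M] [ChartedSpace (Model m) M]
  [IsManifold (𝓡 m) ∞ M] (g : Metric m M) {x₀ : M}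

variable {y : Model m} (hy : y ∈ (chartAt (Model m) x₀).target)
include hy

omit [IsManifold (𝓡 m) ∞ M] g in
lemma eventually_chart_symm {P : M → Prop}
    (h : ∀ᶠ q in 𝓝 ((chartAt (Model m) x₀).symm y), P q) :
    ∀ᶠ z in 𝓝 y, P ((chartAt (Model m) x₀).symm z) :=
  ((chartAt (Model m) x₀).continuousAt_symm hy).eventually h

lemma hat_nabla {V Y : ∀ p : M, TangentSpace (𝓡 m) p}
    (hV : MDifferentiableAt (𝓡 m) (𝓡 m).tangent (T% V) ((chartAt (Model m) x₀).symm y)) :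
    hat x₀ (fun p ↦ g.leviCivita V p (Y p)) y
      = (g.inChart x₀).nabla (hat x₀ V) y (hat x₀ Y y) := by
  rw [← g.toChart_nabla hy hV, hat, hat, ofChart_toChart (symm_mem hy)]

lemma hat_nabla_eventuallyEq {V Y : ∀ p : M, TangentSpace (𝓡 m) p}
    (hV : ∀ᶠ q in 𝓝 ((chartAt (Model m) x₀).symm y),
      ContMDiffAt (𝓡 m) (𝓡 m).tangent ∞ (T% V) q) :
    hat x₀ (fun p ↦ g.leviCivita V p (Y p))
      =ᶠ[𝓝 y] fun z ↦ (g.inChart x₀).nabla (hat x₀ V) z (hat x₀ Y z) := by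
  filter_upwards [eventually_mem_target hy, eventually_chart_symm hy hV] with z hz hVz
  exact g.hat_nabla hz (hVz.mdifferentiableAt (by simp))

lemma contDiffAt_hat_nabla {V Y : ∀ p : M, TangentSpace (𝓡 m) p}
    (hV : ∀ᶠ q in 𝓝 ((chartAt (Model m) x₀).symm y),
      ContMDiffAt (𝓡 m) (𝓡 m).tangent ∞ (T% V) q)
    (hY : ContMDiffAt (𝓡 m) (𝓡 m).tangent ∞ (T% Y) ((chartAt (Model m) x₀).symm y)) :
    ContDiffAt ℝ ∞ (hat x₀ (fun p ↦ g.leviCivita V p (Y p))) y :=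
  (((g.inChart x₀).contDiffAt_nabla hy isOpen_target (contDiffAt_hat hy hV.self_of_nhds)).clm_apply
    (contDiffAt_hat hy hY)).congr_of_eventuallyEq (g.hat_nabla_eventuallyEq hy hV)

lemma contMDiffAt_nabla {V Y : ∀ p : M, TangentSpace (𝓡 m) p}
    (hV : ∀ᶠ q in 𝓝 ((chartAt (Model m) x₀).symm y),
      ContMDiffAt (𝓡 m) (𝓡 m).tangent ∞ (T% V) q)
    (hY : ContMDiffAt (𝓡 m) (𝓡 m).tangent ∞ (T% Y) ((chartAt (Model m) x₀).symm y)) :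
    ContMDiffAt (𝓡 m) (𝓡 m).tangent ∞ (T% (fun p ↦ g.leviCivita V p (Y p)))
      ((chartAt (Model m) x₀).symm y) := by
  refine contMDiffAt_of_contDiffAt_hat (x₀ := x₀) (symm_mem hy) ?_
  rw [(chartAt (Model m) x₀).right_inv hy]
  exact g.contDiffAt_hat_nabla hy hV hY

/-- The curvature, in a chart. -/
theorem toChart_curvature {X Y Z : ∀ p : M, TangentSpace (𝓡 m) p}
    (hX : ContMDiffAt (𝓡 m) (𝓡 m).tangent ∞ (T% X) ((chartAt (Model m) x₀).symm y))
    (hY : ContMDiffAt (𝓡 m) (𝓡 m).tangent ∞ (T% Y) ((chartAt (Model m) x₀).symm y))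
    (hZ : ∀ᶠ q in 𝓝 ((chartAt (Model m) x₀).symm y),
      ContMDiffAt (𝓡 m) (𝓡 m).tangent ∞ (T% Z) q) :
    toChart x₀ _ (g.curvature X Y Z ((chartAt (Model m) x₀).symm y))
      = (g.inChart x₀).curv y (hat x₀ X y) (hat x₀ Y y) (hat x₀ Z y) := by
  set γ := g.inChart x₀
  have hs := symm_mem hy
  have hZy := contDiffAt_hat hy hZ.self_of_nhds
  have hΓ := (γ.contDiffAt_Γ isOpen_target hy).differentiableAt (by simp)
  -- The iterated covariant derivative `∇_Y (∇_X Z)`, in the chart.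
  have key : ∀ {X Y : ∀ p : M, TangentSpace (𝓡 m) p}
      (_ : ContMDiffAt (𝓡 m) (𝓡 m).tangent ∞ (T% X) ((chartAt (Model m) x₀).symm y))
      (_ : ContMDiffAt (𝓡 m) (𝓡 m).tangent ∞ (T% Y) ((chartAt (Model m) x₀).symm y)),
      toChart x₀ _ (g.leviCivita (fun p ↦ g.leviCivita Z p (X p)) ((chartAt (Model m) x₀).symm y)
        (Y ((chartAt (Model m) x₀).symm y)))
      = γ.nablaEnd (γ.nabla (hat x₀ Z)) y (hat x₀ Y y) (hat x₀ X y)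
        + γ.nabla (hat x₀ Z) y (γ.nabla (hat x₀ X) y (hat x₀ Y y)) := by
    intro X Y hX hY
    have h₁ := g.contMDiffAt_nabla hy hZ hX
    have h₂ := g.hat_nabla (Y := Y) hy (h₁.mdifferentiableAt (by simp))
    refine Eq.trans h₂ ?_
    have h₃ := g.hat_nabla_eventuallyEq (Y := X) hy hZ
    have h₄ : γ.nabla (hat x₀ fun p ↦ g.leviCivita Z p (X p)) y
        = γ.nabla (fun z ↦ γ.nabla (hat x₀ Z) z (hat x₀ X z)) y := by
      rw [LocalMetric.nabla, LocalMetric.nabla, h₃.fderiv_eq, h₃.eq_of_nhds]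
    rw [h₄, γ.nabla_clm_apply ((γ.contDiffAt_nabla hy isOpen_target hZy).differentiableAt
      (by simp)) ((contDiffAt_hat hy hX).differentiableAt (by simp))]
  have hb := toChart_mlieBracket hy (hX.mdifferentiableAt (by simp))
    (hY.mdifferentiableAt (by simp))
  have hn := g.hat_nabla (Y := mlieBracket (𝓡 m) X Y) hy
    (hZ.self_of_nhds.mdifferentiableAt (by simp))
  rw [curvature, map_sub, map_sub, key hY hX, key hX hY]
  have hn' : toChart x₀ _ (g.leviCivita Z ((chartAt (Model m) x₀).symm y)
      (mlieBracket (𝓡 m) X Y ((chartAt (Model m) x₀).symm y)))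
      = γ.nabla (hat x₀ Z) y (fderiv ℝ (hat x₀ Y) y (hat x₀ X y)
        - fderiv ℝ (hat x₀ X) y (hat x₀ Y y)) := by
    rw [← hb]; exact hn
  rw [hn']
  have hR := γ.nablaEnd_nabla_sub hy isOpen_target hZy (hat x₀ X y) (hat x₀ Y y)
  rw [← neg_eq_iff_eq_neg] at hR
  rw [← hR, γ.nabla_apply (hat x₀ X), γ.nabla_apply (hat x₀ Y),
    γ.Γ_symm isOpen_target hy (hat x₀ X y)]
  simp only [map_sub, map_add]
  abel

/-- The Ricci tensor, in a chart. It is defined through the coordinate frame of the preferred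
chart at the point itself, but as a trace it may be computed in any chart. -/
theorem ricci_eq (u v : TangentSpace (𝓡 m) ((chartAt (Model m) x₀).symm y)) :
    g.ricci ((chartAt (Model m) x₀).symm y) u v
      = (g.inChart x₀).ric y (toChart x₀ _ u) (toChart x₀ _ v) := by
  set p := (chartAt (Model m) x₀).symm y with hp
  have hs : p ∈ (chartAt (Model m) x₀).source := symm_mem hy
  have hb : ∀ i, coordBasis (m := m) p i = coordField (m := m) p i p := fun i ↦
    (Trivialization.localFrame_apply_of_mem_baseSet _ _
      (FiberBundle.mem_baseSet_trivializationAt' p)).symm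
  have hc : ∀ i, ∀ q ∈ (chartAt (Model m) p).source,
      ContMDiffAt (𝓡 m) (𝓡 m).tangent ∞ (T% (coordField (m := m) p i)) q := by
    intro i q hq
    refine (contMDiffAt_constField (x₀ := p) (EuclideanSpace.basisFun (Fin m) ℝ i) hq
      ).congr_of_eventuallyEq ?_
    filter_upwards [(chartAt (Model m) p).open_source.mem_nhds hq] with q' hq'
    rw [coordField_eq hq']; rfl
  have hc' : ∀ i, ContMDiffAt (𝓡 m) (𝓡 m).tangent ∞ (T% (coordField (m := m) p i)) p :=
    fun i ↦ hc i p (mem_chart_source _ p)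
  have hc'' : ∀ i, ∀ᶠ q in 𝓝 p, ContMDiffAt (𝓡 m) (𝓡 m).tangent ∞
      (T% (coordField (m := m) p i)) q := fun i ↦ by
      filter_upwards [(chartAt (Model m) p).open_source.mem_nhds (mem_chart_source _ p)] with q hq
        using hc i q hq
  have key : g.ricci p = ((g.inChart x₀).ricBilin y).compl₁₂ (toChart x₀ p).toLinearMap
      (toChart x₀ p).toLinearMap := by
    refine LinearMap.BilinForm.ext_basis (coordBasis p) fun i j ↦ ?_
    rw [ricci, ← LinearMap.BilinForm.toMatrix_apply, LinearMap.BilinForm.toMatrix_toBilin,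
      Matrix.of_apply, LinearMap.compl₁₂_apply,
      LocalMetric.ricBilin_apply, LocalMetric.ric, traceCLM_apply,
      ← LinearMap.trace_conj' _ (chartEquiv hs).symm,
      LinearMap.trace_eq_matrix_trace ℝ (coordBasis p), Matrix.trace]
    refine Finset.sum_congr rfl fun k _ ↦ ?_
    rw [Matrix.diag_apply, LinearMap.toMatrix_apply]
    congr 2
    refine toChart_injective hs ?_
    have h := g.toChart_curvature hy (hc' i) (hc' k) (hc'' j)
    refine h.trans ?_
    rw [LinearEquiv.conj_apply]
    refine Eq.trans ?_ (toChart_ofChart hs _).symm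
    simp only [hb]
    rfl
  rw [key]; rfl

end Metric

/-! ### The energy density and the paracontact structure in charts -/

namespace Metric

variable {m : ℕ} {M : Type*} [TopologicalSpace M] [ChartedSpace (Model m) M]
  [IsManifold (𝓡 m) ∞ M] (g : Metric m M) {x₀ : M}

/-- The differential of a vector field, as a map to `TM`, projects to the identity. -/
lemma mfderiv_proj_mfderiv {V : ∀ p : M, TangentSpace (𝓡 m) p} {p : M}
    (hV : MDifferentiableAt (𝓡 m) (𝓡 m).tangent (T% V) p) (u : TangentSpace (𝓡 m) p) :
    mfderiv (𝓡 m).tangent (𝓡 m) (TotalSpace.proj : TangentBundle (𝓡 m) M → M)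
      (TotalSpace.mk' (Model m) p (V p)) (mfderiv (𝓡 m) (𝓡 m).tangent (T% V) p u) = u := by
  have h := mfderiv_comp p (mdifferentiableAt_proj (TangentSpace (𝓡 m) : M → Type _)
    (p := TotalSpace.mk' (Model m) p (V p)) (IB := 𝓡 m)) hV
  have h₁ : (TotalSpace.proj : TangentBundle (𝓡 m) M → M) ∘ (T% V) = id := rfl
  rw [h₁, mfderiv_id] at h
  exact (congrArg (fun L : TangentSpace (𝓡 m) p →L[ℝ] TangentSpace (𝓡 m) p ↦ L u) h).symm

/-- The connection map sends the differential of a vector field to its covariant derivative. -/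
lemma connectionMap_mfderiv {V : ∀ p : M, TangentSpace (𝓡 m) p} {p : M}
    (hV : MDifferentiableAt (𝓡 m) (𝓡 m).tangent (T% V) p) (u : TangentSpace (𝓡 m) p) :
    g.connectionMap (TotalSpace.mk' (Model m) p (V p))
      (mfderiv (𝓡 m) (𝓡 m).tangent (T% V) p u) = g.leviCivita V p u := by
  have hp := mem_chart_source (Model m) p
  set y := chartAt (Model m) p p with hy
  have hyt : y ∈ (chartAt (Model m) p).target := (chartAt (Model m) p).map_source hp
  have hpy : (chartAt (Model m) p).symm y = p := (chartAt (Model m) p).left_inv hp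
  set e := trivializationAt (Model m) (fun x : M ↦ TangentSpace (𝓡 m) x) p with he
  have hpe : p ∈ e.baseSet := mem_baseSet hp
  -- The derivative of the fibre coordinate of `V`.
  have h₁ : mfderiv (𝓡 m).tangent 𝓘(ℝ, Model m) (fun q : TangentBundle (𝓡 m) M ↦ (e q).2)
      (TotalSpace.mk' (Model m) p (V p)) (mfderiv (𝓡 m) (𝓡 m).tangent (T% V) p u)
      = fderiv ℝ (hat p V) y (toChart p p u) := by
    have hd : MDifferentiableAt (𝓡 m).tangent 𝓘(ℝ, Model m)
        (fun q : TangentBundle (𝓡 m) M ↦ (e q).2) (TotalSpace.mk' (Model m) p (V p)) := by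
      have h₀ := e.contMDiffOn (IB := 𝓡 m) (n := ∞)
      have h₂ := (h₀.contMDiffAt (e.open_source.mem_nhds (e.mem_source.2 hpe :
        TotalSpace.mk' (Model m) p (V p) ∈ e.source))).mdifferentiableAt (by simp)
      exact h₂.snd
    have h₂ := mfderiv_comp p hd hV
    have h₃ : (fun q : TangentBundle (𝓡 m) M ↦ (e q).2) ∘ (T% V)
        =ᶠ[𝓝 p] hat p V ∘ chartAt (Model m) p := by
      filter_upwards [(chartAt (Model m) p).open_source.mem_nhds hp] with q hq
      simp only [Function.comp_apply, hat]
      rw [(chartAt (Model m) p).left_inv hq, toChart_apply hq]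
    have hV' : MDifferentiableAt (𝓡 m) (𝓡 m).tangent (T% V) ((chartAt (Model m) p).symm y) := by
      rwa [hpy]
    have h₄ : mfderiv (𝓡 m) 𝓘(ℝ, Model m) (hat p V ∘ chartAt (Model m) p) p
        = mfderiv 𝓘(ℝ, Model m) 𝓘(ℝ, Model m) (hat p V) y
          ∘L mfderiv (𝓡 m) 𝓘(ℝ, Model m) (chartAt (Model m) p) p :=
      mfderiv_comp p (differentiableAt_hat hyt hV').mdifferentiableAt
      ((contMDiffAt_chart hp).mdifferentiableAt (by simp))
    rw [mfderiv_chart hp, mfderiv_eq_fderiv] at h₄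
    rw [h₃.mfderiv_eq] at h₂
    have h₅ := h₂.symm.trans h₄
    exact congrArg (fun L : TangentSpace (𝓡 m) p →L[ℝ] Model m ↦ L u) h₅
  -- The covariant derivative of the extension with constant coordinates.
  have hE : MDifferentiableAt (𝓡 m) (𝓡 m).tangent (T% (FiberBundle.extend (Model m) (V p))) p :=
    FiberBundle.mdifferentiableAt_extend (𝓡 m) (Model m) (V p)
  have hE₁ : hat p (FiberBundle.extend (Model m) (V p)) =ᶠ[𝓝 y] fun _ ↦ hat p V y := by
    filter_upwards [eventually_mem_target hyt] with z hz
    have hz' := symm_mem hz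
    rw [hat, toChart_apply hz']
    have : FiberBundle.extend (Model m) (V p) ((chartAt (Model m) p).symm z)
        = e.symm ((chartAt (Model m) p).symm z) (e ⟨p, V p⟩).2 := rfl
    rw [this, e.mk_symm (mem_baseSet hz'), e.apply_symm_apply' (mem_baseSet hz')]
    rw [hat, hpy, toChart_apply hp]
  have h₂ : ∀ {W : ∀ p : M, TangentSpace (𝓡 m) p}
      (_ : MDifferentiableAt (𝓡 m) (𝓡 m).tangent (T% W) p),
      toChart p p (g.leviCivita W p u) = (g.inChart p).nabla (hat p W) y (toChart p p u) := by
    intro W hW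
    have hW' : MDifferentiableAt (𝓡 m) (𝓡 m).tangent (T% W) ((chartAt (Model m) p).symm y) := by
      rwa [hpy]
    have := g.toChart_nabla hyt hW' (toChart p p u)
    rw [hpy, ofChart_toChart hp] at this
    exact this
  refine toChart_injective hp ?_
  have hK : g.connectionMap (TotalSpace.mk' (Model m) p (V p))
      (mfderiv (𝓡 m) (𝓡 m).tangent (T% V) p u)
      = ofChart p p (fderiv ℝ (hat p V) y (toChart p p u))
        + g.leviCivita (FiberBundle.extend (Model m) (V p)) p u :=
    congrArg₂ (fun a b : TangentSpace (𝓡 m) p ↦ a + b) (congrArg (ofChart p p) h₁)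
      (congrArg (g.leviCivita (FiberBundle.extend (Model m) (V p)) p) (mfderiv_proj_mfderiv hV u))
  have h₃ := h₂ hE
  rw [LocalMetric.nabla_apply, hE₁.fderiv_eq, hE₁.eq_of_nhds] at h₃
  rw [hK, map_add, toChart_ofChart hp, h₂ hV, LocalMetric.nabla_apply, h₃]
  simp

lemma pullbackSasaki_apply {V : ∀ p : M, TangentSpace (𝓡 m) p} {p : M}
    (hV : MDifferentiableAt (𝓡 m) (𝓡 m).tangent (T% V) p) (u v : TangentSpace (𝓡 m) p) :
    g.pullbackSasaki V p u v
      = g.val p u v + g.val p (g.leviCivita V p u) (g.leviCivita V p v) := by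
  have h₁ := mfderiv_proj_mfderiv hV
  have h₂ := g.connectionMap_mfderiv hV
  refine congrArg₂ (fun a b : ℝ ↦ a + b) ?_ ?_
  · exact congrArg₂ (fun u v ↦ g.val p u v) (h₁ u) (h₁ v)
  · exact congrArg₂ (fun u v ↦ g.val p u v) (h₂ u) (h₂ v)

/-- The energy density of a vector field, in a chart, from the formula
`(V^* g^s)(u, v) = g(u, v) + g(∇_u V, ∇_v V)`. -/
theorem tr_pullbackSasaki {V : ∀ p : M, TangentSpace (𝓡 m) p} {y : Model m}
    (hy : y ∈ (chartAt (Model m) x₀).target)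
    (hV : MDifferentiableAt (𝓡 m) (𝓡 m).tangent (T% V) ((chartAt (Model m) x₀).symm y)) :
    g.tr _ (g.pullbackSasaki V ((chartAt (Model m) x₀).symm y))
      = m + pairing ((g.inChart x₀).G y) ((g.inChart x₀).nabla (hat x₀ V) y)
        ((g.inChart x₀).nabla (hat x₀ V) y) := by
  set p := (chartAt (Model m) x₀).symm y with hp
  have hs : p ∈ (chartAt (Model m) x₀).source := symm_mem hy
  set N := (g.inChart x₀).nabla (hat x₀ V) y
  have hn := (g.inChart x₀).nondegenerate y hy
  have hN : ∀ a, toChart x₀ p (g.leviCivita V p (ofChart x₀ p a)) = N a := g.toChart_nabla hy hV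
  rw [tr, ← LinearMap.trace_conj' _ (chartEquiv hs)]
  have key : (chartEquiv hs).conj ((g.flat p).symm.toLinearMap ∘ₗ g.pullbackSasaki V p)
      = (ContinuousLinearMap.id ℝ (Model m) + adj ((g.inChart x₀).G y) N ∘L N).toLinearMap := by
    ext1 a
    refine eq_of_forall_apply_eq hn fun b ↦ ?_
    set T := (g.flat p).symm (g.pullbackSasaki V p (ofChart x₀ p a)) with hT
    have h₁ : (chartEquiv hs).conj ((g.flat p).symm.toLinearMap ∘ₗ g.pullbackSasaki V p) a
      = toChart x₀ p T := rfl
    have h₂ : ∀ v, g.val p T v = g.pullbackSasaki V p (ofChart x₀ p a) v := fun v ↦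
      LinearMap.congr_fun ((g.flat p).apply_symm_apply
        (g.pullbackSasaki V p (ofChart x₀ p a))) v
    have h₃ : (g.inChart x₀).G y (toChart x₀ p T) b = g.val p T (ofChart x₀ p b) := by
      rw [← g.inChart_G_toChart hy, toChart_ofChart hs]
    rw [h₁, h₃, h₂, g.pullbackSasaki_apply hV, ← g.inChart_G_toChart hy,
      ← g.inChart_G_toChart hy, toChart_ofChart hs, toChart_ofChart hs, hN, hN]
    simp [adj_apply hn]
  rw [key, ← traceCLM_apply, map_add, traceCLM_apply]
  simp [pairing]

end Metric

/-- The exterior derivative of a 1-form metrically dual to a vector field, in a chart. -/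
lemma extDeriv_eq_inChart {m : ℕ} {M : Type*} [TopologicalSpace M] [ChartedSpace (Model m) M]
    [IsManifold (𝓡 m) ∞ M] (g : Metric m M) {x₀ : M} {η : ∀ x : M, TangentSpace (𝓡 m) x →L[ℝ] ℝ}
    {ξ : ∀ p : M, TangentSpace (𝓡 m) p} (hη : ∀ x v, η x v = g.val x (ξ x) v) {y : Model m}
    (hy : y ∈ (chartAt (Model m) x₀).target)
    (hξ : MDifferentiableAt (𝓡 m) (𝓡 m).tangent (T% ξ) ((chartAt (Model m) x₀).symm y))
    (a b : Model m) :
    extDeriv η ((chartAt (Model m) x₀).symm y) (ofChart x₀ _ a) (ofChart x₀ _ b)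
      = (1 / 2 : ℝ) * (fderiv ℝ (fun z ↦ (g.inChart x₀).G z (hat x₀ ξ z)) y a b
        - fderiv ℝ (fun z ↦ (g.inChart x₀).G z (hat x₀ ξ z)) y b a) := by
  have hs := symm_mem hy
  have hG := ((g.inChart x₀).contDiffAt_G isOpen_target hy).differentiableAt (by simp)
  have hξ' := differentiableAt_hat hy hξ
  have hE : ∀ a : Model m, MDifferentiableAt (𝓡 m) (𝓡 m).tangent
      (T% (FiberBundle.extend (Model m) (ofChart x₀ ((chartAt (Model m) x₀).symm y) a)))
      ((chartAt (Model m) x₀).symm y) := fun a ↦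
    FiberBundle.mdifferentiableAt_extend (𝓡 m) (Model m) _
  have hE' : ∀ a : Model m, hat x₀ (FiberBundle.extend (Model m)
      (ofChart x₀ ((chartAt (Model m) x₀).symm y) a)) y = a := fun a ↦ by
    rw [hat, FiberBundle.extend_apply_self, toChart_ofChart hs]
  have h₁ : ∀ a b : Model m, mvfderiv (𝓡 m) (fun p ↦ η p (FiberBundle.extend (Model m)
      (ofChart x₀ ((chartAt (Model m) x₀).symm y) b) p)) ((chartAt (Model m) x₀).symm y)
        (ofChart x₀ _ a)
      = fderiv ℝ (fun z ↦ (g.inChart x₀).G z (hat x₀ ξ z)) y a b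
        + (g.inChart x₀).G y (hat x₀ ξ y) (fderiv ℝ (hat x₀ (FiberBundle.extend (Model m)
          (ofChart x₀ ((chartAt (Model m) x₀).symm y) b))) y a) := by
    intro a b
    simp only [hη]
    rw [g.fderiv_val hy hξ (hE b), hE', fderiv_clm_apply hG hξ']
    simp
    ring
  have h₂ := toChart_mlieBracket hy (hE a) (hE b)
  rw [hE', hE'] at h₂
  rw [extDeriv, h₁, h₁, hη, ← g.inChart_G_toChart hy, h₂, map_sub]
  simp only [hat]
  ring

namespace ParacontactMetricStructure

variable {n : ℕ} {M : Type*} [TopologicalSpace M] [ChartedSpace (Model (2 * n + 1)) M]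
  [IsManifold (𝓡 (2 * n + 1)) ∞ M] (S : ParacontactMetricStructure n M) (x₀ : M)

lemma mdifferentiable_ξ (p : M) :
    MDifferentiableAt (𝓡 (2 * n + 1)) (𝓡 (2 * n + 1)).tangent (T% S.ξ) p :=
  (S.contMDiff_ξ p).mdifferentiableAt (by simp)

lemma val_ξ_ξ (p : M) : S.g.val p (S.ξ p) (S.ξ p) = 1 := by rw [← S.η_eq, S.η_ξ]

lemma val_ξ_φ (p : M) (v : TangentSpace (𝓡 (2 * n + 1)) p) : S.g.val p (S.ξ p) (S.φ p v) = 0 := by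
  rw [← S.extDeriv_eq, S.extDeriv_ξ]

/-- The expression of `φ` in a chart. -/
def chartφ (y : Model (2 * n + 1)) : Model (2 * n + 1) →L[ℝ] Model (2 * n + 1) :=
  toChart x₀ ((chartAt (Model (2 * n + 1)) x₀).symm y) ∘L S.φ _ ∘L ofChart x₀ _

lemma contMDiffAt_φ {V : ∀ p : M, TangentSpace (𝓡 (2 * n + 1)) p} {p : M}
    (hV : ContMDiffAt (𝓡 (2 * n + 1)) (𝓡 (2 * n + 1)).tangent ∞ (T% V) p) :
    ContMDiffAt (𝓡 (2 * n + 1)) (𝓡 (2 * n + 1)).tangent ∞ (T% (fun p ↦ S.φ p (V p))) p :=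
  ContMDiffAt.clm_bundle_apply (F₁ := Model (2 * n + 1)) (F₂ := Model (2 * n + 1))
    (E₁ := fun x : M ↦ TangentSpace (𝓡 (2 * n + 1)) x)
    (E₂ := fun x : M ↦ TangentSpace (𝓡 (2 * n + 1)) x)
    (S.contMDiff_φ p) hV

/-- The local expression of a paracontact metric structure in the preferred chart at `x₀`. -/
def inChart : LocalParacontact (S.g.inChart x₀) where
  ξ := hat x₀ S.ξ
  φ := S.chartφ x₀
  contDiffOn_ξ := fun y hy ↦ (contDiffAt_hat hy (S.contMDiff_ξ _)).contDiffWithinAt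
  contDiffOn_φ := contDiffOn_clm_apply.2 fun a y hy ↦
    (contDiffAt_hat hy (S.contMDiffAt_φ (contMDiffAt_constField a (symm_mem hy)))).contDiffWithinAt
  unit := fun y hy ↦ by rw [hat, S.g.inChart_G_toChart hy, S.val_ξ_ξ]
  G_ξ_φ := fun y hy v ↦ by
    rw [hat, chartφ, ContinuousLinearMap.comp_apply, S.g.inChart_G_toChart hy,
      ContinuousLinearMap.comp_apply, S.val_ξ_φ]
  φ_φ := fun y hy v ↦ by
    have hs := symm_mem hy
    simp only [chartφ, ContinuousLinearMap.comp_apply]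
    rw [ofChart_toChart hs, S.φ_φ, map_sub, toChart_ofChart hs, map_smul, S.η_eq,
      ← S.g.inChart_G_toChart hy, toChart_ofChart hs]
    rfl
  dη := fun y hy u v ↦ by
    have hs := symm_mem hy
    rw [← extDeriv_eq_inChart S.g S.η_eq hy (S.mdifferentiable_ξ _), S.extDeriv_eq,
      ← S.g.inChart_G_toChart hy, toChart_ofChart hs]
    rfl

end ParacontactMetricStructure

/-! ### The volume measure in charts -/

namespace Metric

variable {m : ℕ} {M : Type*} [TopologicalSpace M] [ChartedSpace (Model m) M]
  [IsManifold (𝓡 m) ∞ M] (g : Metric m M)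

/-- The density of the volume measure in the preferred chart at `x`. -/
def chartVol (x : M) (y : Model m) : ℝ :=
  (g.inChart x).vol (EuclideanSpace.basisFun (Fin m) ℝ).toBasis y

lemma volumeDensity_eq {x : M} {y : Model m} (hy : y ∈ (chartAt (Model m) x).target) :
    g.volumeDensity x ((chartAt (Model m) x).symm y) = g.chartVol x y := by
  simp only [volumeDensity, chartVol, LocalMetric.vol, LocalMetric.gram,
    coordField_eq (symm_mem hy), inChart_G_apply]
  simp

lemma chartVol_pos {x : M} {y : Model m} (hy : y ∈ (chartAt (Model m) x).target) :
    0 < g.chartVol x y := (g.inChart x).vol_pos _ hy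

lemma continuousOn_chartVol (x : M) :
    ContinuousOn (g.chartVol x) (chartAt (Model m) x).target := fun _ hy ↦
  ((g.inChart x).contDiffAt_vol _ hy isOpen_target).continuousAt.continuousWithinAt

/-- The change of coordinates from the preferred chart at `x` to that at `x'`. -/
def transition (x x' : M) (y : Model m) : Model m :=
  chartAt (Model m) x' ((chartAt (Model m) x).symm y)

omit g in
lemma hasFDerivAt_transition {x x' : M} {y : Model m} (hy : y ∈ (chartAt (Model m) x).target)
    (hy' : (chartAt (Model m) x).symm y ∈ (chartAt (Model m) x').source) :
    HasFDerivAt (transition x x') (toChart x' ((chartAt (Model m) x).symm y) ∘L ofChart x _) y := by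
  have h₁ := ((contMDiffAt_chart hy').mdifferentiableAt (by simp)).hasMFDerivAt
  have h₂ := (mdifferentiableAt_chart_symm hy).hasMFDerivAt
  rw [mfderiv_chart hy'] at h₁
  rw [mfderiv_chart_symm hy] at h₂
  exact (h₁.comp y h₂).hasFDerivAt

/-- The Gram matrices of two charts are congruent through the differential of the transition map. -/
lemma chartVol_transition {x x' : M} {y : Model m} (hy : y ∈ (chartAt (Model m) x).target)
    (hy' : (chartAt (Model m) x).symm y ∈ (chartAt (Model m) x').source) :
    |(toChart (m := m) x' ((chartAt (Model m) x).symm y) ∘L ofChart (m := m) x _).det|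
      * g.chartVol x' (transition x x' y) = g.chartVol x y := by
  set p := (chartAt (Model m) x).symm y with hp
  have hs : p ∈ (chartAt (Model m) x).source := symm_mem hy
  have hz : transition x x' y ∈ (chartAt (Model m) x').target := (chartAt _ x').map_source hy'
  have hzp : (chartAt (Model m) x').symm (transition x x' y) = p := (chartAt _ x').left_inv hy'
  rw [← g.volumeDensity_eq hz, ← g.volumeDensity_eq hy, hzp, ← hp]
  set L : Model m →L[ℝ] Model m := toChart x' p ∘L ofChart x p with hL
  set b := (EuclideanSpace.basisFun (Fin m) ℝ).toBasis with hb
  let B : LinearMap.BilinForm ℝ (Model m) :=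
    (g.bilin p).compl₁₂ (ofChart x' p).toLinearMap (ofChart x' p).toLinearMap
  have h₁ : (Matrix.of fun i j : Fin m ↦ g.val p (coordField x' i p) (coordField x' j p))
      = LinearMap.BilinForm.toMatrix b B := by
    ext i j
    simp only [Matrix.of_apply, coordField_eq hy', LinearMap.BilinForm.toMatrix_apply]
    simp [B, hb]
  have h₂ : (Matrix.of fun i j : Fin m ↦ g.val p (coordField x i p) (coordField x j p))
      = LinearMap.BilinForm.toMatrix b (B.comp L.toLinearMap L.toLinearMap) := by
    ext i j
    have h : ∀ a, ofChart x' p (L a) = ofChart x p a := fun a ↦ ofChart_toChart hy' _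
    simp only [Matrix.of_apply, coordField_eq hs, LinearMap.BilinForm.toMatrix_apply]
    simp only [LinearMap.BilinForm.comp_apply, B, LinearMap.compl₁₂_apply,
      ContinuousLinearMap.coe_coe, h, bilin_apply, hb]
    simp
  have h₃ : (LinearMap.toMatrix b b L.toLinearMap).det = L.det := by
    rw [LinearMap.det_toMatrix]
  rw [volumeDensity, volumeDensity, h₁, h₂, LinearMap.BilinForm.toMatrix_comp b b, Matrix.det_mul,
    Matrix.det_mul, Matrix.det_transpose, h₃, abs_mul, abs_mul,
    show |L.det| * |(LinearMap.BilinForm.toMatrix b B).det| * |L.det|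
      = |L.det| ^ 2 * |(LinearMap.BilinForm.toMatrix b B).det| by ring,
    Real.sqrt_mul (by positivity), Real.sqrt_sq (abs_nonneg _)]

variable [MeasurableSpace M] [BorelSpace M]

omit [IsManifold (𝓡 m) ∞ M] g in
lemma measurableSet_chart_image (x : M) {s : Set M} (hs : MeasurableSet s) :
    MeasurableSet ((chartAt (Model m) x).target ∩ (chartAt (Model m) x).symm ⁻¹' s) := by
  have h := (continuousOn_iff_continuous_domRestrict.1
    (chartAt (Model m) x).symm.continuousOn).measurable hs
  have h₁ := (isOpen_target (x₀ := x)).measurableSet.subtype_image h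
  convert h₁ using 1
  ext y
  simp [and_comm]

lemma aemeasurable_chart_symm (x : M) : AEMeasurable (chartAt (Model m) x).symm
    (((volume : Measure (Model m)).restrict (chartAt (Model m) x).target).withDensity
    (fun y ↦ ENNReal.ofReal (g.volumeDensity x ((chartAt (Model m) x).symm y)))) :=
  ((chartAt (Model m) x).symm.continuousOn.aemeasurable
    isOpen_target.measurableSet).mono_ac (withDensity_absolutelyContinuous _ _)

lemma chartVolume_apply (x : M) {s : Set M} (hs : MeasurableSet s) :
    g.chartVolume x s = ∫⁻ y in (chartAt (Model m) x).target ∩ (chartAt (Model m) x).symm ⁻¹' s,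
      ENNReal.ofReal (g.chartVol x y) := by
  have hs' := measurableSet_chart_image (m := m) x hs
  have ht : MeasurableSet (chartAt (Model m) x).target := isOpen_target.measurableSet
  have h₁ := (g.aemeasurable_chart_symm x).nullMeasurable hs
  rw [chartVolume, Measure.map_apply_of_aemeasurable (g.aemeasurable_chart_symm x) hs,
    withDensity_apply' _ _, Measure.restrict_restrict' ht, inter_comm]
  exact setLIntegral_congr_fun hs' fun y hy ↦ by rw [g.volumeDensity_eq hy.1]

/-- The volume measures of two charts agree on the intersection of their domains. -/
lemma chartVolume_congr {x x' : M} {s : Set M} (hs : MeasurableSet s)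
    (hx : s ⊆ (chartAt (Model m) x).source) (hx' : s ⊆ (chartAt (Model m) x').source) :
    g.chartVolume x s = g.chartVolume x' s := by
  have hA := measurableSet_chart_image (m := m) x hs
  rw [g.chartVolume_apply x hs, g.chartVolume_apply x' hs]
  have himage : (chartAt (Model m) x').target ∩ (chartAt (Model m) x').symm ⁻¹' s
      = transition x x' '' ((chartAt (Model m) x).target ∩ (chartAt (Model m) x).symm ⁻¹' s) := by
    ext z
    constructor
    · rintro ⟨hz, hzs⟩
      refine ⟨chartAt (Model m) x ((chartAt (Model m) x').symm z),
        ⟨(chartAt (Model m) x).map_source (hx hzs), ?_⟩, ?_⟩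
      · rw [mem_preimage, (chartAt (Model m) x).left_inv (hx hzs)]; exact hzs
      · rw [transition, (chartAt (Model m) x).left_inv (hx hzs), (chartAt _ x').right_inv hz]
    · rintro ⟨y, ⟨hy, hys⟩, rfl⟩
      refine ⟨(chartAt _ x').map_source (hx' hys), ?_⟩
      rw [mem_preimage, transition, (chartAt _ x').left_inv (hx' hys)]
      exact hys
  have hinj : InjOn (transition x x')
      ((chartAt (Model m) x).target ∩ (chartAt (Model m) x).symm ⁻¹' s) := by
    rintro y ⟨hy, hys⟩ z ⟨hz, hzs⟩ h
    have := (chartAt (Model m) x').injOn (hx' hys) (hx' hzs) h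
    exact (chartAt (Model m) x).symm.injOn hy hz this
  rw [himage, lintegral_image_eq_lintegral_abs_det_fderiv_mul volume hA
    (fun y hy ↦ (hasFDerivAt_transition hy.1 (hx' hy.2)).hasFDerivWithinAt) hinj]
  refine setLIntegral_congr_fun hA fun y hy ↦ ?_
  simp only
  rw [← ENNReal.ofReal_mul (abs_nonneg _), g.chartVol_transition hy.1 (hx' hy.2)]

lemma chartVolume_restrict (x : M) :
    (g.chartVolume x).restrict (chartAt (Model m) x).source = g.chartVolume x := by
  have ho : MeasurableSet (chartAt (Model m) x).source := (chartAt _ x).open_source.measurableSet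
  ext s hs
  rw [Measure.restrict_apply hs, g.chartVolume_apply x hs, g.chartVolume_apply x (hs.inter ho)]
  congr 2
  ext y
  constructor
  · rintro ⟨h₁, h₂, -⟩; exact ⟨h₁, h₂⟩
  · rintro ⟨h₁, h₂⟩; exact ⟨h₁, h₂, symm_mem h₁⟩

/-- In the domain of a chart, the volume measure is the measure of the chart. The supremum defining
the volume measure is bounded by its restriction to the complement of the chart domain plus the
measure of the chart, since the chart measures agree on overlaps. -/
theorem volumeMeasure_restrict (x : M) :
    g.volumeMeasure.restrict (chartAt (Model m) x).source = g.chartVolume x := by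
  have ho : MeasurableSet (chartAt (Model m) x).source := (chartAt _ x).open_source.measurableSet
  have hle : ∀ x, g.chartVolume x ≤ g.volumeMeasure := le_iSup g.chartVolume
  refine le_antisymm ?_ ?_
  · have h : g.volumeMeasure
        ≤ g.chartVolume x + g.volumeMeasure.restrict (chartAt (Model m) x).sourceᶜ := by
      refine iSup_le fun x' ↦ Measure.le_iff.2 fun s hs ↦ ?_
      have ho' : MeasurableSet (chartAt (Model m) x').source :=
        (chartAt _ x').open_source.measurableSet
      rw [← measure_inter_add_sdiff s ho, Measure.add_apply, Measure.restrict_apply hs]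
      refine add_le_add ?_ ?_
      · rw [← g.chartVolume_restrict x', Measure.restrict_apply (hs.inter ho),
          g.chartVolume_congr ((hs.inter ho).inter ho') (x' := x) inter_subset_right
            fun p hp ↦ hp.1.2]
        exact measure_mono fun p hp ↦ hp.1.1
      · rw [sdiff_eq]
        exact hle x' _
    have h' := Measure.restrict_mono_measure h (chartAt (Model m) x).source
    rwa [Measure.restrict_add, Measure.restrict_restrict ho, inter_compl_self,
      Measure.restrict_empty, add_zero, g.chartVolume_restrict] at h'
  · rw [← g.chartVolume_restrict x]
    exact Measure.restrict_mono_measure (hle x) _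

lemma volumeMeasure_apply {x : M} {s : Set M} (hs : MeasurableSet s)
    (hx : s ⊆ (chartAt (Model m) x).source) :
    g.volumeMeasure s = ∫⁻ y in (chartAt (Model m) x).target ∩ (chartAt (Model m) x).symm ⁻¹' s,
      ENNReal.ofReal (g.chartVol x y) := by
  rw [← g.chartVolume_apply x hs, ← g.volumeMeasure_restrict, Measure.restrict_apply hs,
    inter_eq_left.2 hx]

lemma setIntegral_chart {x : M} {f : M → ℝ} (hf : Continuous f) :
    ∫ p in (chartAt (Model m) x).source, f p ∂g.volumeMeasure
      = ∫ y in (chartAt (Model m) x).target,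
        g.chartVol x y * f ((chartAt (Model m) x).symm y) := by
  have ht : MeasurableSet (chartAt (Model m) x).target := isOpen_target.measurableSet
  have hd : AEMeasurable (fun y ↦ ENNReal.ofReal (g.volumeDensity x ((chartAt (Model m) x).symm y)))
      ((volume : Measure (Model m)).restrict (chartAt (Model m) x).target) := by
    refine AEMeasurable.ennreal_ofReal
      (((g.continuousOn_chartVol x).congr fun y hy ↦ ?_).aemeasurable ht)
    exact g.volumeDensity_eq hy
  rw [g.volumeMeasure_restrict, chartVolume, integral_map (g.aemeasurable_chart_symm x)
    hf.aestronglyMeasurable, integral_withDensity_eq_integral_toReal_smul₀ hd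
    (by simp)]
  refine setIntegral_congr_fun ht fun y hy ↦ ?_
  simp only [smul_eq_mul]
  rw [g.volumeDensity_eq hy, ENNReal.toReal_ofReal (g.chartVol_pos hy).le]

instance : IsLocallyFiniteMeasure g.volumeMeasure := by
  refine ⟨fun x ↦ ?_⟩
  obtain ⟨K, hK, hKt, hKc⟩ := local_compact_nhds (isOpen_target.mem_nhds
    ((chartAt (Model m) x).map_source (mem_chart_source (Model m) x)))
  have hi : IsOpen ((chartAt (Model m) x).source ∩ chartAt (Model m) x ⁻¹' interior K) :=
    (chartAt (Model m) x).isOpen_inter_preimage isOpen_interior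
  refine ⟨_, hi.mem_nhds ⟨mem_chart_source _ x, mem_interior_iff_mem_nhds.2 hK⟩, ?_⟩
  rw [g.volumeMeasure_apply hi.measurableSet inter_subset_left]
  have hint : IntegrableOn (g.chartVol x) K :=
    ((g.continuousOn_chartVol x).mono hKt).integrableOn_compact hKc
  refine (lintegral_mono_set ?_).trans_lt hint.lintegral_lt_top
  rintro y ⟨hy, -, hy'⟩
  rw [mem_preimage, (chartAt (Model m) x).right_inv hy] at hy'
  exact interior_subset hy'

instance : g.volumeMeasure.IsOpenPosMeasure := by
  refine ⟨fun U hU hne ↦ ?_⟩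
  obtain ⟨x, hx⟩ := hne
  have hV : IsOpen (U ∩ (chartAt (Model m) x).source) := hU.inter (chartAt _ x).open_source
  refine ne_of_gt (lt_of_lt_of_le ?_ (measure_mono (inter_subset_left :
    U ∩ (chartAt (Model m) x).source ⊆ U)))
  rw [g.volumeMeasure_apply hV.measurableSet inter_subset_right, pos_iff_ne_zero, ne_eq,
    setLIntegral_eq_zero_iff' (measurableSet_chart_image x hV.measurableSet)
    (((g.continuousOn_chartVol x).mono inter_subset_left).aemeasurable
      (measurableSet_chart_image x hV.measurableSet)).ennreal_ofReal]
  intro h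
  have hO : IsOpen ((chartAt (Model m) x).target ∩
    (chartAt (Model m) x).symm ⁻¹' (U ∩ (chartAt (Model m) x).source)) :=
    (chartAt (Model m) x).symm.isOpen_inter_preimage hV
  have h₀ : (volume : Measure (Model m)) ((chartAt (Model m) x).target ∩
    (chartAt (Model m) x).symm ⁻¹' (U ∩ (chartAt (Model m) x).source)) = 0 := by
    refine measure_mono_null (fun y hy ↦ ?_) (ae_iff.1 h)
    simp only [mem_ofPred_eq, Classical.not_imp]
    exact ⟨hy, by simpa using g.chartVol_pos hy.1⟩
  refine (hO.measure_pos volume ⟨chartAt (Model m) x x, ?_⟩).ne' h₀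
  have hx' := mem_chart_source (Model m) x
  refine ⟨(chartAt _ x).map_source hx', ?_⟩
  rw [mem_preimage, (chartAt _ x).left_inv hx']
  exact ⟨hx, hx'⟩

end Metric

/-! ### The divergence theorem -/

/-- Continuity at a point of the chart domain can be checked in the chart. -/
lemma continuousAt_of_chart {m : ℕ} {M : Type*} [TopologicalSpace M] [ChartedSpace (Model m) M]
    {X : Type*} [TopologicalSpace X] {f : M → X} {x₀ p : M}
    (hp : p ∈ (chartAt (Model m) x₀).source)
    (h : ContinuousAt (fun y ↦ f ((chartAt (Model m) x₀).symm y)) (chartAt (Model m) x₀ p)) :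
    ContinuousAt f p := by
  refine (h.comp ((chartAt (Model m) x₀).continuousAt hp)).congr ?_
  filter_upwards [(chartAt (Model m) x₀).open_source.mem_nhds hp] with q hq
  exact congrArg f ((chartAt (Model m) x₀).left_inv hq)

namespace LocalMetric

variable {E : Type*} [NormedAddCommGroup E] [NormedSpace ℝ E] [FiniteDimensional ℝ E]
  {Ω : Set E} (γ : LocalMetric Ω)

omit [FiniteDimensional ℝ E] in
lemma nabla_congr {V W : E → E} {y : E} (h : V =ᶠ[𝓝 y] W) : γ.nabla V y = γ.nabla W y := by
  rw [nabla, nabla, h.fderiv_eq, h.eq_of_nhds]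

end LocalMetric

namespace Metric

variable {m : ℕ} {M : Type*} [TopologicalSpace M] [ChartedSpace (Model m) M]
  [IsManifold (𝓡 m) ∞ M] (g : Metric m M)

/-- The divergence `tr ∇X` of a vector field. -/
def divergence (X : ∀ p : M, TangentSpace (𝓡 m) p) (p : M) : ℝ :=
  LinearMap.trace ℝ _ (g.leviCivita X p).toLinearMap

lemma divergence_chart {X : ∀ p : M, TangentSpace (𝓡 m) p} {x₀ : M} {y : Model m}
    (hy : y ∈ (chartAt (Model m) x₀).target)
    (hX : MDifferentiableAt (𝓡 m) (𝓡 m).tangent (T% X) ((chartAt (Model m) x₀).symm y)) :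
    g.divergence X ((chartAt (Model m) x₀).symm y) = (g.inChart x₀).div (hat x₀ X) y := by
  rw [divergence, ← LinearMap.trace_conj' _ (chartEquiv (symm_mem hy)), LocalMetric.div,
    traceCLM_apply]
  congr 1
  ext1 a
  exact g.toChart_nabla hy hX a

lemma leviCivita_of_eventuallyEq_zero {X : ∀ p : M, TangentSpace (𝓡 m) p} {p : M}
    (hX : MDifferentiableAt (𝓡 m) (𝓡 m).tangent (T% X) p)
    (h0 : ∀ᶠ q in 𝓝 p, X q = 0) : g.leviCivita X p = 0 := by
  have hz : MDifferentiableAt (𝓡 m) (𝓡 m).tangent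
      (T% (0 : ∀ p : M, TangentSpace (𝓡 m) p)) p :=
    (contMDiff_zeroSection ℝ (TangentSpace (𝓡 m) : M → Type _) (n := ∞)).mdifferentiableAt (by simp)
  have h := g.leviCivita.isCovariantDerivativeOnUniv.congr_of_eventuallyEq (σ := X) (σ' := 0)
    (x := p) hX hz univ_mem h0
  rw [h, g.leviCivita.zero]
  rfl

lemma divergence_of_eventuallyEq_zero {X : ∀ p : M, TangentSpace (𝓡 m) p} {p : M}
    (hX : MDifferentiableAt (𝓡 m) (𝓡 m).tangent (T% X) p)
    (h0 : ∀ᶠ q in 𝓝 p, X q = 0) : g.divergence X p = 0 := by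
  rw [divergence, g.leviCivita_of_eventuallyEq_zero hX h0]
  exact map_zero _

lemma continuous_divergence {X : ∀ p : M, TangentSpace (𝓡 m) p}
    (hX : ContMDiff (𝓡 m) (𝓡 m).tangent ∞ (T% X)) : Continuous (g.divergence X) := by
  refine continuous_iff_continuousAt.2 fun p ↦ ?_
  have hp := mem_chart_source (Model m) p
  have hy := (chartAt (Model m) p).map_source hp
  refine continuousAt_of_chart hp ?_
  have h : ContinuousAt ((g.inChart p).div (hat p X)) (chartAt (Model m) p p) :=
    (traceCLM (Model m)).continuous.continuousAt.comp
      ((g.inChart p).contDiffAt_nabla hy isOpen_target (contDiffAt_hat hy (hX _))).continuousAt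
  refine h.congr ?_
  filter_upwards [eventually_mem_target hy] with z hz
  exact (g.divergence_chart hz ((hX _).mdifferentiableAt (by simp))).symm

lemma divergence_add {X Y : ∀ p : M, TangentSpace (𝓡 m) p} {p : M}
    (hX : MDifferentiableAt (𝓡 m) (𝓡 m).tangent (T% X) p)
    (hY : MDifferentiableAt (𝓡 m) (𝓡 m).tangent (T% Y) p) :
    g.divergence (X + Y) p = g.divergence X p + g.divergence Y p := by
  rw [divergence, g.leviCivita.isCovariantDerivativeOnUniv.add hX hY]
  exact map_add _ _ _

lemma divergence_sum {ι : Type*} (s : Finset ι) {X : ι → ∀ p : M, TangentSpace (𝓡 m) p} {p : M}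
    (hX : ∀ i, MDifferentiableAt (𝓡 m) (𝓡 m).tangent (T% (X i)) p) :
    g.divergence (fun q ↦ ∑ i ∈ s, X i q) p = ∑ i ∈ s, g.divergence (X i) p := by
  classical
  have hs : ∀ s : Finset ι, MDifferentiableAt (𝓡 m) (𝓡 m).tangent
      (T% (fun q ↦ ∑ i ∈ s, X i q)) p := fun s ↦ MDifferentiableAt.sum_section fun i _ ↦ hX i
  induction s using Finset.induction_on with
  | empty =>
    refine g.divergence_of_eventuallyEq_zero (hs ∅) ?_
    simp
  | insert i s hi ih =>
    rw [Finset.sum_insert hi, ← ih, ← g.divergence_add (hX i) (hs s)]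
    congr 1
    funext q
    simp [Finset.sum_insert hi]

variable [T2Space M] [MeasurableSpace M] [BorelSpace M]

/-- The divergence theorem, for fields supported in the domain of a chart. -/
lemma integral_divergence_of_subset_source {X : ∀ p : M, TangentSpace (𝓡 m) p}
    (hX : ContMDiff (𝓡 m) (𝓡 m).tangent ∞ (T% X)) {K : Set M} (hK : IsCompact K) {x₀ : M}
    (hKs : K ⊆ (chartAt (Model m) x₀).source) (h0 : ∀ p ∉ K, X p = 0) :
    ∫ p, g.divergence X p ∂g.volumeMeasure = 0 := by
  have hXd : ∀ p, MDifferentiableAt (𝓡 m) (𝓡 m).tangent (T% X) p := fun p ↦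
    (hX p).mdifferentiableAt (by simp)
  have hdiv : ∀ p ∉ (chartAt (Model m) x₀).source, g.divergence X p = 0 := fun p hp ↦
    g.divergence_of_eventuallyEq_zero (hXd p) (by
      filter_upwards [hK.isClosed.isOpen_compl.mem_nhds fun h ↦ hp (hKs h)] with q hq using h0 q hq)
  rw [← setIntegral_eq_integral_of_forall_compl_eq_zero hdiv,
    g.setIntegral_chart (g.continuous_divergence hX)]
  set Y := (chartAt (Model m) x₀).target.indicator (hat x₀ X) with hY
  have hYeq : ∀ y ∈ (chartAt (Model m) x₀).target, Y =ᶠ[𝓝 y] hat x₀ X := fun y hy ↦ by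
    filter_upwards [eventually_mem_target hy] with z hz using indicator_of_mem hz _
  have hK' : IsCompact (chartAt (Model m) x₀ '' K) :=
    hK.image_of_continuousOn ((chartAt (Model m) x₀).continuousOn.mono hKs)
  have hKt : chartAt (Model m) x₀ '' K ⊆ (chartAt (Model m) x₀).target := by
    rintro _ ⟨p, hp, rfl⟩
    exact (chartAt (Model m) x₀).map_source (hKs hp)
  have hY0 : ∀ y ∉ chartAt (Model m) x₀ '' K, Y y = 0 := fun y hy ↦ by
    by_cases hyt : y ∈ (chartAt (Model m) x₀).target
    · rw [hY, indicator_of_mem hyt, hat, h0, map_zero]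
      exact fun h ↦ hy ⟨_, h, (chartAt (Model m) x₀).right_inv hyt⟩
    · exact indicator_of_notMem hyt _
  have hYt : tsupport Y ⊆ chartAt (Model m) x₀ '' K :=
    closure_minimal (fun y hy ↦ by_contra fun h ↦ hy (hY0 y h)) hK'.isClosed
  have hYs : ContDiff ℝ 1 Y := by
    refine contDiff_iff_contDiffAt.2 fun y ↦ ?_
    by_cases hyt : y ∈ (chartAt (Model m) x₀).target
    · exact ((contDiffAt_hat hyt (hX _)).of_le (by simp)).congr_of_eventuallyEq (hYeq y hyt)
    · refine (contDiffAt_const (c := (0 : Model m))).congr_of_eventuallyEq ?_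
      filter_upwards [hK'.isClosed.isOpen_compl.mem_nhds fun h ↦ hyt (hKt h)] with z hz
        using hY0 z hz
  refine Eq.trans ?_ ((g.inChart x₀).integral_vol_mul_div
    (EuclideanSpace.basisFun (Fin m) ℝ).toBasis volume (isOpen_target (x₀ := x₀)) hYs
    (HasCompactSupport.intro hK' hY0) (hYt.trans hKt))
  refine Eq.trans (setIntegral_congr_fun (isOpen_target (x₀ := x₀)).measurableSet fun y hy ↦ ?_)
    (setIntegral_eq_integral_of_forall_compl_eq_zero ?_)
  · rw [g.divergence_chart hy (hXd _), LocalMetric.div, LocalMetric.div,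
      (g.inChart x₀).nabla_congr (hYeq y hy)]
    rfl
  · intro y hy
    have h : Y =ᶠ[𝓝 y] fun _ ↦ 0 := by
      filter_upwards [hK'.isClosed.isOpen_compl.mem_nhds fun h ↦ hy (hKt h)] with z hz
        using hY0 z hz
    simp only [LocalMetric.div, (g.inChart x₀).nabla_congr h]
    simp [LocalMetric.nabla]

variable [SecondCountableTopology M]

/-- The divergence theorem, for compactly supported vector fields. -/
theorem integral_divergence {X : ∀ p : M, TangentSpace (𝓡 m) p}
    (hX : ContMDiff (𝓡 m) (𝓡 m).tangent ∞ (T% X)) {K : Set M} (hK : IsCompact K)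
    (h0 : ∀ p ∉ K, X p = 0) : ∫ p, g.divergence X p ∂g.volumeMeasure = 0 := by
  have : LocallyCompactSpace M := ChartedSpace.locallyCompactSpace (Model m) M
  obtain ⟨f, hf⟩ := SmoothPartitionOfUnity.exists_isSubordinate_chartAt_source (𝓡 m) M
  have hfin := f.locallyFinite.finite_nonempty_inter_compact hK
  set s := hfin.toFinset with hs
  have hfX : ∀ i, ContMDiff (𝓡 m) (𝓡 m).tangent ∞ (T% (fun p ↦ f i p • X p)) := fun i ↦
    ContMDiff.smul_section (f i).contMDiff hX
  have hsum : X = fun p ↦ ∑ i ∈ s, f i p • X p := by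
    funext p
    by_cases hp : p ∈ K
    · rw [← Finset.sum_smul]
      have h₁ := f.sum_eq_one (mem_univ p)
      rw [finsum_eq_sum_of_support_subset (s := s)] at h₁
      · rw [h₁, one_smul]
      · intro i hi
        simp only [hs, Finite.coe_toFinset]
        exact ⟨p, hi, hp⟩
    · simp [h0 p hp]
  have hK' : ∀ i, IsCompact (K ∩ tsupport (f i)) := fun i ↦ hK.inter_right (isClosed_tsupport _)
  have h0' : ∀ i, ∀ p ∉ K ∩ tsupport (f i), f i p • X p = 0 := fun i p hp ↦ by
    by_cases hpK : p ∈ K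
    · rw [image_eq_zero_of_notMem_tsupport fun h ↦ hp ⟨hpK, h⟩, zero_smul]
    · rw [h0 p hpK, smul_zero]
  rw [hsum]
  simp only [fun p ↦ g.divergence_sum s (X := fun i p ↦ f i p • X p) (p := p)
    fun i ↦ (hfX i p).mdifferentiableAt (by simp)]
  rw [integral_finsetSum]
  · exact Finset.sum_eq_zero fun i _ ↦ g.integral_divergence_of_subset_source (hfX i) (hK' i)
      (inter_subset_right.trans (hf i)) (h0' i)
  · intro i _
    refine (g.continuous_divergence (hfX i)).integrable_of_hasCompactSupport
      (HasCompactSupport.intro (hK' i) fun p hp ↦ ?_)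
    refine g.divergence_of_eventuallyEq_zero ((hfX i p).mdifferentiableAt (by simp)) ?_
    filter_upwards [(hK' i).isClosed.isOpen_compl.mem_nhds hp] with q hq using h0' i q hq

end Metric

/-! ### Smooth families of vector fields -/

section PartialDerivatives

variable {E F : Type*} [NormedAddCommGroup E] [NormedSpace ℝ E] [NormedAddCommGroup F]
  [NormedSpace ℝ F] {f : ℝ × E → F} {t : ℝ} {y : E}

lemma fderiv_snd_eq (hf : DifferentiableAt ℝ f (t, y)) :
    fderiv ℝ (fun z ↦ f (t, z)) y = fderiv ℝ f (t, y) ∘L ContinuousLinearMap.inr ℝ ℝ E :=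
  (hf.hasFDerivAt.comp y (hasFDerivAt_prodMk_right t y)).fderiv

lemma hasDerivAt_fst (hf : DifferentiableAt ℝ f (t, y)) :
    HasDerivAt (fun s ↦ f (s, y)) (fderiv ℝ f (t, y) (1, 0)) t := by
  have h := (hf.hasFDerivAt.comp t (hasFDerivAt_prodMk_left t y)).hasDerivAt
  simpa [Function.comp_def] using h

lemma eventually_differentiableAt (hf : ContDiffAt ℝ ∞ f (t, y)) :
    ∀ᶠ q in 𝓝 (t, y), DifferentiableAt ℝ f q :=
  ((hf.of_le (m := 1) (by simp)).eventually (by simp)).mono fun _ h ↦ h.differentiableAt (by simp)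

omit [NormedSpace ℝ E] in
lemma tendsto_prodMk_left : Tendsto (fun s : ℝ ↦ (s, y)) (𝓝 t) (𝓝 (t, y)) :=
  (continuous_id.prodMk continuous_const).tendsto' _ _ rfl

omit [NormedSpace ℝ E] in
lemma tendsto_prodMk_right : Tendsto (fun z : E ↦ (t, z)) (𝓝 y) (𝓝 (t, y)) :=
  (continuous_const.prodMk continuous_id).tendsto' _ _ rfl

lemma contDiffAt_deriv_fst (hf : ContDiffAt ℝ ∞ f (t, y)) :
    ContDiffAt ℝ ∞ (fun q : ℝ × E ↦ deriv (fun s ↦ f (s, q.2)) q.1) (t, y) := by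
  have h : ContDiffAt ℝ ∞ (fun q ↦ fderiv ℝ f q (1, 0)) (t, y) :=
    (hf.fderiv_right (m := ∞) (by simp)).clm_apply contDiffAt_const
  refine h.congr_of_eventuallyEq ?_
  filter_upwards [eventually_differentiableAt hf] with q hq using (hasDerivAt_fst hq).deriv

lemma contDiffAt_fderiv_snd (hf : ContDiffAt ℝ ∞ f (t, y)) :
    ContDiffAt ℝ ∞ (fun q : ℝ × E ↦ fderiv ℝ (fun z ↦ f (q.1, z)) q.2) (t, y) := by
  have h : ContDiffAt ℝ ∞ (fun q ↦ fderiv ℝ f q ∘L ContinuousLinearMap.inr ℝ ℝ E) (t, y) :=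
    (hf.fderiv_right (m := ∞) (by simp)).clm_comp contDiffAt_const
  refine h.congr_of_eventuallyEq ?_
  filter_upwards [eventually_differentiableAt hf] with q hq using fderiv_snd_eq hq

/-- The derivative in the parameter commutes with the derivative in the space variables. -/
lemma hasDerivAt_fderiv_snd (hf : ContDiffAt ℝ ∞ f (t, y)) :
    HasDerivAt (fun s ↦ fderiv ℝ (fun z ↦ f (s, z)) y)
      (fderiv ℝ (fun z ↦ deriv (fun s ↦ f (s, z)) t) y) t := by
  have hd : DifferentiableAt ℝ (fderiv ℝ f) (t, y) :=
    (hf.fderiv_right (m := ∞) (by simp)).differentiableAt (by simp)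
  have h₁ : HasDerivAt (fun s ↦ fderiv ℝ f (s, y) ∘L ContinuousLinearMap.inr ℝ ℝ E)
      (fderiv ℝ (fderiv ℝ f) (t, y) (1, 0) ∘L ContinuousLinearMap.inr ℝ ℝ E) t := by
    have := (hasDerivAt_fst hd).clm_comp (hasDerivAt_const t (ContinuousLinearMap.inr ℝ ℝ E))
    simpa using this
  have h₂ : fderiv ℝ (fun z ↦ deriv (fun s ↦ f (s, z)) t) y
      = fderiv ℝ (fderiv ℝ f) (t, y) (1, 0) ∘L ContinuousLinearMap.inr ℝ ℝ E := by
    have he : (fun z ↦ deriv (fun s ↦ f (s, z)) t) =ᶠ[𝓝 y] fun z ↦ fderiv ℝ f (t, z) (1, 0) := by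
      filter_upwards [tendsto_prodMk_right.eventually (eventually_differentiableAt hf)] with z hz
        using (hasDerivAt_fst hz).deriv
    have hd' : DifferentiableAt ℝ (fun z ↦ fderiv ℝ f (t, z)) y :=
      hd.comp y (hasFDerivAt_prodMk_right t y).differentiableAt
    rw [he.fderiv_eq, fderiv_clm_apply hd' (differentiableAt_const _),
      fderiv_snd_eq (f := fderiv ℝ f) hd]
    ext a
    have hs := hf.isSymmSndFDerivAt (by simp; exact ENat.LEInfty.out) (0, a) (1, 0)
    simpa using hs
  rw [h₂]
  refine h₁.congr_of_eventuallyEq ?_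
  filter_upwards [tendsto_prodMk_left.eventually (eventually_differentiableAt hf)] with s hs
    using fderiv_snd_eq hs

end PartialDerivatives

namespace LocalMetric

variable {E : Type*} [NormedAddCommGroup E] [NormedSpace ℝ E] [FiniteDimensional ℝ E]
  {Ω : Set E} (γ : LocalMetric Ω) {t : ℝ} {y : E}

lemma contDiffAt_pairing (hy : y ∈ Ω) (hΩ : IsOpen Ω) {N : ℝ × E → E →L[ℝ] E}
    (hN : ContDiffAt ℝ ∞ N (t, y)) :
    ContDiffAt ℝ ∞ (fun q ↦ pairing (γ.G q.2) (N q) (N q)) (t, y) := by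
  have hG : ContDiffAt ℝ ∞ (fun q : ℝ × E ↦ γ.G q.2) (t, y) :=
    ContDiffAt.comp (t, y) (γ.contDiffAt_G hΩ hy) contDiffAt_snd
  have hI : ContDiffAt ℝ ∞ (fun q : ℝ × E ↦ (γ.G q.2).inverse) (t, y) :=
    ContDiffAt.comp (t, y) (γ.contDiffAt_inverse_G hΩ hy) contDiffAt_snd
  have hC : ContDiffAt ℝ ∞ (fun q ↦ (ContinuousLinearMap.compL ℝ E E ℝ).flip (N q)) (t, y) :=
    ((ContinuousLinearMap.compL ℝ E E ℝ).flip.contDiff.contDiffAt).comp (t, y) hN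
  exact (traceCLM E).contDiff.contDiffAt.comp (t, y) ((hI.clm_comp (hC.clm_comp hG)).clm_comp hN)

lemma hasDerivAt_pairing (hy : y ∈ Ω) {N : ℝ → E →L[ℝ] E} {N' : E →L[ℝ] E}
    (hN : HasDerivAt N N' t) :
    HasDerivAt (fun s ↦ pairing (γ.G y) (N s) (N s)) (2 * pairing (γ.G y) N' (N t)) t := by
  have hC : HasDerivAt (fun s ↦ (ContinuousLinearMap.compL ℝ E E ℝ).flip (N s))
      ((ContinuousLinearMap.compL ℝ E E ℝ).flip N') t :=
    ((ContinuousLinearMap.compL ℝ E E ℝ).flip).hasFDerivAt.comp_hasDerivAt t hN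
  have hA := (hasDerivAt_const t (γ.G y).inverse).clm_comp
    (hC.clm_comp (hasDerivAt_const t (γ.G y)))
  have h := (traceCLM E).hasFDerivAt.comp_hasDerivAt t (hA.clm_comp hN)
  have hc := pairing_comm (γ.nondegenerate y hy) (γ.symm y hy) (N t) N'
  refine h.congr_deriv ?_
  simp only [pairing, adj] at hc ⊢
  simp [hc]
  ring

lemma contDiffAt_nabla_family (hy : y ∈ Ω) (hΩ : IsOpen Ω) {f : ℝ × E → E}
    (hf : ContDiffAt ℝ ∞ f (t, y)) :
    ContDiffAt ℝ ∞ (fun q : ℝ × E ↦ γ.nabla (fun z ↦ f (q.1, z)) q.2) (t, y) := by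
  have hΓ' : ContDiffAt ℝ ∞ (fun q : ℝ × E ↦ (γ.Γ q.2).flip) (t, y) :=
    (ContinuousLinearMap.flipₗᵢ ℝ E E E).contDiff.contDiffAt.comp (t, y)
      (ContDiffAt.comp (t, y) (γ.contDiffAt_Γ hΩ hy) contDiffAt_snd)
  exact (contDiffAt_fderiv_snd hf).add (hΓ'.clm_apply hf)

omit [FiniteDimensional ℝ E] in
lemma hasDerivAt_nabla_family {f : ℝ × E → E} (hf : ContDiffAt ℝ ∞ f (t, y)) :
    HasDerivAt (fun s ↦ γ.nabla (fun z ↦ f (s, z)) y)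
      (γ.nabla (fun z ↦ deriv (fun s ↦ f (s, z)) t) y) t := by
  have h := hasDerivAt_fst (hf.differentiableAt (by simp))
  have h' := (γ.Γ y).flip.hasFDerivAt.comp_hasDerivAt t h
  rw [← h.deriv] at h'
  exact (hasDerivAt_fderiv_snd hf).add h'

end LocalMetric

namespace Metric

variable {m : ℕ} {M : Type*} [TopologicalSpace M] [ChartedSpace (Model m) M]
  [IsManifold (𝓡 m) ∞ M] (g : Metric m M) {ε : ℝ} {W : ℝ → ∀ x : M, TangentSpace (𝓡 m) x}

variable (W ε) in
/-- A family of vector fields which is jointly smooth in the parameter `t ∈ (-ε, ε)` and the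
point. -/
def SmoothFamily : Prop :=
  ContMDiffOn (𝓘(ℝ, ℝ).prod (𝓡 m)) (𝓡 m).tangent ∞
    (fun q : ℝ × M ↦ TotalSpace.mk' (Model m) (E := fun x : M ↦ TangentSpace (𝓡 m) x)
      q.2 (W q.1 q.2)) (Set.Ioo (-ε) ε ×ˢ Set.univ)

omit g in
lemma SmoothFamily.contMDiff (hW : SmoothFamily ε W) {t : ℝ} (ht : t ∈ Ioo (-ε) ε) :
    ContMDiff (𝓡 m) (𝓡 m).tangent ∞ (T% (W t)) := by
  have h : ContMDiff (𝓡 m) (𝓘(ℝ, ℝ).prod (𝓡 m)) ∞ (fun p : M ↦ (t, p)) :=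
    contMDiff_const.prodMk contMDiff_id
  exact contMDiffOn_univ.1 (ContMDiffOn.comp hW h.contMDiffOn fun p _ ↦ ⟨ht, mem_univ p⟩)

omit g in
lemma SmoothFamily.contDiffAt_hat (hW : SmoothFamily ε W) {t : ℝ} (ht : t ∈ Ioo (-ε) ε) {x₀ : M}
    {y : Model m} (hy : y ∈ (chartAt (Model m) x₀).target) :
    ContDiffAt ℝ ∞ (fun q : ℝ × Model m ↦ hat x₀ (W q.1) q.2) (t, y) := by
  have hs := symm_mem hy
  have h₁ : ContMDiffAt 𝓘(ℝ, ℝ × Model m) (𝓘(ℝ, ℝ).prod (𝓡 m)) ∞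
      (fun q : ℝ × Model m ↦ (q.1, (chartAt (Model m) x₀).symm q.2)) (t, y) :=
    contDiff_fst.contMDiff.contMDiffAt.prodMk
      ((contMDiffAt_chart_symm hy).comp (t, y) contDiff_snd.contMDiff.contMDiffAt)
  have h₂ := (ContMDiffOn.contMDiffAt hW ((isOpen_Ioo.prod isOpen_univ).mem_nhds
    (⟨ht, mem_univ _⟩ : (t, (chartAt (Model m) x₀).symm y) ∈ Ioo (-ε) ε ×ˢ univ)))
  have h₃ := (((trivializationAt (Model m) (fun p : M ↦ TangentSpace (𝓡 m) p) x₀).contMDiffAt_iff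
    (IB := 𝓡 m) ((Trivialization.mem_source _).2 (mem_baseSet hs))).1 h₂).2
  have h₄ := h₃.comp (t, y) h₁
  refine (contMDiffAt_iff_contDiffAt.1 h₄).congr_of_eventuallyEq ?_
  filter_upwards [(continuous_snd.tendsto (t, y)).eventually (eventually_mem_target hy)] with q hq
  exact toChart_apply (symm_mem hq) _

variable (W) in
/-- The derivative at time `t` of a family of vector fields. It is taken in the coordinates of the
preferred chart at each point. -/
def variationField (t : ℝ) (p : M) : TangentSpace (𝓡 m) p :=
  ofChart p p (deriv (fun s ↦ toChart p p (W s p)) t)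

omit g in
lemma SmoothFamily.hat_variationField (hW : SmoothFamily ε W) {t : ℝ} (ht : t ∈ Ioo (-ε) ε)
    {x₀ : M} {y : Model m} :
    hat x₀ (variationField W t) y = deriv (fun s ↦ hat x₀ (W s) y) t := by
  set p := (chartAt (Model m) x₀).symm y with hp
  have hpp := mem_chart_source (Model m) p
  have hyp := (chartAt (Model m) p).map_source hpp
  have h := hasDerivAt_fst ((hW.contDiffAt_hat ht hyp).differentiableAt (by simp))
  have h' : HasDerivAt (fun s ↦ toChart p p (W s p))
      (deriv (fun s ↦ toChart p p (W s p)) t) t := by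
    simp only [hat] at h
    rw [(chartAt (Model m) p).left_inv hpp] at h
    exact h.differentiableAt.hasDerivAt
  have h₂ :=
    (toChart x₀ p ∘L ofChart p p : Model m →L[ℝ] Model m).hasFDerivAt.comp_hasDerivAt t h'
  have h₃ : (fun s ↦ (toChart x₀ p ∘L ofChart p p : Model m →L[ℝ] Model m) (toChart p p (W s p)))
      = fun s ↦ hat x₀ (W s) y := by
    funext s
    exact congrArg (toChart x₀ p) (ofChart_toChart hpp (W s p))
  exact (h₃ ▸ h₂ : HasDerivAt (fun s ↦ hat x₀ (W s) y) _ t).deriv.symm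

omit g in
lemma SmoothFamily.contMDiff_variationField (hW : SmoothFamily ε W) {t : ℝ}
    (ht : t ∈ Ioo (-ε) ε) : ContMDiff (𝓡 m) (𝓡 m).tangent ∞ (T% (variationField W t)) := by
  intro p
  have hpp := mem_chart_source (Model m) p
  have hyp := (chartAt (Model m) p).map_source hpp
  refine contMDiffAt_of_contDiffAt_hat hpp ?_
  have h : ContDiffAt ℝ ∞ (fun z ↦ deriv (fun s ↦ hat p (W s) z) t) (chartAt (Model m) p p) :=
    (contDiffAt_deriv_fst (hW.contDiffAt_hat ht hyp)).comp (chartAt (Model m) p p)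
      (contDiffAt_const.prodMk contDiffAt_id)
  refine h.congr_of_eventuallyEq ?_
  exact .of_forall fun z ↦ hW.hat_variationField ht

/-- The energy density of a vector field. -/
def energyDensity (V : ∀ x : M, TangentSpace (𝓡 m) x) (p : M) : ℝ :=
  g.tr p (g.pullbackSasaki V p)

lemma energyDensity_chart (hW : SmoothFamily ε W) {t : ℝ} (ht : t ∈ Ioo (-ε) ε)
    {x₀ : M} {y : Model m} (hy : y ∈ (chartAt (Model m) x₀).target) :
    g.energyDensity (W t) ((chartAt (Model m) x₀).symm y)
      = m + pairing ((g.inChart x₀).G y) ((g.inChart x₀).nabla (hat x₀ (W t)) y)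
        ((g.inChart x₀).nabla (hat x₀ (W t)) y) :=
  g.tr_pullbackSasaki hy ((hW.contMDiff ht _).mdifferentiableAt (by simp))

lemma contDiffAt_energyDensity (hW : SmoothFamily ε W) {t : ℝ} (ht : t ∈ Ioo (-ε) ε)
    {x₀ : M} {y : Model m} (hy : y ∈ (chartAt (Model m) x₀).target) :
    ContDiffAt ℝ ∞ (fun q : ℝ × Model m ↦
      g.energyDensity (W q.1) ((chartAt (Model m) x₀).symm q.2)) (t, y) := by
  have h := (g.inChart x₀).contDiffAt_pairing hy isOpen_target
    ((g.inChart x₀).contDiffAt_nabla_family hy isOpen_target (hW.contDiffAt_hat ht hy))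
  refine ((contDiffAt_const (c := (m : ℝ))).add h).congr_of_eventuallyEq ?_
  filter_upwards [(isOpen_Ioo.prod isOpen_target).mem_nhds
    (⟨ht, hy⟩ : (t, y) ∈ Ioo (-ε) ε ×ˢ (chartAt (Model m) x₀).target)] with q hq
    using g.energyDensity_chart hW hq.1 hq.2

/-- The derivative of the energy density along a variation. -/
lemma deriv_energyDensity (hW : SmoothFamily ε W) {t : ℝ} (ht : t ∈ Ioo (-ε) ε)
    {x₀ : M} {y : Model m} (hy : y ∈ (chartAt (Model m) x₀).target) :
    deriv (fun s ↦ g.energyDensity (W s) ((chartAt (Model m) x₀).symm y)) t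
      = 2 * pairing ((g.inChart x₀).G y)
        ((g.inChart x₀).nabla (hat x₀ (variationField W t)) y)
        ((g.inChart x₀).nabla (hat x₀ (W t)) y) := by
  have h₁ := (g.inChart x₀).hasDerivAt_nabla_family (hW.contDiffAt_hat ht hy)
  have h₂ : hat x₀ (variationField W t) = fun z ↦ deriv (fun s ↦ hat x₀ (W s) z) t :=
    funext fun z ↦ hW.hat_variationField ht
  simp only at h₁
  rw [← h₂] at h₁
  have h₃ := ((g.inChart x₀).hasDerivAt_pairing hy h₁).const_add (m : ℝ)
  refine (h₃.congr_of_eventuallyEq ?_).deriv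
  filter_upwards [isOpen_Ioo.mem_nhds ht] with s hs using g.energyDensity_chart hW hs hy

end Metric

/-! ### The first variation of the energy -/

namespace Metric

variable {m : ℕ} {M : Type*} [TopologicalSpace M] [ChartedSpace (Model m) M]
  [IsManifold (𝓡 m) ∞ M] (g : Metric m M) {ε : ℝ} {W : ℝ → ∀ x : M, TangentSpace (𝓡 m) x}

lemma hasDerivAt_energyDensity (hW : SmoothFamily ε W) {t : ℝ} (ht : t ∈ Ioo (-ε) ε) (p : M) :
    HasDerivAt (fun s ↦ g.energyDensity (W s) p)
      (deriv (fun s ↦ g.energyDensity (W s) p) t) t := by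
  have hp := mem_chart_source (Model m) p
  have h := hasDerivAt_fst ((g.contDiffAt_energyDensity hW ht
    ((chartAt (Model m) p).map_source hp)).differentiableAt (by simp))
  simp only [(chartAt (Model m) p).left_inv hp] at h
  exact h.differentiableAt.hasDerivAt

lemma continuous_energyDensity (hW : SmoothFamily ε W) {t : ℝ} (ht : t ∈ Ioo (-ε) ε) :
    Continuous (g.energyDensity (W t)) := by
  refine continuous_iff_continuousAt.2 fun p ↦ ?_
  have hp := mem_chart_source (Model m) p
  exact continuousAt_of_chart hp (ContinuousAt.comp (g := fun q : ℝ × Model m ↦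
      g.energyDensity (W q.1) ((chartAt (Model m) p).symm q.2)) (f := fun y ↦ (t, y))
    (g.contDiffAt_energyDensity hW ht ((chartAt (Model m) p).map_source hp)).continuousAt
    (continuousAt_const.prodMk continuousAt_id))

lemma continuousAt_deriv_energyDensity (hW : SmoothFamily ε W) {t : ℝ} (ht : t ∈ Ioo (-ε) ε)
    (p : M) : ContinuousAt
      (fun q : ℝ × M ↦ deriv (fun s ↦ g.energyDensity (W s) q.2) q.1) (t, p) := by
  have hp := mem_chart_source (Model m) p
  have h := (contDiffAt_deriv_fst (g.contDiffAt_energyDensity hW ht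
    ((chartAt (Model m) p).map_source hp))).continuousAt
  have hc : ContinuousAt (fun q : ℝ × M ↦ (q.1, chartAt (Model m) p q.2)) (t, p) :=
    continuousAt_fst.prodMk (((chartAt (Model m) p).continuousAt hp).comp continuousAt_snd)
  refine (ContinuousAt.comp (f := fun q : ℝ × M ↦ (q.1, chartAt (Model m) p q.2)) h hc).congr ?_
  filter_upwards [(continuous_snd.tendsto (t, p)).eventually
    ((chartAt (Model m) p).open_source.mem_nhds hp)] with q hq
  simp only [Function.comp_apply]
  rw [(chartAt (Model m) p).left_inv hq]

lemma energyDensity_congr {t s : ℝ} (hW : SmoothFamily ε W) (ht : t ∈ Ioo (-ε) ε)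
    (hs : s ∈ Ioo (-ε) ε) {p : M} (h : ∀ᶠ q in 𝓝 p, W t q = W s q) :
    g.energyDensity (W t) p = g.energyDensity (W s) p := by
  have hp := mem_chart_source (Model m) p
  have hy := (chartAt (Model m) p).map_source hp
  have h₁ := g.energyDensity_chart hW ht hy
  have h₂ := g.energyDensity_chart hW hs hy
  have h₃ : hat p (W t) =ᶠ[𝓝 (chartAt (Model m) p p)] hat p (W s) := by
    have h' : ∀ᶠ q in 𝓝 ((chartAt (Model m) p).symm (chartAt (Model m) p p)), W t q = W s q := by
      rwa [(chartAt (Model m) p).left_inv hp]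
    filter_upwards [eventually_chart_symm hy h'] with z hz using congrArg (toChart p _) hz
  rw [(chartAt (Model m) p).left_inv hp] at h₁ h₂
  rw [h₁, h₂, (g.inChart p).nabla_congr h₃]

variable [T2Space M] [SecondCountableTopology M] [MeasurableSpace M] [BorelSpace M]

omit [SecondCountableTopology M] [MeasurableSpace M] [BorelSpace M] in
lemma deriv_energyDensity_eq_zero (hW : SmoothFamily ε W) {K : Set M} (hK : IsCompact K)
    (hKW : ∀ t ∈ Ioo (-ε) ε, ∀ x ∉ K, W t x = W 0 x) {t : ℝ} (ht : t ∈ Ioo (-ε) ε) {p : M}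
    (hp : p ∉ K) : deriv (fun s ↦ g.energyDensity (W s) p) t = 0 := by
  have h0 : (0 : ℝ) ∈ Ioo (-ε) ε := ⟨by linarith [ht.1, ht.2], by linarith [ht.1, ht.2]⟩
  have h : (fun s ↦ g.energyDensity (W s) p) =ᶠ[𝓝 t] fun _ ↦ g.energyDensity (W 0) p := by
    filter_upwards [isOpen_Ioo.mem_nhds ht] with s hs
    refine g.energyDensity_congr hW hs h0 ?_
    filter_upwards [hK.isClosed.isOpen_compl.mem_nhds hp] with q hq using hKW s hs q hq
  rw [h.deriv_eq, deriv_const]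

omit [SecondCountableTopology M] in
/-- Differentiation of the energy under the integral sign. -/
theorem hasDerivAt_energy (hε : 0 < ε) (hW : SmoothFamily ε W) {D K : Set M}
    (hDc : IsCompact (closure D)) (hK : IsCompact K) (hKD : K ⊆ D)
    (hKW : ∀ t ∈ Ioo (-ε) ε, ∀ x ∉ K, W t x = W 0 x) :
    HasDerivAt (fun t ↦ g.energy D (W t))
      (1 / 2 * ∫ p, deriv (fun s ↦ g.energyDensity (W s) p) 0 ∂g.volumeMeasure) 0 := by
  have h0 : (0 : ℝ) ∈ Ioo (-ε) ε := ⟨by linarith, hε⟩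
  have hsub : Icc (-(ε / 2)) (ε / 2) ⊆ Ioo (-ε) ε := fun t ht ↦
    ⟨by linarith [ht.1, ht.2], by linarith [ht.1, ht.2]⟩
  obtain ⟨C, hC⟩ := (isCompact_Icc (a := -(ε / 2)) (b := ε / 2)).prod hK
    |>.exists_bound_of_continuousOn (f := fun q : ℝ × M ↦
      deriv (fun s ↦ g.energyDensity (W s) q.2) q.1) fun q hq ↦
      (g.continuousAt_deriv_energyDensity hW (hsub hq.1) q.2).continuousWithinAt
  have hF' : Continuous fun p ↦ deriv (fun s ↦ g.energyDensity (W s) p) 0 :=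
    continuous_iff_continuousAt.2 fun p ↦ ContinuousAt.comp (f := fun p : M ↦ ((0 : ℝ), p))
      (g.continuousAt_deriv_energyDensity hW h0 p) (continuousAt_const.prodMk continuousAt_id)
  have hint : IntegrableOn (g.energyDensity (W 0)) D g.volumeMeasure :=
    ((g.continuous_energyDensity hW h0).continuousOn.integrableOn_compact hDc).mono_set
      subset_closure
  have key := (hasDerivAt_integral_of_dominated_loc_of_deriv_le
    (μ := g.volumeMeasure.restrict D) (F := fun t ↦ g.energyDensity (W t)) (x₀ := 0)
    (F' := fun t p ↦ deriv (fun s ↦ g.energyDensity (W s) p) t)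
    (bound := K.indicator fun _ ↦ C)
    (Icc_mem_nhds (a := -(ε / 2)) (b := ε / 2) (by linarith) (by linarith)) ?_ hint
    hF'.aestronglyMeasurable ?_ ?_ ?_).2
  · have h₁ : ∫ p in D, deriv (fun s ↦ g.energyDensity (W s) p) 0 ∂g.volumeMeasure
        = ∫ p, deriv (fun s ↦ g.energyDensity (W s) p) 0 ∂g.volumeMeasure :=
      setIntegral_eq_integral_of_forall_compl_eq_zero fun p hp ↦
        g.deriv_energyDensity_eq_zero hW hK hKW h0 fun h ↦ hp (hKD h)
    rw [← h₁]
    exact key.const_mul (1 / 2 : ℝ)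
  · filter_upwards [isOpen_Ioo.mem_nhds h0] with t ht
    exact (g.continuous_energyDensity hW ht).aestronglyMeasurable
  · refine .of_forall fun p t ht ↦ ?_
    by_cases hp : p ∈ K
    · rw [indicator_of_mem hp]
      exact hC (t, p) ⟨ht, hp⟩
    · rw [indicator_of_notMem hp]
      simp [g.deriv_energyDensity_eq_zero hW hK hKW (hsub ht) hp]
  · refine (IntegrableOn.integrable_indicator ?_ hK.measurableSet).mono_measure
      Measure.restrict_le_self
    exact integrableOn_const hK.measure_lt_top.ne
  · exact .of_forall fun p t ht ↦ g.hasDerivAt_energyDensity hW (hsub ht) p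

end Metric

/-! ### The first variation of the energy at the Reeb vector field -/

lemma LocalMetric.continuousAt_ric {E : Type*} [NormedAddCommGroup E] [NormedSpace ℝ E]
    [FiniteDimensional ℝ E] {Ω : Set E} (γ : LocalMetric Ω) (hΩ : IsOpen Ω) {y : E} (hy : y ∈ Ω)
    {u v : E → E} (hu : ContinuousAt u y) (hv : ContinuousAt v y) :
    ContinuousAt (fun z ↦ γ.ric z (u z) (v z)) y := by
  let b := finBasis ℝ E
  have hΓ := γ.contDiffAt_Γ hΩ hy
  have h₁ : ContinuousAt γ.Γ y := hΓ.continuousAt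
  have h₂ : ContinuousAt (fderiv ℝ γ.Γ) y := (hΓ.fderiv_right (m := ∞) (by simp)).continuousAt
  have hc : ∀ c : E, ContinuousAt (fun z ↦ γ.curv z (u z) c (v z)) y := fun c ↦ by
    simp only [curv, add_apply, sub_apply, ContinuousLinearMap.comp_apply]
    fun_prop
  have h : ∀ z, γ.ric z (u z) (v z)
      = ∑ i, LinearMap.toContinuousLinearMap (b.coord i) (γ.curv z (u z) (b i) (v z)) := fun z ↦ by
    rw [ric, traceCLM_eq_sum b]
    rfl
  simp only [h]
  exact tendsto_finsetSum _ fun i _ ↦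
    ((LinearMap.toContinuousLinearMap (b.coord i)).continuous.continuousAt.comp (hc (b i)))

lemma Metric.continuousAt_ricci {m : ℕ} {M : Type*} [TopologicalSpace M]
    [ChartedSpace (Model m) M] [IsManifold (𝓡 m) ∞ M] (g : Metric m M)
    {V W : ∀ x : M, TangentSpace (𝓡 m) x} {p : M}
    (hV : ContMDiffAt (𝓡 m) (𝓡 m).tangent ∞ (T% V) p)
    (hW : ContMDiffAt (𝓡 m) (𝓡 m).tangent ∞ (T% W) p) :
    ContinuousAt (fun q ↦ g.ricci q (V q) (W q)) p := by
  have hp := mem_chart_source (Model m) p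
  have hy := (chartAt (Model m) p).map_source hp
  rw [← (chartAt (Model m) p).left_inv hp] at hV hW
  refine continuousAt_of_chart hp (((g.inChart p).continuousAt_ric isOpen_target hy
    (contDiffAt_hat hy hV).continuousAt (contDiffAt_hat hy hW).continuousAt).congr ?_)
  filter_upwards [eventually_mem_target hy] with z hz using (g.ricci_eq hz _ _).symm

namespace ParacontactMetricStructure

variable {n : ℕ} {M : Type*} [TopologicalSpace M] [ChartedSpace (Model (2 * n + 1)) M]
  [IsManifold (𝓡 (2 * n + 1)) ∞ M] (S : ParacontactMetricStructure n M)
  {ε : ℝ} {W : ℝ → ∀ x : M, TangentSpace (𝓡 (2 * n + 1)) x}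

/-- The variation field of a variation of `ξ` through unit fields is orthogonal to `ξ`. -/
lemma val_ξ_variationField (hε : 0 < ε) (hW : Metric.SmoothFamily ε W) (hW0 : W 0 = S.ξ)
    (hr : ∀ t ∈ Ioo (-ε) ε, S.g.HasLength (W t) 1) (p : M) :
    S.g.val p (S.ξ p) (Metric.variationField W 0 p) = 0 := by
  have h0 : (0 : ℝ) ∈ Ioo (-ε) ε := ⟨by linarith, hε⟩
  have hp := mem_chart_source (Model (2 * n + 1)) p
  set y := chartAt (Model (2 * n + 1)) p p with hyd
  have hy : y ∈ (chartAt (Model (2 * n + 1)) p).target :=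
    (chartAt (Model (2 * n + 1)) p).map_source hp
  have hpy : (chartAt (Model (2 * n + 1)) p).symm y = p :=
    (chartAt (Model (2 * n + 1)) p).left_inv hp
  suffices h : (S.g.inChart p).G y (hat p S.ξ y) (hat p (Metric.variationField W 0) y) = 0 by
    rw [hat, hat, S.g.inChart_G_toChart hy, hpy] at h
    exact h
  have h₁ := (hasDerivAt_fst ((hW.contDiffAt_hat h0 hy).differentiableAt (by simp)))
  rw [← h₁.deriv] at h₁
  simp only at h₁
  rw [← hW.hat_variationField h0] at h₁
  have h₂ := ((hasDerivAt_const (0 : ℝ) ((S.g.inChart p).G y)).clm_apply h₁).clm_apply h₁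
  have h₃ : (fun t ↦ (S.g.inChart p).G y (hat p (W t) y) (hat p (W t) y)) =ᶠ[𝓝 0]
      fun _ ↦ (1 : ℝ) := by
    filter_upwards [isOpen_Ioo.mem_nhds h0] with t ht
    rw [hat, S.g.inChart_G_toChart hy, hr t ht]
  have h₄ := (h₂.congr_of_eventuallyEq h₃.symm).unique (hasDerivAt_const (0 : ℝ) (1 : ℝ))
  rw [hW0] at h₄
  have hs := (S.g.inChart p).symm y hy (hat p S.ξ y) (hat p (Metric.variationField W 0) y)
  simp at h₄
  linarith

/-- The vector field `(∇ξ + 2φ) Z`, which for `Z` orthogonal to `ξ` is the adjoint of `∇ξ` applied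
to `Z`. -/
def flux (Z : ∀ x : M, TangentSpace (𝓡 (2 * n + 1)) x) (p : M) : TangentSpace (𝓡 (2 * n + 1)) p :=
  S.g.leviCivita S.ξ p (Z p) + (2 : ℝ) • S.φ p (Z p)

lemma contMDiff_flux {Z : ∀ x : M, TangentSpace (𝓡 (2 * n + 1)) x}
    (hZ : ContMDiff (𝓡 (2 * n + 1)) (𝓡 (2 * n + 1)).tangent ∞ (T% Z)) :
    ContMDiff (𝓡 (2 * n + 1)) (𝓡 (2 * n + 1)).tangent ∞ (T% (S.flux Z)) := by
  intro p
  have hp := mem_chart_source (Model (2 * n + 1)) p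
  have hy := (chartAt (Model (2 * n + 1)) p).map_source hp
  have h₁ := S.g.contMDiffAt_nabla hy (.of_forall S.contMDiff_ξ) (hZ _)
  rw [(chartAt (Model (2 * n + 1)) p).left_inv hp] at h₁
  exact h₁.add_section (S.contMDiffAt_φ (hZ p)).const_smul_section

lemma divergence_flux {Z : ∀ x : M, TangentSpace (𝓡 (2 * n + 1)) x}
    (hZ : ContMDiff (𝓡 (2 * n + 1)) (𝓡 (2 * n + 1)).tangent ∞ (T% Z))
    (h0 : ∀ p, S.g.val p (S.ξ p) (Z p) = 0) {x₀ : M} {y : Model (2 * n + 1)}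
    (hy : y ∈ (chartAt (Model (2 * n + 1)) x₀).target) :
    S.g.divergence (S.flux Z) ((chartAt (Model (2 * n + 1)) x₀).symm y)
      = pairing ((S.g.inChart x₀).G y) ((S.g.inChart x₀).nabla (hat x₀ Z) y)
          ((S.g.inChart x₀).nabla (hat x₀ S.ξ) y)
        + S.g.ricci ((chartAt (Model (2 * n + 1)) x₀).symm y) (S.ξ _) (Z _) := by
  have h₁ := (S.inChart x₀).div_adj_nabla hy isOpen_target
    (differentiableAt_hat hy ((hZ _).mdifferentiableAt (by simp)))
    (by rw [← h0 ((chartAt (Model (2 * n + 1)) x₀).symm y)]; exact S.g.inChart_G_toChart hy _ _)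
  rw [S.g.ricci_eq hy]
  refine Eq.trans ?_ h₁
  rw [S.g.divergence_chart hy ((S.contMDiff_flux hZ _).mdifferentiableAt (by simp)),
    LocalMetric.div, LocalMetric.div, LocalMetric.nabla_congr]
  filter_upwards [Metric.eventually_mem_target hy] with z hz
  have h₂ := S.g.hat_nabla hz (V := S.ξ) (Y := Z) (S.mdifferentiable_ξ _)
  have h₃ : hat x₀ (S.flux Z) z = hat x₀ (fun p ↦ S.g.leviCivita S.ξ p (Z p)) z
      + (2 : ℝ) • toChart x₀ _ (S.φ _ (Z ((chartAt (Model (2 * n + 1)) x₀).symm z))) := by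
    simp only [hat, flux, map_add, map_smul]
  rw [h₃, h₂, add_apply, smul_apply]
  congr 2
  change _ = toChart x₀ _ (S.φ _ (ofChart x₀ _ (toChart x₀ _ _)))
  rw [ofChart_toChart (symm_mem hz)]

variable [T2Space M] [SecondCountableTopology M] [MeasurableSpace M] [BorelSpace M]

/-- The first variation of the energy at `ξ` among unit vector fields. -/
theorem hasDerivAt_energy (hε : 0 < ε) (hW : Metric.SmoothFamily ε W) (hW0 : W 0 = S.ξ)
    (hr : ∀ t ∈ Ioo (-ε) ε, S.g.HasLength (W t) 1) {D K : Set M}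
    (hDc : IsCompact (closure D)) (hK : IsCompact K) (hKD : K ⊆ D)
    (hKW : ∀ t ∈ Ioo (-ε) ε, ∀ x ∉ K, W t x = S.ξ x) :
    HasDerivAt (fun t ↦ S.g.energy D (W t))
      (-∫ p, S.g.ricci p (S.ξ p) (Metric.variationField W 0 p) ∂S.g.volumeMeasure) 0 := by
  have h0 : (0 : ℝ) ∈ Ioo (-ε) ε := ⟨by linarith, hε⟩
  rw [← hW0] at hKW
  set Z := Metric.variationField W 0 with hZ
  have hZs := hW.contMDiff_variationField h0
  have hZ0 : ∀ p ∉ K, Z p = 0 := fun p hp ↦ by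
    have h : (fun s ↦ toChart p p (W s p)) =ᶠ[𝓝 0] fun _ ↦ toChart p p (W 0 p) := by
      filter_upwards [isOpen_Ioo.mem_nhds h0] with s hs
      rw [hKW s hs p hp]
    rw [hZ, Metric.variationField, h.deriv_eq, deriv_const, map_zero]
  have hX := S.contMDiff_flux hZs
  have hX0 : ∀ p ∉ K, S.flux Z p = 0 := fun p hp ↦ by simp [flux, hZ0 p hp]
  have hdiv := S.g.integral_divergence hX hK hX0
  have hpt : ∀ p, S.g.ricci p (S.ξ p) (Z p) = S.g.divergence (S.flux Z) p
      - 1 / 2 * deriv (fun s ↦ S.g.energyDensity (W s) p) 0 := fun p ↦ by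
    have hp := mem_chart_source (Model (2 * n + 1)) p
    have hy := (chartAt (Model (2 * n + 1)) p).map_source hp
    have h₁ := S.divergence_flux hZs (S.val_ξ_variationField hε hW hW0 hr) hy
    have h₂ := S.g.deriv_energyDensity hW h0 hy
    rw [(chartAt (Model (2 * n + 1)) p).left_inv hp] at h₁ h₂
    rw [h₁, h₂, hW0]
    ring
  have hcont : Continuous fun p ↦ deriv (fun s ↦ S.g.energyDensity (W s) p) 0 :=
    continuous_iff_continuousAt.2 fun p ↦ ContinuousAt.comp (f := fun p : M ↦ ((0 : ℝ), p))
      (S.g.continuousAt_deriv_energyDensity hW h0 p) (continuousAt_const.prodMk continuousAt_id)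
  have hi₁ := (S.g.continuous_divergence hX).integrable_of_hasCompactSupport
    (μ := S.g.volumeMeasure) (HasCompactSupport.intro hK fun p hp ↦
      S.g.divergence_of_eventuallyEq_zero ((hX p).mdifferentiableAt (by simp)) (by
        filter_upwards [hK.isClosed.isOpen_compl.mem_nhds hp] with q hq using hX0 q hq))
  have hi₂ := hcont.integrable_of_hasCompactSupport (μ := S.g.volumeMeasure)
    (HasCompactSupport.intro hK fun p hp ↦ S.g.deriv_energyDensity_eq_zero hW hK hKW h0 hp)
  have key := S.g.hasDerivAt_energy hε hW hDc hK hKD hKW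
  refine key.congr_deriv ?_
  simp only [hpt]
  rw [integral_sub hi₁ (hi₂.const_mul _), hdiv, integral_const_mul]
  ring

end ParacontactMetricStructure

/-! ### Variations through unit vector fields -/

namespace Metric

variable {m : ℕ} {M : Type*} [TopologicalSpace M] [ChartedSpace (Model m) M]
  [IsManifold (𝓡 m) ∞ M] (g : Metric m M) {ε : ℝ} {V Z : ∀ x : M, TangentSpace (𝓡 m) x}

omit g in
lemma smoothFamily_smul_add {a b : ℝ × M → ℝ}
    (ha : ContMDiffOn (𝓘(ℝ, ℝ).prod (𝓡 m)) 𝓘(ℝ, ℝ) ∞ a (Ioo (-ε) ε ×ˢ univ))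
    (hb : ContMDiffOn (𝓘(ℝ, ℝ).prod (𝓡 m)) 𝓘(ℝ, ℝ) ∞ b (Ioo (-ε) ε ×ˢ univ))
    (hV : ContMDiff (𝓡 m) (𝓡 m).tangent ∞ (T% V)) (hZ : ContMDiff (𝓡 m) (𝓡 m).tangent ∞ (T% Z)) :
    SmoothFamily ε fun t p ↦ a (t, p) • V p + b (t, p) • Z p := by
  intro q hq
  have hp := mem_chart_source (Model m) q.2
  set e := trivializationAt (Model m) (fun p : M ↦ TangentSpace (𝓡 m) p) q.2
  have he : ∀ {Y : ∀ x : M, TangentSpace (𝓡 m) x}, ContMDiff (𝓡 m) (𝓡 m).tangent ∞ (T% Y) →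
      ContMDiffWithinAt (𝓘(ℝ, ℝ).prod (𝓡 m)) 𝓘(ℝ, Model m) ∞
        (fun q' : ℝ × M ↦ toChart q.2 q'.2 (Y q'.2)) (Ioo (-ε) ε ×ˢ univ) q := fun {Y} hY ↦ by
    have h := ((e.contMDiffAt_section_iff (mem_baseSet hp)).1 (hY q.2)).comp q
      (contMDiffAt_snd (I := 𝓘(ℝ, ℝ)))
    refine (h.congr_of_eventuallyEq ?_).contMDiffWithinAt
    filter_upwards [(continuous_snd.tendsto q).eventually
      ((chartAt (Model m) q.2).open_source.mem_nhds hp)] with q' hq'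
    exact toChart_apply hq' _
  refine (e.contMDiffWithinAt_iff ((Trivialization.mem_source _).2 (mem_baseSet hp))).2
    ⟨contMDiffWithinAt_snd, ?_⟩
  refine (((ha q hq).smul (he hV)).add ((hb q hq).smul (he hZ))).congr_of_eventuallyEq_of_mem ?_ hq
  refine eventually_nhdsWithin_of_eventually_nhds ?_
  filter_upwards [(continuous_snd.tendsto q).eventually
    ((chartAt (Model m) q.2).open_source.mem_nhds hp)] with q' hq'
  refine (toChart_apply hq' _).symm.trans ?_
  rw [map_add, map_smul, map_smul]
  rfl

/-- The variation of a unit field `V` in the direction of a field `Z` orthogonal to it, namely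
`V + t Z` rescaled to unit length. -/
def unitVariation (V Z : ∀ x : M, TangentSpace (𝓡 m) x) (t : ℝ) (p : M) : TangentSpace (𝓡 m) p :=
  (√(1 + t ^ 2 * g.val p (Z p) (Z p)))⁻¹ • V p + (t * (√(1 + t ^ 2 * g.val p (Z p) (Z p)))⁻¹) • Z p

lemma unitVariation_zero : g.unitVariation V Z 0 = V := by
  funext p
  simp [unitVariation]

lemma unitVariation_of_eq_zero (t : ℝ) {p : M} (hp : Z p = 0) :
    g.unitVariation V Z t p = V p := by
  simp [unitVariation, hp]

lemma val_unitVariation {t : ℝ} {p : M} (hV : g.val p (V p) (V p) = 1)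
    (h0 : g.val p (V p) (Z p) = 0) (ht : 0 < 1 + t ^ 2 * g.val p (Z p) (Z p)) :
    g.val p (g.unitVariation V Z t p) (g.unitVariation V Z t p) = 1 := by
  have h0' : g.val p (Z p) (V p) = 0 := by rw [g.symm, h0]
  have hs := Real.sq_sqrt ht.le
  have hs' := (Real.sqrt_pos.2 ht).ne'
  simp only [unitVariation, map_add, map_smul, add_apply, smul_apply, smul_eq_mul, hV, h0, h0']
  field_simp
  linarith

lemma smoothFamily_unitVariation (hV : ContMDiff (𝓡 m) (𝓡 m).tangent ∞ (T% V))
    (hZ : ContMDiff (𝓡 m) (𝓡 m).tangent ∞ (T% Z))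
    (h : ∀ t ∈ Ioo (-ε) ε, ∀ p, 0 < 1 + t ^ 2 * g.val p (Z p) (Z p)) :
    SmoothFamily ε (g.unitVariation V Z) := by
  have hG : ContMDiff (𝓡 m) 𝓘(ℝ, ℝ) ∞ fun p ↦ g.val p (Z p) (Z p) := fun p ↦
    g.contMDiffAt_val (hZ p) (hZ p)
  have hA : ContMDiff (𝓘(ℝ, ℝ).prod (𝓡 m)) 𝓘(ℝ, ℝ) ∞
      fun q : ℝ × M ↦ 1 + q.1 ^ 2 * g.val q.2 (Z q.2) (Z q.2) :=
    contMDiff_const.add ((contMDiff_fst.pow 2).mul (hG.comp contMDiff_snd))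
  have ha : ContMDiffOn (𝓘(ℝ, ℝ).prod (𝓡 m)) 𝓘(ℝ, ℝ) ∞
      (fun q : ℝ × M ↦ (√(1 + q.1 ^ 2 * g.val q.2 (Z q.2) (Z q.2)))⁻¹)
      (Ioo (-ε) ε ×ˢ univ) := fun q hq ↦ by
    have hpos := h q.1 hq.1 q.2
    have hs : ContDiffAt ℝ ∞ (fun s : ℝ ↦ (√s)⁻¹)
        (1 + q.1 ^ 2 * g.val q.2 (Z q.2) (Z q.2)) :=
      (Real.contDiffAt_sqrt hpos.ne').inv (Real.sqrt_pos.2 hpos).ne'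
    exact (hs.contMDiffAt.comp q (hA q)).contMDiffWithinAt
  exact smoothFamily_smul_add ha (contMDiffOn_fst.mul ha) hV hZ

lemma variationField_unitVariation (p : M) :
    variationField (g.unitVariation V Z) 0 p = Z p := by
  have hp := mem_chart_source (Model m) p
  have h₁ : HasDerivAt (fun t : ℝ ↦ (√(1 + t ^ 2 * g.val p (Z p) (Z p)))⁻¹) 0 0 := by
    have h : HasDerivAt (fun t : ℝ ↦ 1 + t ^ 2 * g.val p (Z p) (Z p)) 0 0 := by
      have := (((hasDerivAt_id (0 : ℝ)).pow 2).mul_const (g.val p (Z p) (Z p))).const_add 1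
      simpa using this
    exact ((h.sqrt (by simp)).inv (by simp)).congr_deriv (by simp)
  have h₂ : HasDerivAt (fun t : ℝ ↦ t * (√(1 + t ^ 2 * g.val p (Z p) (Z p)))⁻¹) 1 0 := by
    exact ((hasDerivAt_id (0 : ℝ)).mul h₁).congr_deriv (by simp)
  have h₃ : HasDerivAt (fun t ↦ toChart p p (g.unitVariation V Z t p)) (toChart p p (Z p)) 0 := by
    have := (h₁.smul_const (toChart p p (V p))).add (h₂.smul_const (toChart p p (Z p)))
    simp only [zero_smul, one_smul, zero_add] at this
    refine this.congr_of_eventuallyEq (.of_forall fun t ↦ ?_)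
    simp only [unitVariation, map_add, map_smul, Pi.add_apply]
  rw [variationField, h₃.deriv, ofChart_toChart hp]

end Metric

namespace ParacontactMetricStructure

variable {n : ℕ} {M : Type*} [TopologicalSpace M] [ChartedSpace (Model (2 * n + 1)) M]
  [IsManifold (𝓡 (2 * n + 1)) ∞ M] (S : ParacontactMetricStructure n M)

lemma ξ_ne_zero (x : M) : S.ξ x ≠ 0 := fun h ↦ by
  have := S.η_ξ x
  rw [h, map_zero] at this
  exact zero_ne_one this

lemma val_ricciOperator (x : M) (u v : TangentSpace (𝓡 (2 * n + 1)) x) :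
    S.g.val x (S.g.ricciOperator x u) v = S.g.ricci x u v :=
  LinearMap.congr_fun ((S.g.flat x).apply_symm_apply (S.g.ricci x u)) v

lemma hasEigenvector_ricciOperator_iff (x : M) (μ : ℝ) :
    (S.g.ricciOperator x).HasEigenvector μ (S.ξ x)
      ↔ ∀ v, S.g.ricci x (S.ξ x) v = μ * S.η x v := by
  rw [Module.End.hasEigenvector_iff, Module.End.mem_eigenspace_iff, and_iff_left (S.ξ_ne_zero x)]
  constructor
  · intro h v
    rw [← S.val_ricciOperator, h, S.η_eq]
    simp
  · intro h
    refine (S.g.flat x).injective (LinearMap.ext fun v ↦ ?_)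
    refine (S.val_ricciOperator x (S.ξ x) v).trans ((h v).trans ?_)
    rw [S.η_eq]
    change _ = S.g.val x (μ • S.ξ x) v
    simp

variable [T2Space M] [SecondCountableTopology M] [MeasurableSpace M] [BorelSpace M]

/-- If `ξ` is harmonic, then `∫ ρ(ξ, Z) = 0` for all compactly supported fields `Z` orthogonal
to `ξ`. -/
lemma integral_ricci_eq_zero (hS : S.IsHParacontact)
    {Z : ∀ x : M, TangentSpace (𝓡 (2 * n + 1)) x}
    (hZ : ContMDiff (𝓡 (2 * n + 1)) (𝓡 (2 * n + 1)).tangent ∞ (T% Z))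
    (h0 : ∀ p, S.g.val p (S.ξ p) (Z p) = 0) {K : Set M} (hK : IsCompact K)
    (hZK : ∀ p ∉ K, Z p = 0) :
    ∫ p, S.g.ricci p (S.ξ p) (Z p) ∂S.g.volumeMeasure = 0 := by
  rcases isEmpty_or_nonempty M with hM | ⟨⟨x⟩⟩
  · simp [integral_of_isEmpty]
  have : LocallyCompactSpace M := ChartedSpace.locallyCompactSpace (Model (2 * n + 1)) M
  obtain ⟨-, r, -, hr, hcrit⟩ := hS
  obtain rfl : r = 1 := by rw [← hr x, S.val_ξ_ξ]
  obtain ⟨D, hDo, hKD, hDc⟩ := exists_isOpen_superset_and_isCompact_closure hK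
  have hG : Continuous fun p ↦ S.g.val p (Z p) (Z p) :=
    continuous_iff_continuousAt.2 fun p ↦ (S.g.contMDiffAt_val (hZ p) (hZ p)).continuousAt
  obtain ⟨C, hC⟩ := hK.exists_bound_of_continuousOn hG.continuousOn
  -- For `|t| < ε ≤ 1` one has `t² |g(Z, Z)| ≤ ε |C| < 1`.
  set ε : ℝ := (1 + |C|)⁻¹ with hε
  have hε0 : 0 < ε := by positivity
  have hpos : ∀ t ∈ Ioo (-ε) ε, ∀ p, 0 < 1 + t ^ 2 * S.g.val p (Z p) (Z p) := by
    intro t ht p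
    by_cases hp : p ∈ K
    · have h₁ : |S.g.val p (Z p) (Z p)| ≤ |C| := (hC p hp).trans (le_abs_self C)
      have h₂ : |t| < ε := abs_lt.2 ht
      have h₃ : ε * (1 + |C|) = 1 := inv_mul_cancel₀ (by positivity)
      have h₄ : ε ≤ 1 := inv_le_one_of_one_le₀ (by linarith [abs_nonneg C])
      have h₅ : t ^ 2 ≤ ε := by
        rw [← sq_abs]
        nlinarith [abs_nonneg t]
      have h₆ : t ^ 2 * |S.g.val p (Z p) (Z p)| ≤ ε * |C| := by gcongr
      have h₇ := mul_le_mul_of_nonneg_left (neg_abs_le (S.g.val p (Z p) (Z p))) (sq_nonneg t)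
      linarith
    · simp [hZK p hp]
  have hW := S.g.smoothFamily_unitVariation S.contMDiff_ξ hZ hpos
  have hW0 : S.g.unitVariation S.ξ Z 0 = S.ξ := S.g.unitVariation_zero
  have hW1 : ∀ t ∈ Ioo (-ε) ε, S.g.HasLength (S.g.unitVariation S.ξ Z t) 1 := fun t ht p ↦
    S.g.val_unitVariation (S.val_ξ_ξ p) (h0 p) (hpos t ht p)
  have hWK : ∀ t ∈ Ioo (-ε) ε, ∀ x ∉ K, S.g.unitVariation S.ξ Z t x = S.ξ x := fun t _ x hx ↦
    S.g.unitVariation_of_eq_zero t (hZK x hx)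
  have h₁ := hcrit D hDo hDc ε hε0 _ hW hW0 hW1 ⟨K, hKD, hK, hWK⟩
  have h₂ := S.hasDerivAt_energy hε0 hW hW0 hW1 hDc hK hKD hWK
  have h₃ := h₂.unique h₁
  simp only [S.g.variationField_unitVariation] at h₃
  linarith

/-- If `ξ` is harmonic, then `ρ(ξ, ·)` is nonpositive on the orthogonal complement of `ξ` (hence
zero there, by linearity): a vector on which it is positive extends to a field orthogonal to `ξ`
and supported near the point, contradicting `integral_ricci_eq_zero`. -/
lemma ricci_nonpos (hS : S.IsHParacontact) (x : M) (v : TangentSpace (𝓡 (2 * n + 1)) x) :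
    S.g.ricci x (S.ξ x) (v - S.η x v • S.ξ x) ≤ 0 := by
  by_contra! hpos
  -- The extension of `v - η(v) ξ`: the field with constant coordinates extending `v`, projected.
  set Y : ∀ p : M, TangentSpace (𝓡 (2 * n + 1)) p := fun p ↦
    constField x (toChart x x v) p - S.g.val p (S.ξ p) (constField x (toChart x x v) p) • S.ξ p
    with hY
  have hx := mem_chart_source (Model (2 * n + 1)) x
  have hYs : ∀ p ∈ (chartAt (Model (2 * n + 1)) x).source,
      ContMDiffAt (𝓡 (2 * n + 1)) (𝓡 (2 * n + 1)).tangent ∞ (T% Y) p := fun p hp ↦ by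
    have h := contMDiffAt_constField (x₀ := x) (toChart x x v) hp
    exact h.sub_section ((S.g.contMDiffAt_val (S.contMDiff_ξ p) h).smul_section (S.contMDiff_ξ p))
  have hY0 : ∀ p, S.g.val p (S.ξ p) (Y p) = 0 := fun p ↦ by
    simp [hY, S.val_ξ_ξ]
  have hYx : Y x = v - S.η x v • S.ξ x := by
    have : constField x (toChart x x v) x = v := ofChart_toChart hx v
    simp only [hY]
    rw [this, S.η_eq]
  rw [← hYx] at hpos
  have hρ : ∀ p ∈ (chartAt (Model (2 * n + 1)) x).source,
      ContinuousAt (fun q ↦ S.g.ricci q (S.ξ q) (Y q)) p := fun p hp ↦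
    S.g.continuousAt_ricci (S.contMDiff_ξ p) (hYs p hp)
  have hO : {p | 0 < S.g.ricci p (S.ξ p) (Y p)} ∈ 𝓝 x :=
    (hρ x hx).eventually (lt_mem_nhds hpos)
  obtain ⟨f, -, hf⟩ := (SmoothBumpFunction.nhds_basis_tsupport (I := 𝓡 (2 * n + 1)) x).mem_iff.1 hO
  have hZ : ContMDiff (𝓡 (2 * n + 1)) (𝓡 (2 * n + 1)).tangent ∞ (T% (fun p ↦ f p • Y p)) :=
    ContMDiffOn.smul_section_of_tsupport f.contMDiff.contMDiffOn
      (chartAt (Model (2 * n + 1)) x).open_source f.tsupport_subset_chartAt_source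
      fun p hp ↦ (hYs p hp).contMDiffWithinAt
  have hZ0 : ∀ p ∉ tsupport f, f p • Y p = 0 := fun p hp ↦ by
    rw [image_eq_zero_of_notMem_tsupport hp, zero_smul]
  have hint := S.integral_ricci_eq_zero hS hZ (fun p ↦ by simp [hY0]) f.hasCompactSupport hZ0
  refine hint.not_gt (Continuous.integral_pos_of_hasCompactSupport_nonneg_nonzero (x := x)
    (continuous_iff_continuousAt.2 fun p ↦ S.g.continuousAt_ricci (S.contMDiff_ξ p) (hZ p))
    (HasCompactSupport.intro f.hasCompactSupport fun p hp ↦ ?_) (fun p ↦ ?_) ?_)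
  · rw [hZ0 p hp, map_zero]
  · by_cases hp : p ∈ tsupport f
    · simp only [map_smul, smul_eq_mul]
      exact mul_nonneg f.nonneg (hf hp : 0 < S.g.ricci p (S.ξ p) (Y p)).le
    · simp only [hZ0 p hp, map_zero]
      exact le_rfl
  · rw [f.eq_one, one_smul]
    exact hpos.ne'

end ParacontactMetricStructure

end SemiRiemannian

end

theorem theorem3p1 {n : ℕ} {M : Type*} [TopologicalSpace M]
    [ChartedSpace (SemiRiemannian.Model (2 * n + 1)) M]
    [IsManifold (𝓡 (2 * n + 1)) ∞ M] [T2Space M] [SecondCountableTopology M] [ConnectedSpace M]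
    [MeasurableSpace M] [BorelSpace M]
    (S : SemiRiemannian.ParacontactMetricStructure n M) :
    S.IsHParacontact ↔ S.IsRicciEigenvector := by
  constructor
  · intro hS
    refine ⟨fun x ↦ S.g.ricci x (S.ξ x) (S.ξ x),
      fun x ↦ (S.hasEigenvector_ricciOperator_iff x _).2 fun v ↦ ?_⟩
    have h₁ := S.ricci_nonpos hS x v
    have h₂ := S.ricci_nonpos hS x (-v)
    simp only [map_sub, map_neg, map_smul, smul_eq_mul, neg_smul] at h₁ h₂
    linarith
  · rintro ⟨μ, hμ⟩
    refine ⟨S.contMDiff_ξ, 1, one_ne_zero, S.val_ξ_ξ, ?_⟩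
    intro D _ hDc ε hε W hW hW0 hr ⟨K, hKD, hK, hKW⟩
    refine (S.hasDerivAt_energy hε hW hW0 hr hDc hK hKD hKW).congr_deriv ?_
    have h : ∀ p, S.g.ricci p (S.ξ p) (SemiRiemannian.Metric.variationField W 0 p) = 0 := by
      intro p
      rw [(S.hasEigenvector_ricciOperator_iff p (μ p)).1 (hμ p), S.η_eq,
        S.val_ξ_variationField hε hW hW0 hr, mul_zero]
    simp [h]
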